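/- Let $\mathfrak g=\mathfrak{so}(5)$ be the complex Lie algebra of antisymmetric $5\times5$ matrices, $M_{jk}=e_{jk}-e_{kj}$, with the root basis $$\begin{aligned} H_{1\pm2}&=-\tfrac i2(M_{12}\pm M_{34}),& H_1&=\tfrac12(H_{1+2}+H_{1-2}),\\ E_{1+2}&=\tfrac12(-M_{24}+iM_{23}+iM_{14}+M_{13}),& E_{1-2}&=\tfrac12(-M_{24}-iM_{23}+iM_{14}-M_{13}),\\ E_1&=\tfrac1{\sqrt2}(M_{25}-iM_{15}),& E_2&=-\tfrac1{\sqrt2}(-M_{45}+iM_{35}),\\ E_{-1}&=\tfrac1{\sqrt2}(-M_{25}-iM_{15}),& E_{-2}&=\tfrac1{\sqrt2}(-M_{45}-iM_{35}),\\ E_{2-1}&=\tfrac12(M_{24}-iM_{23}+iM_{14}+M_{13}),& E_{-1-2}&=\tfrac12(M_{24}+iM_{23}+iM_{14}-M_{13}). \end{aligned}$$ Let $\Delta$, $\varepsilon$ be the standard coproduct and counit of $U(\mathfrak g)$, extended $h$-linearly to formal power series in $h$. For $a,b\in U(\mathfrak g)[[h]]$ let $a\otimes b$ denote the corresponding element of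 $(U(\mathfrak g)\otimes U(\mathfrak g))[[h]]$. The symbols of the generators are rescaled by the weight of $H_{1+2}+H_{1-2}$: put $$\hat E_{1+2}=hE_{1+2},\qquad \hat E_{1-2}=hE_{1-2},\qquad \hat E_1=hE_1,$$ leaving $H_{1\pm2}$, $E_{\pm2}$, $E_{-1},E_{2-1},E_{-1-2}$ unscaled, and put $$\sigma=\ln(1+\hat E_{1+2}),\qquad E_{BO}=\hat E_{1-2}+\tfrac12\hat E_1^2e^{-\sigma},\qquad \tau=\ln(1+E_{BO}),$$ $$F_{EJ}=\exp\!\big(-E_2\otimes \hat E_1e^{-\frac12\sigma}\big)\exp\!\big(H_{1+2}\otimes\sigma\big),\qquad \Phi_{BJ}=\exp\!\big(H_{1-2}\otimes\tau\big),\qquad F_{BJEJ}=\Phi_{BJ}F_{EJ}.$$ For invertible $F$ write $\Delta_F(x)=F\,\Delta(x)\,F^{-1}$, $(\Delta_F\otimes\mathrm{id})(y)=F_{12}\,(\Delta\otimes\mathrm{id})(y)\,F_{12}^{-1}$ and $(\mathrm{id}\otimes\Delta_F)(y)=F_{23}\,(\mathrm{id}\otimes\Delta)(y)\,F_{23}^{-1}$.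 A twist for $\Delta_F$ is an invertible $\Phi$ with $\Phi_{12}(\Delta_F\otimes \mathrm{id})\Phi=\Phi_{23}(\mathrm{id}\otimes\Delta_F)\Phi$ and $(\varepsilon\otimes \mathrm{id})\Phi=1=(\mathrm{id}\otimes\varepsilon)\Phi$. Write $\Delta_{EJ}=\Delta_{F_{EJ}}$ and $\Delta_{BJEJ}=\Delta_{F_{BJEJ}}$. 1. $F_{EJ}$ is a twist of $U(\mathfrak g)$ (that is, for $\Delta$), and $$\begin{aligned} \Delta_{EJ}(H_{1+2})&=H_{1+2}\otimes e^{-\sigma}+1\otimes H_{1+2}+E_2\otimes\hat E_1e^{-\frac32\sigma},\\ \Delta_{EJ}(\hat E_{1+2})&=\hat E_{1+2}\otimes e^{\sigma}+1\otimes\hat E_{1+2},\\ \Delta_{EJ}(E_2)&=E_2\otimes e^{-\frac12\sigma}+1\otimes E_2,\\ \Delta_{EJ}(\hat E_1)&=\hat E_1\otimes e^{\frac12\sigma}+e^{\sigma}\otimes\hat E_1,\\ \Delta_{EJ}(\hat E_{1-2})&=\hat E_{1-2}\otimes1+1\otimes\hat E_{1-2}-\hat E_1\otimes\hat E_1e^{-\frac12\sigma}-\tfrac12\hat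 E_{1+2}\otimes\hat E_1^2e^{-\sigma}. \end{aligned}$$ The elements $H_{1-2}$ and $E_{BO}$ are primitive: $\Delta_{EJ}(x)=x\otimes1+1\otimes x$ for both. 2. $\Phi_{BJ}$ is a twist for $\Delta_{EJ}$, and $F_{BJEJ}$ is a twist of $U(\mathfrak g)$. Hence $U(\mathfrak g)[[h]]$ with its product, $\Delta_{BJEJ}$ and $\varepsilon$ is a bialgebra: $\Delta_{BJEJ}$ is a unital ring homomorphism, coassociative, and counital. If $U(L^{(6)})$ denotes the subalgebra of $U(\mathfrak g)$ generated by $H_{1\pm2},E_{1\pm2},E_1,E_2$, then $\Delta_{BJEJ}$ maps $U(L^{(6)})$ into $(U(L^{(6)})\otimes U(L^{(6)}))[[h]]$. 3. The coproducts of the generators are $$\begin{aligned} \Delta_{BJEJ}(H_{1+2})={}&H_{1+2}\otimes e^{-\sigma}+1\otimes H_{1+2}+E_2\otimes\hat E_1e^{-\frac32\sigma-\frac12\tau}-\tfrac12H_{1-2}\otimes\hat E_1^2e^{-2\sigma-\tau},\\ \Delta_{BJEJ}(H_{1-2})={}&H_{1-2}\otimes e^{-\tau}+1\otimes H_{1-2},\\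 \Delta_{BJEJ}(\hat E_{1+2})={}&\hat E_{1+2}\otimes e^{\sigma}+1\otimes\hat E_{1+2},\\ \Delta_{BJEJ}(E_2)={}&E_2\otimes e^{-\frac12\sigma-\frac12\tau}+1\otimes E_2-H_{1-2}\otimes\hat E_1e^{-\sigma-\tau},\\ \Delta_{BJEJ}(\hat E_1)={}&\hat E_1\otimes e^{\frac12\sigma+\frac12\tau}+e^{\sigma}\otimes\hat E_1,\\ \Delta_{BJEJ}(\hat E_{1-2})={}&\hat E_{1-2}\otimes e^{\tau}+1\otimes\hat E_{1-2}-\hat E_1\otimes\hat E_1e^{-\frac12\sigma+\frac12\tau}-\tfrac12\hat E_{1+2}\otimes\hat E_1^2e^{-\sigma},\\ \Delta_{BJEJ}(E_{BO})={}&E_{BO}\otimes e^{\tau}+1\otimes E_{BO},\\ \Delta_{BJEJ}(E_{-2})={}&E_{-2}\otimes e^{\frac12(\tau-\sigma)}+1\otimes E_{-2}+E_2\otimes(1-e^{-\tau})e^{\frac12(\tau-\sigma)}+H_{1-2}\otimes\hat E_1e^{-\sigma-\tau}, \end{aligned}$$ $$\begin{aligned} \Delta_{BJEJ}(E_{-1})={}&E_{-1}\otimes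 e^{-\frac12(\sigma+\tau)}+1\otimes E_{-1}+E_{2-1}\otimes\hat E_1e^{-\sigma-\tau}\\ &+h\Big[H_{1-2}\otimes\big(E_{-2}+2H_1\hat E_1e^{-\sigma}+\tfrac12\hat E_1^2E_2e^{-2\sigma}\big)e^{-\tau}\\ &\quad+\tfrac12H_{1-2}\otimes\hat E_1\big((\hat E_1^2e^{-2\sigma}-2)e^{-\tau}+1\big)e^{-\sigma-\tau}\\ &\quad-\tfrac12H_{1-2}^2\otimes\hat E_1\big((\hat E_1^2e^{-2\sigma}-2)e^{-\tau}+2\big)e^{-\sigma-\tau}\\ &\quad+H_{1-2}E_2\otimes\big((\tfrac32\hat E_1^2e^{-2\sigma}-1)e^{-\tau}+1\big)e^{-\frac12(\sigma+\tau)}\\ &\quad-H_{1+2}\otimes E_2e^{-\sigma}+H_{1+2}H_{1-2}\otimes\hat E_1e^{-2\sigma-\tau}+H_{1+2}E_2\otimes(1-e^{-\sigma})e^{-\frac12(\sigma+\tau)}\\ &\quad-E_2\otimes\big(2H_1+\hat E_1E_2e^{-\sigma}\big)e^{-\frac12(\sigma+\tau)}+E_2^2\otimes\hat E_1\big(\tfrac12-e^{-\sigma}\big)e^{-\sigma-\tau}\Big],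 \end{aligned}$$ $$\begin{aligned} \Delta_{BJEJ}(E_{2-1})={}&E_{2-1}\otimes e^{-\tau}+1\otimes E_{2-1}\\ &+h\Big[H_{1-2}\otimes\big(\tfrac12(1+e^{-\sigma})-e^{-\tau}+2H_{1-2}+\hat E_1e^{-\sigma}(\tfrac12\hat E_1e^{-\sigma-\tau}+E_2)\big)e^{-\tau}\\ &\quad+H_{1-2}E_2\otimes\hat E_1e^{-\frac32(\sigma+\tau)}+H_{1-2}^2\otimes\big((1-\tfrac12\hat E_1^2e^{-2\sigma})e^{-\tau}-1\big)e^{-\tau}\\ &\quad-E_2\otimes E_2e^{-\frac12(\sigma+\tau)}+\tfrac12E_2^2\otimes(1-e^{-\sigma})e^{-\tau}\Big], \end{aligned}$$ $$\begin{aligned} \Delta_{BJEJ}(E_{-1-2})={}&E_{-1-2}\otimes e^{-\sigma}+1\otimes E_{-1-2}-E_{-1}\otimes\hat E_1e^{-\frac32\sigma-\frac12\tau}-\tfrac12E_{2-1}\otimes\hat E_1^2e^{-2\sigma-\tau}\\ &+h\Big[H_{1-2}\otimes\big(\tfrac12(e^{-\tau}-1)-\hat E_1E_{-2}e^{-\tau}\big)e^{-\sigma}\\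 &\quad+H_{1-2}\otimes\big(e^{-\sigma}+\tfrac12e^{-\tau}-H_{1+2}-\tfrac14(\hat E_1^2e^{-2\sigma-\tau}+1)\big)\hat E_1^2e^{-2\sigma-\tau}\\ &\quad+\tfrac12H_{1-2}^2\otimes\big(1-e^{-\tau}+\tfrac12\hat E_1^2e^{-2\sigma-\tau}\big)\hat E_1^2e^{-2\sigma-\tau}\\ &\quad+(H_{1+2}^2-H_{1+2})\otimes(e^{-\sigma}-1)e^{-\sigma}+2H_{1+2}\otimes H_{1+2}e^{-\sigma}-H_{1+2}H_{1-2}\otimes\hat E_1^2e^{-3\sigma-\tau}\\ &\quad+E_2\otimes\big(E_{-2}+(2H_{1+2}-2e^{-\sigma}+1)\hat E_1e^{-\sigma}\big)e^{-\frac12(\sigma+\tau)}\\ &\quad+E_2^2\otimes\big(\tfrac12e^{-\sigma}(1-e^{-\tau})+\hat E_1^2e^{-2\sigma-\tau}(e^{-\sigma}-\tfrac14)\big)\\ &\quad+H_{1-2}E_2\otimes\big(e^{-\tau}-1-\hat E_1^2e^{-2\sigma-\tau}\big)\hat E_1e^{-\frac32\sigma-\frac12\tau}\\ &\quad+H_{1+2}E_2\otimes(2e^{-\sigma}-1)\hat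 E_1e^{-\frac32\sigma-\frac12\tau}\Big]. \end{aligned}$$ -/

import Mathlib

open scoped TensorProduct

noncomputable section

namespace FormalTwist

/-- Exponential of a formal power series `x` in `h` with vanishing constant term, over a possibly
noncommutative `ℂ`-algebra: the sum of all `x ^ k / k!`. Since `h ^ k` divides `x ^ k`, only the
terms with `k ≤ n` contribute to the coefficient of `h ^ n`. -/
def exp {R : Type*} [Ring R] [Algebra ℂ R] (x : PowerSeries R) : PowerSeries R :=
  PowerSeries.mk fun n =>
    ∑ k ∈ Finset.range (n + 1), ((k.factorial : ℂ)⁻¹) • PowerSeries.coeff n (x ^ k)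

/-- `ln (1 + x)` for a formal power series `x` with vanishing constant term: the sum over `k ≥ 1`
of `(-1) ^ (k + 1) x ^ k / k`. -/
def logOneAdd {R : Type*} [Ring R] [Algebra ℂ R] (x : PowerSeries R) : PowerSeries R :=
  PowerSeries.mk fun n =>
    ∑ k ∈ Finset.Icc 1 n, ((-1 : ℂ) ^ (k + 1) / (k : ℂ)) • PowerSeries.coeff n (x ^ k)

section Enveloping

attribute [local instance 100] LieRing.ofAssociativeRing

/-- The coproduct of the universal enveloping algebra: the algebra homomorphism with
`x ↦ x ⊗ 1 + 1 ⊗ x` for `x` in the Lie algebra. -/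
def comul (L : Type*) [LieRing L] [LieAlgebra ℂ L] :
    UniversalEnvelopingAlgebra ℂ L →ₐ[ℂ]
      UniversalEnvelopingAlgebra ℂ L ⊗[ℂ] UniversalEnvelopingAlgebra ℂ L :=
  UniversalEnvelopingAlgebra.lift ℂ
    { toFun := fun x => UniversalEnvelopingAlgebra.ι ℂ x ⊗ₜ[ℂ] 1 +
        1 ⊗ₜ[ℂ] UniversalEnvelopingAlgebra.ι ℂ x
      map_add' := fun x y => by
        simp only [map_add, TensorProduct.add_tmul, TensorProduct.tmul_add]
        abel
      map_smul' := fun c x => by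
        simp only [map_smul, TensorProduct.smul_tmul', TensorProduct.tmul_smul, smul_add,
          RingHom.id_apply]
      map_lie' := fun {x y} => by
        simp only [LieHom.map_lie, LieRing.of_associative_ring_bracket, TensorProduct.sub_tmul,
          TensorProduct.tmul_sub, mul_add, add_mul, Algebra.TensorProduct.tmul_mul_tmul, one_mul,
          mul_one]
        abel }

/-- The counit of the universal enveloping algebra, zero on the Lie algebra. -/
def counit (L : Type*) [LieRing L] [LieAlgebra ℂ L] :
    UniversalEnvelopingAlgebra ℂ L →ₐ[ℂ] ℂ :=
  UniversalEnvelopingAlgebra.lift ℂ (0 : L →ₗ⁅ℂ⁆ ℂ)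

/-- `U(L)`. -/
abbrev U (L : Type*) [LieRing L] [LieAlgebra ℂ L] : Type _ := UniversalEnvelopingAlgebra ℂ L

/-- `U(L) ⊗ U(L)`. -/
abbrev U2 (L : Type*) [LieRing L] [LieAlgebra ℂ L] : Type _ := U L ⊗[ℂ] U L

/-- `U(L) ⊗ U(L) ⊗ U(L)`. -/
abbrev U3 (L : Type*) [LieRing L] [LieAlgebra ℂ L] : Type _ := U2 L ⊗[ℂ] U L

/-- `a ⊗ b` in the completed tensor square `(U(L) ⊗ U(L))[[h]]` of `U(L)[[h]]`. -/
def tens {L : Type*} [LieRing L] [LieAlgebra ℂ L] (a b : PowerSeries (U L)) :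
    PowerSeries (U2 L) :=
  PowerSeries.map
      (Algebra.TensorProduct.includeLeft : U L →ₐ[ℂ] U2 L).toRingHom a *
    PowerSeries.map
      (Algebra.TensorProduct.includeRight : U L →ₐ[ℂ] U2 L).toRingHom b

/-- `y ↦ y₁₂ = y ⊗ 1`. -/
def leg12 {L : Type*} [LieRing L] [LieAlgebra ℂ L] :
    PowerSeries (U2 L) →+* PowerSeries (U3 L) :=
  PowerSeries.map (Algebra.TensorProduct.includeLeft : U2 L →ₐ[ℂ] U3 L).toRingHom

/-- `y ↦ y₂₃ = 1 ⊗ y`. -/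
def leg23 {L : Type*} [LieRing L] [LieAlgebra ℂ L] :
    PowerSeries (U2 L) →+* PowerSeries (U3 L) :=
  PowerSeries.map
    (((Algebra.TensorProduct.assoc ℂ ℂ ℂ (U L) (U L) (U L)).symm : _ →ₐ[ℂ] U3 L).comp
      (Algebra.TensorProduct.includeRight : U2 L →ₐ[ℂ] U L ⊗[ℂ] U2 L)).toRingHom

/-- `Δ ⊗ id` for the undeformed coproduct `Δ`. -/
def comulLeft {L : Type*} [LieRing L] [LieAlgebra ℂ L] :
    PowerSeries (U2 L) →+* PowerSeries (U3 L) :=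
  PowerSeries.map (Algebra.TensorProduct.map (comul L) (AlgHom.id ℂ (U L))).toRingHom

/-- `id ⊗ Δ` for the undeformed coproduct `Δ`. -/
def comulRight {L : Type*} [LieRing L] [LieAlgebra ℂ L] :
    PowerSeries (U2 L) →+* PowerSeries (U3 L) :=
  PowerSeries.map
    (((Algebra.TensorProduct.assoc ℂ ℂ ℂ (U L) (U L) (U L)).symm : _ →ₐ[ℂ] U3 L).comp
      (Algebra.TensorProduct.map (AlgHom.id ℂ (U L)) (comul L))).toRingHom

/-- `ε ⊗ id`. -/
def counitLeft {L : Type*} [LieRing L] [LieAlgebra ℂ L] :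
    PowerSeries (U2 L) →+* PowerSeries (U L) :=
  PowerSeries.map
    (((Algebra.TensorProduct.lid ℂ (U L)) : _ →ₐ[ℂ] U L).comp
      (Algebra.TensorProduct.map (counit L) (AlgHom.id ℂ (U L)))).toRingHom

/-- `id ⊗ ε`. -/
def counitRight {L : Type*} [LieRing L] [LieAlgebra ℂ L] :
    PowerSeries (U2 L) →+* PowerSeries (U L) :=
  PowerSeries.map
    (((Algebra.TensorProduct.rid ℂ ℂ (U L)) : _ →ₐ[ℂ] U L).comp
      (Algebra.TensorProduct.map (AlgHom.id ℂ (U L)) (counit L))).toRingHom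

/-- The twisted coproduct `Δ_F x = F (Δ x) F⁻¹` on `U(L)[[h]]`. -/
def twistedComul {L : Type*} [LieRing L] [LieAlgebra ℂ L] (F : PowerSeries (U2 L))
    (x : PowerSeries (U L)) : PowerSeries (U2 L) :=
  F * PowerSeries.map (comul L).toRingHom x * Ring.inverse F

/-- `(Δ_F ⊗ id) y = F₁₂ ((Δ ⊗ id) y) F₁₂⁻¹`. -/
def twistedComulLeft {L : Type*} [LieRing L] [LieAlgebra ℂ L] (F : PowerSeries (U2 L))
    (y : PowerSeries (U2 L)) : PowerSeries (U3 L) :=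
  leg12 F * comulLeft y * Ring.inverse (leg12 F)

/-- `(id ⊗ Δ_F) y = F₂₃ ((id ⊗ Δ) y) F₂₃⁻¹`. -/
def twistedComulRight {L : Type*} [LieRing L] [LieAlgebra ℂ L] (F : PowerSeries (U2 L))
    (y : PowerSeries (U2 L)) : PowerSeries (U3 L) :=
  leg23 F * comulRight y * Ring.inverse (leg23 F)

/-- `Φ` is a twist of the algebra `U(L)[[h]]` equipped with the coproduct `Δ_G`: it is invertible,
satisfies the Drinfeld equation `Φ₁₂ (Δ_G ⊗ id) Φ = Φ₂₃ (id ⊗ Δ_G) Φ`, and is counital.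
The undeformed `U(L)` is the case `G = 1`. -/
structure IsTwist {L : Type*} [LieRing L] [LieAlgebra ℂ L] (G Φ : PowerSeries (U2 L)) :
    Prop where
  isUnit : IsUnit Φ
  cocycle : leg12 Φ * twistedComulLeft G Φ = leg23 Φ * twistedComulRight G Φ
  counit_left : counitLeft Φ = 1
  counit_right : counitRight Φ = 1

/-- The algebra `U(L)[[h]]` with the coproduct `Δ_F` and the undeformed counit is a bialgebra. -/
structure IsTwistedBialgebra {L : Type*} [LieRing L] [LieAlgebra ℂ L]
    (F : PowerSeries (U2 L)) : Prop where
  map_one : twistedComul F 1 = 1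
  map_add : ∀ x y, twistedComul F (x + y) = twistedComul F x + twistedComul F y
  map_mul : ∀ x y, twistedComul F (x * y) = twistedComul F x * twistedComul F y
  coassoc : ∀ x, twistedComulLeft F (twistedComul F x) = twistedComulRight F (twistedComul F x)
  counit_left : ∀ x, counitLeft (twistedComul F x) = x
  counit_right : ∀ x, counitRight (twistedComul F x) = x

end Enveloping

end FormalTwist

namespace So5

open FormalTwist

/-- The complex Lie algebra `so(5)` of antisymmetric `5 × 5` matrices. -/
abbrev so5 : Type := LieAlgebra.Orthogonal.so (Fin 5) ℂ

/-- The antisymmetric matrix `M_{jk} = e_{jk} - e_{kj}`; indices run over `0, …, 4` here. -/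
def M (j k : Fin 5) : so5 :=
  ⟨Matrix.single j k 1 - Matrix.single k j 1, by
    rw [LieAlgebra.Orthogonal.mem_so, Matrix.transpose_sub, Matrix.transpose_single,
      Matrix.transpose_single, neg_sub]⟩

/-- `√2` as a complex number. -/
def sqrtTwo : ℂ := ((Real.sqrt 2 : ℝ) : ℂ)

/-- `H_{1+2}` -/
def rootHp : so5 := (-(Complex.I / 2)) • (M 0 1 + M 2 3)
/-- `H_{1-2}` -/
def rootHm : so5 := (-(Complex.I / 2)) • (M 0 1 - M 2 3)
/-- `E_{1+2}` -/
def rootEp : so5 :=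
  (1 / 2 : ℂ) • (-M 1 3 + Complex.I • M 1 2 + Complex.I • M 0 3 + M 0 2)
/-- `E_{1-2}` -/
def rootEm : so5 :=
  (1 / 2 : ℂ) • (-M 1 3 - Complex.I • M 1 2 + Complex.I • M 0 3 - M 0 2)
/-- `E_1` -/
def rootE1 : so5 := (1 / sqrtTwo) • (M 1 4 - Complex.I • M 0 4)
/-- `E_2` -/
def rootE2 : so5 := -((1 / sqrtTwo) • (-M 3 4 + Complex.I • M 2 4))
/-- `E_{-1}`, normalized by `[E_1, E_{-1}] = H_{1+2} + H_{1-2}` -/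
def rootF1 : so5 := (1 / sqrtTwo) • (-M 1 4 - Complex.I • M 0 4)
/-- `E_{-2}`, normalized by `[E_2, E_{-2}] = H_{1+2} - H_{1-2}` -/
def rootF2 : so5 := (1 / sqrtTwo) • (-M 3 4 - Complex.I • M 2 4)
/-- `E_{2-1}`, normalized by `[E_{1-2}, E_{2-1}] = 2 H_{1-2}` -/
def rootFm : so5 :=
  (1 / 2 : ℂ) • (M 1 3 - Complex.I • M 1 2 + Complex.I • M 0 3 + M 0 2)
/-- `E_{-1-2}`, normalized by `[E_{1+2}, E_{-1-2}] = 2 H_{1+2}` -/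
def rootFp : so5 :=
  (1 / 2 : ℂ) • (M 1 3 + Complex.I • M 1 2 + Complex.I • M 0 3 - M 0 2)

/-- The image in `U(so(5))[[h]]` of an element of `so(5)`. -/
def gen (x : so5) : PowerSeries (U so5) :=
  PowerSeries.C (UniversalEnvelopingAlgebra.ι ℂ x)

/-- The formal parameter `h` of `U(so(5))[[h]]`. -/
def h : PowerSeries (U so5) := PowerSeries.X

/-- The formal parameter `h` of `(U(so(5)) ⊗ U(so(5)))[[h]]`. -/
def h2 : PowerSeries (U2 so5) := PowerSeries.X

/-! The deformation parameter is carried by the carrier generators of weight one with respect to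
`H_{1+2} + H_{1-2}`: `E_{1+2}`, `E_{1-2}` and `E_1` are rescaled by `h`, the generators
`H_{1+2}`, `H_{1-2}`, `E_2`, `E_{-2}` of weight zero are not rescaled. This makes the logarithms and
exponentials below formal power series. The generators `E_{-1}`, `E_{2-1}`, `E_{-1-2}` of weight
minus one, whose rescaling would be by `1 / h`, are left unscaled. -/

/-- `H_{1+2}` -/
def Hp : PowerSeries (U so5) := gen rootHp
/-- `H_{1-2}` -/
def Hm : PowerSeries (U so5) := gen rootHm
/-- `h E_{1+2}` -/
def Ep : PowerSeries (U so5) := h * gen rootEp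
/-- `h E_{1-2}` -/
def Em : PowerSeries (U so5) := h * gen rootEm
/-- `h E_1` -/
def E1 : PowerSeries (U so5) := h * gen rootE1
/-- `E_2` -/
def E2 : PowerSeries (U so5) := gen rootE2
/-- `E_{-2}` -/
def F2 : PowerSeries (U so5) := gen rootF2
/-- `E_{-1}` -/
def F1 : PowerSeries (U so5) := gen rootF1
/-- `E_{2-1}` -/
def Fm : PowerSeries (U so5) := gen rootFm
/-- `E_{-1-2}` -/
def Fp : PowerSeries (U so5) := gen rootFp
/-- `H_1 = (H_{1+2} + H_{1-2}) / 2` -/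
def H1 : PowerSeries (U so5) := (1 / 2 : ℂ) • (Hp + Hm)

/-- `σ_{1+2} = ln (1 + h E_{1+2})` -/
def sigma : PowerSeries (U so5) := logOneAdd Ep

/-- `E_{BO} = h E_{1-2} + (1/2) (h E_1)² exp (-σ_{1+2})` -/
def EBO : PowerSeries (U so5) := Em + (1 / 2 : ℂ) • (E1 ^ 2 * exp (-sigma))

/-- `σ_{BO} = ln (1 + E_{BO})` -/
def sigmaBO : PowerSeries (U so5) := logOneAdd EBO

/-- `exp (a σ_{1+2} + b σ_{BO})` -/
def q (a b : ℂ) : PowerSeries (U so5) := exp (a • sigma + b • sigmaBO)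

/-- The extended Jordanian twist
`F_{EJ} = exp (-E_2 ⊗ h E_1 exp (-σ_{1+2} / 2)) exp (H_{1+2} ⊗ σ_{1+2})`. -/
def twistEJ : PowerSeries (U2 so5) :=
  exp (-tens E2 (E1 * exp ((-1 / 2 : ℂ) • sigma))) * exp (tens Hp sigma)

/-- The Jordanian factor `Φ_{BJ} = exp (H_{1-2} ⊗ σ_{BO})` on the deformed carrier. -/
def factorBJ : PowerSeries (U2 so5) := exp (tens Hm sigmaBO)

/-- `F_{BJEJ} = Φ_{BJ} F_{EJ}` -/
def twistBJEJ : PowerSeries (U2 so5) := factorBJ * twistEJ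

/-- `Δ_{EJ}` -/
def deltaEJ : PowerSeries (U so5) → PowerSeries (U2 so5) := twistedComul twistEJ

/-- `Δ_{BJEJ}` -/
def deltaBJEJ : PowerSeries (U so5) → PowerSeries (U2 so5) := twistedComul twistBJEJ

/-- The subalgebra `U(L⁽⁶⁾)` of `U(so(5))` generated by
`H_{1+2}, E_{1+2}, H_{1-2}, E_{1-2}, E_1, E_2`. -/
def UL6 : Subalgebra ℂ (U so5) :=
  Algebra.adjoin ℂ (UniversalEnvelopingAlgebra.ι ℂ ''
    ({rootHp, rootEp, rootHm, rootEm, rootE1, rootE2} : Set so5))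

end So5

end

infixl:66 " ⊠ " => FormalTwist.tens

open FormalTwist So5

/-! An exponential `exp (a ⊗ b)` is a twist for a coproduct Δ as soon as some `g` commuting with `a`
and `b` satisfies Δ(a) = a ⊗ g + 1 ⊗ a before the twist and Δ(b) = b ⊗ 1 + g ⊗ b after it. Both
sides of the Drinfeld equation are then exp(a⊗b⊗1) exp(a⊗g⊗b) exp(1⊗a⊗b); this is
`isTwist_exp_tens`. The twist `twistBJEJ` is a product of three such exponentials: the Jordanian
factor (H_{1+2}, σ) with g = 1, the extension (-E_2, hE_1 e^{-σ/2}) with g = e^{σ/2}, and the second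
Jordanian factor (H_{1-2}, τ) with g = 1. The third is available because H_{1-2} and E_{BO} are
primitive for Δ_{EJ}: the quadratic correction in E_{BO} cancels the non-primitive part of the
coproduct of hE_{1-2} (`semiconjBy_twistEJ_EBO`). Since [H_{1-2}, E_{BO}] = E_{BO}, conjugation by
the third factor makes 1 + E_{BO} group-like, so that τ becomes primitive. `IsTwist.mul` composes
the factors, and the bialgebra axioms follow from the cocycle equation
(`IsTwist.isTwistedBialgebra`).

The coproducts are obtained by conjugating x ⊗ 1 + 1 ⊗ x by the three exponentials in turn. This
terminates: on 1 ⊗ y the adjoint action of a ⊗ b is a ⊗ ad b, and the third commutators that occur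
vanish; on y ⊗ 1 a Cartan element a acts by a weight and multiplies by an exponential of b.
Commutators with ln(1+x) and with powers (1+x)^a come from Taylor's formula f(x)y = y f(x) + z f'(x)
+ ½ w f''(x), where z = [x,y] and w = [x,z] (`subs_mul_eq`). It is proved for polynomials and
carried to power series modulo every power of h.

What remains is finite noncommutative algebra. It is done by a rewriting procedure on words in
numbered letters with dyadic coefficients: every rule is an identity of the algebra, so a computed
zero is a true zero (`Poly.eval_eq_of_isZero_sub`), and the kernel evaluates the computation.
Because e^σ = 1 + hE_{1+2} and e^τ = 1 + E_{BO}, the letters for hE_{1+2} and hE_{1-2} are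
redundant. The first is never used; the second is kept in `rules1`, where commutators with E_{BO}
are computed, and is removed by `elim` in favour of `rules2`, where e^{±τ/2} can be moved past all
the generators. -/

open PowerSeries in
/-- Left multiplication preserves divisibility by a power of the central variable. -/
theorem PowerSeries.X_pow_dvd_mul_left {R : Type*} [Ring R] {N : ℕ} {a : PowerSeries R}
    (b : PowerSeries R) (h : (X : PowerSeries R) ^ N ∣ a) : X ^ N ∣ b * a := by
  obtain ⟨c, rfl⟩ := h
  exact ⟨b * c, by rw [← mul_assoc, ← X_pow_mul, mul_assoc]⟩

/-! ### Substitution of a noncommutative power series into a scalar one. -/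

namespace FormalTwist

open PowerSeries

section Eval

/-- The variable is central, so (Xc)^n = X^n c^n even when the coefficients do not commute. This is
what makes substitution a finite sum in each degree. -/
theorem X_pow_dvd_pow {R : Type*} [Ring R] {x : PowerSeries R} (hx : constantCoeff x = 0) (n : ℕ) :
    (X : PowerSeries R) ^ n ∣ x ^ n := by
  obtain ⟨c, hc⟩ := X_dvd_iff.2 hx
  refine ⟨c ^ n, ?_⟩
  rw [hc, (commute_X c).symm.mul_pow]

/-- Separatedness of the X-adic topology: identities between substituted series are reduced to
identities between polynomials modulo each X^N. -/
theorem eq_of_forall_X_pow_dvd_sub {R : Type*} [Ring R] {a b : PowerSeries R}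
    (h : ∀ N, (X : PowerSeries R) ^ N ∣ a - b) : a = b := by
  ext n
  have := X_pow_dvd_iff.1 (h (n + 1)) n n.lt_succ_self
  rwa [map_sub, sub_eq_zero] at this

variable {R S : Type*} [Ring R] [Algebra ℂ R] [Ring S] [Algebra ℂ S]

/-- The substitution `f(x)` of a formal power series `x` over a noncommutative algebra with
vanishing constant term into a scalar power series. -/
noncomputable def subs (x : PowerSeries R) (f : PowerSeries ℂ) : PowerSeries R :=
  PowerSeries.mk fun n => ∑ k ∈ Finset.range (n + 1), coeff k f • coeff n (x ^ k)

theorem subs_add (x : PowerSeries R) (f g : PowerSeries ℂ) :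
    subs x (f + g) = subs x f + subs x g := by
  ext n
  simp [subs, add_smul, Finset.sum_add_distrib]

theorem subs_smul (x : PowerSeries R) (c : ℂ) (f : PowerSeries ℂ) :
    subs x (c • f) = c • subs x f := by
  ext n
  simp [subs, mul_smul, Finset.smul_sum]

/-- Below degree N only the powers x^k with k < N contribute. This is the bridge between `subs` and
the algebra homomorphism `Polynomial.aeval x`. -/
theorem subs_sub_aeval_trunc {x : PowerSeries R} (hx : constantCoeff x = 0) (f : PowerSeries ℂ)
    (N : ℕ) : (X : PowerSeries R) ^ N ∣ subs x f - Polynomial.aeval x (trunc N f) := by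
  rw [X_pow_dvd_iff]
  intro m hm
  -- The bound N + 1 instead of N also covers N = 0, where the truncation is the zero polynomial and
  -- has `natDegree` 0.
  rw [map_sub, sub_eq_zero, Polynomial.aeval_eq_sum_range' (n := N + 1), map_sum, subs, coeff_mk]
  · refine Finset.sum_subset_zero_on_sdiff ?_ ?_ ?_
    · exact Finset.range_mono (by omega)
    · intro k hk
      simp only [Finset.mem_sdiff, Finset.mem_range] at hk
      have := X_pow_dvd_iff.1 (X_pow_dvd_pow hx k) m (by omega)
      simp [this]
    · intro k hk
      simp only [Finset.mem_range] at hk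
      rw [coeff_trunc, if_pos (by omega)]
      simp
  · rcases N with _ | N
    · simp
    · exact (natDegree_trunc_lt f N).trans (by omega)

/-- `f(x)` and `p(x)` agree to the order to which the polynomial `p` approximates `f`. -/
theorem X_pow_dvd_aeval {x : PowerSeries R} (hx : constantCoeff x = 0) {N : ℕ}
    {p : Polynomial ℂ} (hp : ∀ m < N, p.coeff m = 0) :
    (X : PowerSeries R) ^ N ∣ Polynomial.aeval x p := by
  obtain ⟨r, rfl⟩ := Polynomial.X_pow_dvd_iff.2 hp
  rw [map_mul, map_pow, Polynomial.aeval_X]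
  exact (X_pow_dvd_pow hx N).mul_right _

theorem subs_coe {x : PowerSeries R} (hx : constantCoeff x = 0) (p : Polynomial ℂ) :
    subs x (p : PowerSeries ℂ) = Polynomial.aeval x p := by
  refine eq_of_forall_X_pow_dvd_sub fun N => ?_
  have h1 := subs_sub_aeval_trunc hx (p : PowerSeries ℂ) N
  have h2 : (X : PowerSeries R) ^ N ∣
      Polynomial.aeval x (trunc N (p : PowerSeries ℂ) - p) := by
    refine X_pow_dvd_aeval hx fun m hm => ?_
    rw [Polynomial.coeff_sub, coeff_trunc, if_pos hm, Polynomial.coeff_coe, sub_self]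
  rw [map_sub] at h2
  simpa using dvd_add h1 h2

/-- Powers of the single element `x` commute, so `aeval` is multiplicative, and a product modulo X^N
depends only on the truncations of its factors. -/
theorem subs_mul {x : PowerSeries R} (hx : constantCoeff x = 0) (f g : PowerSeries ℂ) :
    subs x (f * g) = subs x f * subs x g := by
  refine eq_of_forall_X_pow_dvd_sub fun N => ?_
  have h1 := subs_sub_aeval_trunc hx (f * g) N
  have h2 : (X : PowerSeries R) ^ N ∣
      Polynomial.aeval x (trunc N (f * g) - trunc N f * trunc N g) := by
    refine X_pow_dvd_aeval hx fun m hm => ?_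
    rw [Polynomial.coeff_sub, coeff_trunc, if_pos hm, ← Polynomial.coeff_coe, Polynomial.coe_mul,
      coeff_mul_eq_coeff_trunc_mul_trunc f g hm, sub_self]
  have h3 := (subs_sub_aeval_trunc hx f N).mul_right (subs x g)
  have h4 := X_pow_dvd_mul_left (Polynomial.aeval x (trunc N f)) (subs_sub_aeval_trunc hx g N)
  rw [map_sub, map_mul (Polynomial.aeval x)] at h2
  have := dvd_sub (dvd_add h1 h2) (dvd_add h3 h4)
  convert this using 1
  noncomm_ring

theorem subs_one {x : PowerSeries R} (hx : constantCoeff x = 0) : subs x 1 = 1 := by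
  have := subs_coe hx 1
  simpa using this

theorem subs_X {x : PowerSeries R} (hx : constantCoeff x = 0) : subs x X = x := by
  have := subs_coe hx Polynomial.X
  simpa using this

theorem constantCoeff_subs (x : PowerSeries R) (f : PowerSeries ℂ) :
    constantCoeff (subs x f) = algebraMap ℂ R (constantCoeff f) := by
  rw [← coeff_zero_eq_constantCoeff_apply, subs, coeff_mk]
  simp [Algebra.algebraMap_eq_smul_one]

/-- An algebra homomorphism that does not lower orders commutes with substitution. -/
theorem map_subs (φ : PowerSeries R →ₐ[ℂ] PowerSeries S)
    (hφ : ∀ N a, (X : PowerSeries R) ^ N ∣ a → (X : PowerSeries S) ^ N ∣ φ a)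
    {x : PowerSeries R} (hx : constantCoeff x = 0) (f : PowerSeries ℂ) :
    φ (subs x f) = subs (φ x) f := by
  have hx' : constantCoeff (φ x) = 0 := by
    rw [← X_dvd_iff, ← pow_one X]
    exact hφ 1 x (by rw [pow_one]; exact X_dvd_iff.2 hx)
  refine eq_of_forall_X_pow_dvd_sub fun N => ?_
  have h1 := hφ N _ (subs_sub_aeval_trunc hx f N)
  have h2 := subs_sub_aeval_trunc hx' f N
  rw [map_sub, ← Polynomial.aeval_algHom_apply] at h1
  simpa using dvd_sub h1 h2

theorem mapAlgHom_subs (φ : R →ₐ[ℂ] S) (x : PowerSeries R) (f : PowerSeries ℂ) :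
    mapAlgHom φ (subs x f) = subs (mapAlgHom φ x) f := by
  ext n
  simp only [mapAlgHom_apply, coeff_map, subs, coeff_mk, map_sum, ← map_pow]
  simp

/-- Substitution as an algebra homomorphism. -/
noncomputable def subsHom {x : PowerSeries R} (hx : constantCoeff x = 0) :
    PowerSeries ℂ →ₐ[ℂ] PowerSeries R :=
  AlgHom.ofLinearMap
    { toFun := subs x, map_add' := subs_add x, map_smul' := subs_smul x }
    (subs_one hx) (subs_mul hx)

/-- Substituting `x` is an algebra homomorphism that does not lower orders, so `map_subs` applies to
it. -/
theorem subs_subs {x : PowerSeries R} (hx : constantCoeff x = 0) {g : PowerSeries ℂ}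
    (hg : constantCoeff g = 0) (f : PowerSeries ℂ) : subs x (subs g f) = subs (subs x g) f := by
  refine map_subs (subsHom hx) (fun N a ha => ?_) hg f
  obtain ⟨c, rfl⟩ := ha
  rw [map_mul, map_pow]
  refine Dvd.dvd.mul_right ?_ _
  have : subsHom hx X = x := subs_X hx
  rw [this]
  exact X_pow_dvd_pow hx N

/-- For polynomials this is induction on monomials; the passage to the limit is X-adic. Conjugations
of exponentials and logarithms are reduced to it. -/
theorem semiconjBy_subs {x y a : PowerSeries R} (hx : constantCoeff x = 0)
    (hy : constantCoeff y = 0) (h : SemiconjBy a y x) (f : PowerSeries ℂ) :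
    SemiconjBy a (subs y f) (subs x f) := by
  refine eq_of_forall_X_pow_dvd_sub fun N => ?_
  have h1 := X_pow_dvd_mul_left a (subs_sub_aeval_trunc hy f N)
  have h2 := (subs_sub_aeval_trunc hx f N).mul_right a
  have h3 : ∀ p : Polynomial ℂ, a * Polynomial.aeval y p = Polynomial.aeval x p * a := by
    intro p
    induction p using Polynomial.induction_on' with
    | add p q hp hq => simp only [map_add, mul_add, add_mul, hp, hq]
    | monomial n c =>
      have := (h.pow_right n).eq
      simp only [Polynomial.aeval_monomial, mul_assoc, ← this]
      rw [← mul_assoc, ← Algebra.commutes, mul_assoc]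
  have h4 := dvd_sub h1 h2
  rw [mul_sub, sub_mul, h3] at h4
  simpa using h4

theorem commute_subs {x a : PowerSeries R} (hx : constantCoeff x = 0) (h : Commute a x)
    (f : PowerSeries ℂ) : Commute a (subs x f) :=
  semiconjBy_subs hx hx h f

/-- Taylor's formula `f(x) y = y f(x) + z f'(x) + w f''(x) / 2` for `z = [x, y]`, `w = [x, z]` and
`[x, w] = 0`. -/
theorem subs_mul_eq {x y z w : PowerSeries R} (hx : constantCoeff x = 0)
    (hz : x * y = y * x + z) (hw : x * z = z * x + w) (hxw : x * w = w * x)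
    (f : PowerSeries ℂ) :
    subs x f * y = y * subs x f + z * subs x (derivative ℂ f) +
      (1 / 2 : ℂ) • (w * subs x (derivative ℂ (derivative ℂ f))) := by
  have h3 : ∀ p : Polynomial ℂ, Polynomial.aeval x p * y = y * Polynomial.aeval x p +
      z * Polynomial.aeval x (Polynomial.derivative p) +
      (1 / 2 : ℂ) • (w * Polynomial.aeval x (Polynomial.derivative (Polynomial.derivative p))) := by
    have hwn : ∀ n : ℕ, x ^ n * w = w * x ^ n := fun n => (Commute.pow_left hxw n).eq
    have hzn : ∀ n : ℕ, x * (z * x ^ n) = z * x ^ (n + 1) + w * x ^ n := fun n => by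
      rw [← mul_assoc, hw, add_mul, mul_assoc, ← pow_succ']
    -- The truncated exponents n - 1 and n - 2 are harmless, since their coefficients n and n(n-1)/2
    -- vanish whenever the subtraction is truncated.
    have key : ∀ n : ℕ, x ^ n * y = y * x ^ n + (n : ℂ) • (z * x ^ (n - 1)) +
        ((n * (n - 1) / 2 : ℂ)) • (w * x ^ (n - 2)) := by
      intro n
      induction n with
      | zero => simp
      | succ n ih =>
        rw [pow_succ' x n, mul_assoc, ih, mul_add, mul_add, ← mul_assoc x y, hz, mul_smul_comm,
          mul_smul_comm, ← mul_assoc x w, hxw, mul_assoc w x]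
        rcases n with _ | n
        · simp
        rcases n with _ | n
        · simp [hw, mul_assoc, two_smul, add_mul]
          module
        · have e1 : n + 1 + 1 - 1 = n + 1 := rfl
          have e2 : n + 1 + 1 + 1 - 1 = n + 2 := rfl
          have e3 : n + 1 + 1 - 2 = n := rfl
          have e4 : n + 1 + 1 + 1 - 2 = n + 1 := rfl
          rw [e1, e2, e3, e4, hzn, add_mul, mul_assoc y, ← pow_succ', ← pow_succ']
          push_cast
          module
    intro p
    induction p using Polynomial.induction_on' with
    | add p q hp hq =>
      simp only [map_add, mul_add, add_mul, hp, hq, smul_add]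
      abel
    | monomial n c =>
      simp only [Polynomial.derivative_monomial, Polynomial.aeval_monomial,
        Algebra.algebraMap_eq_smul_one, smul_mul_assoc, one_mul, mul_smul_comm, key, smul_add,
        smul_smul]
      have e : n - 1 - 1 = n - 2 := by omega
      have e' : c * (n : ℂ) * ((n - 1 : ℕ) : ℂ) = c * n * (n - 1) := by
        rcases n with _ | n <;> simp
      rw [e, e']
      module
  refine eq_of_forall_X_pow_dvd_sub fun N => ?_
  have h0 := (subs_sub_aeval_trunc hx f N)
  -- Two derivatives cost two degrees: f is truncated at N + 2 so that its second derivative is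
  -- still correct modulo X^N.
  have htr : (X : PowerSeries R) ^ N ∣
      Polynomial.aeval x (trunc N f - trunc (N + 2) f) := by
    refine X_pow_dvd_aeval hx fun m hm => ?_
    rw [Polynomial.coeff_sub, coeff_trunc, coeff_trunc, if_pos hm, if_pos (by omega), sub_self]
  have h0' : (X : PowerSeries R) ^ N ∣ subs x f - Polynomial.aeval x (trunc (N + 2) f) := by
    have := dvd_add h0 htr
    rwa [map_sub, sub_add_sub_cancel] at this
  have htr1 : (X : PowerSeries R) ^ N ∣
      Polynomial.aeval x (trunc N (derivative ℂ f) - trunc (N + 1) (derivative ℂ f)) := by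
    refine X_pow_dvd_aeval hx fun m hm => ?_
    rw [Polynomial.coeff_sub, coeff_trunc, coeff_trunc, if_pos hm, if_pos (by omega), sub_self]
  have h1 : (X : PowerSeries R) ^ N ∣ subs x (derivative ℂ f) -
      Polynomial.aeval x (Polynomial.derivative (trunc (N + 2) f)) := by
    have := dvd_add (subs_sub_aeval_trunc hx (derivative ℂ f) N) htr1
    rwa [map_sub, sub_add_sub_cancel, trunc_derivative] at this
  have h2 : (X : PowerSeries R) ^ N ∣ subs x (derivative ℂ (derivative ℂ f)) -
      Polynomial.aeval x (Polynomial.derivative (Polynomial.derivative (trunc (N + 2) f))) := by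
    have := subs_sub_aeval_trunc hx (derivative ℂ (derivative ℂ f)) N
    rwa [trunc_derivative, trunc_derivative] at this
  have h4 := dvd_sub (h0'.mul_right y) (dvd_add (dvd_add (X_pow_dvd_mul_left y h0')
    (X_pow_dvd_mul_left z h1)) (X_pow_dvd_mul_left ((1 / 2 : ℂ) • w) h2))
  convert h4 using 1
  rw [sub_mul, h3]
  simp only [mul_sub, smul_mul_assoc]
  abel

end Eval

end FormalTwist

/-! ### Exponential and logarithm of noncommutative power series. -/

namespace FormalTwist

open PowerSeries

section ExpLog

variable {R S : Type*} [Ring R] [Algebra ℂ R] [Ring S] [Algebra ℂ S]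

theorem exp_eq_subs (x : PowerSeries R) : exp x = subs x (PowerSeries.exp ℂ) := by
  ext n
  simp [exp, subs]

theorem logOneAdd_eq_subs (x : PowerSeries R) : logOneAdd x = subs x (PowerSeries.log ℂ) := by
  ext n
  simp only [logOneAdd, subs, coeff_mk, coeff_log]
  refine Finset.sum_subset_zero_on_sdiff (fun k hk => ?_) (fun k hk => ?_) (fun k hk => ?_)
  · simp only [Finset.mem_Icc, Finset.mem_range] at *
    omega
  · have : k = 0 := by
      simp only [Finset.mem_sdiff, Finset.mem_Icc, Finset.mem_range] at hk
      omega
    simp [this]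
  · have : k ≠ 0 := by
      simp only [Finset.mem_Icc] at hk
      omega
    simp [this]

theorem constantCoeff_logOneAdd (x : PowerSeries R) : constantCoeff (logOneAdd x) = 0 := by
  simp [logOneAdd_eq_subs, constantCoeff_subs]

theorem constantCoeff_exp (x : PowerSeries R) : constantCoeff (exp x) = 1 := by
  simp [exp_eq_subs, constantCoeff_subs]

theorem exp_zero : exp (0 : PowerSeries R) = 1 := by
  ext n
  simp only [exp, coeff_mk]
  rw [Finset.sum_eq_single 0]
  · simp
  · intro k _ hk
    simp [hk]
  · simp

theorem mapAlgHom_exp (φ : R →ₐ[ℂ] S) (x : PowerSeries R) :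
    mapAlgHom φ (exp x) = exp (mapAlgHom φ x) := by
  rw [exp_eq_subs, exp_eq_subs, mapAlgHom_subs]

theorem mapAlgHom_logOneAdd (φ : R →ₐ[ℂ] S) (x : PowerSeries R) :
    mapAlgHom φ (logOneAdd x) = logOneAdd (mapAlgHom φ x) := by
  rw [logOneAdd_eq_subs, logOneAdd_eq_subs, mapAlgHom_subs]

theorem X_pow_dvd_exp_sub {x : PowerSeries R} (hx : constantCoeff x = 0) (N : ℕ) :
    (X : PowerSeries R) ^ N ∣
      exp x - ∑ k ∈ Finset.range N, ((k.factorial : ℂ)⁻¹) • x ^ k := by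
  have := subs_sub_aeval_trunc hx (PowerSeries.exp ℂ) N
  rw [← exp_eq_subs, Polynomial.aeval_def, eval₂_trunc_eq_sum_range] at this
  convert this using 3 with k
  simp [Algebra.smul_def]

/-- Two elements are involved, so one-variable substitution does not suffice. Modulo X^N the
binomial theorem gives the sum of x^i y^j / (i! j!) over i + j < N, and the product of the truncated
exponentials gives the same sum over a square. -/
theorem exp_add {x y : PowerSeries R} (hx : constantCoeff x = 0) (hy : constantCoeff y = 0)
    (h : Commute x y) : exp (x + y) = exp x * exp y := by
  refine eq_of_forall_X_pow_dvd_sub fun N => ?_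
  have h1 := X_pow_dvd_exp_sub (x := x + y) (by simp [hx, hy]) N
  have h2 := (X_pow_dvd_exp_sub hx N).mul_right (exp y)
  have h3 := X_pow_dvd_mul_left (∑ k ∈ Finset.range N, ((k.factorial : ℂ)⁻¹) • x ^ k)
    (X_pow_dvd_exp_sub hy N)
  set f : ℕ → ℕ → PowerSeries R := fun i j =>
    ((i.factorial : ℂ)⁻¹ * (j.factorial : ℂ)⁻¹) • (x ^ i * y ^ j) with hf
  have h4 : ∑ k ∈ Finset.range N, ((k.factorial : ℂ)⁻¹) • (x + y) ^ k =
      ∑ i ∈ Finset.range N, ∑ j ∈ Finset.range (N - i), f i j := by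
    rw [← Finset.sum_range_diag_flip]
    refine Finset.sum_congr rfl fun k _ => ?_
    rw [h.add_pow, Finset.smul_sum]
    refine Finset.sum_congr rfl fun i hi => ?_
    have hik : i ≤ k := by
      simp only [Finset.mem_range] at hi
      omega
    rw [hf]
    have hc : ((k.choose i : ℕ) : PowerSeries R) = ((k.choose i : ℕ) : ℂ) • 1 := by
      rw [← Algebra.algebraMap_eq_smul_one, map_natCast]
    rw [hc, mul_smul_comm, mul_one, smul_smul]
    congr 1
    rw [Nat.cast_choose ℂ hik]
    have := Nat.cast_ne_zero (R := ℂ).2 k.factorial_ne_zero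
    have := Nat.cast_ne_zero (R := ℂ).2 i.factorial_ne_zero
    have := Nat.cast_ne_zero (R := ℂ).2 (k - i).factorial_ne_zero
    field_simp
  have h5 : (∑ k ∈ Finset.range N, ((k.factorial : ℂ)⁻¹) • x ^ k) *
      (∑ k ∈ Finset.range N, ((k.factorial : ℂ)⁻¹) • y ^ k) =
      ∑ i ∈ Finset.range N, ∑ j ∈ Finset.range N, f i j := by
    rw [Finset.sum_mul_sum]
    refine Finset.sum_congr rfl fun i _ => Finset.sum_congr rfl fun j _ => ?_
    rw [hf, smul_mul_smul_comm]
  -- The part of the square outside the triangle has i + j ≥ N, and X^(i+j) divides x^i y^j.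
  have h6 : (X : PowerSeries R) ^ N ∣
      (∑ i ∈ Finset.range N, ∑ j ∈ Finset.range N, f i j) -
      ∑ i ∈ Finset.range N, ∑ j ∈ Finset.range (N - i), f i j := by
    rw [← Finset.sum_sub_distrib]
    refine Finset.dvd_sum fun i _ => ?_
    rw [← Finset.sum_sdiff (Finset.range_mono (Nat.sub_le N i) :
      Finset.range (N - i) ⊆ Finset.range N), add_sub_cancel_right]
    refine Finset.dvd_sum fun j hj => ?_
    have hN : N ≤ i + j := by
      simp only [Finset.mem_sdiff, Finset.mem_range] at hj
      omega
    refine (pow_dvd_pow _ hN).trans ?_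
    rw [pow_add]
    obtain ⟨c, hc⟩ := X_pow_dvd_pow hx i
    obtain ⟨d, hd⟩ := X_pow_dvd_pow hy j
    refine ⟨((i.factorial : ℂ)⁻¹ * (j.factorial : ℂ)⁻¹) • (c * d), ?_⟩
    simp only [hf]
    rw [hc, hd, mul_smul_comm, mul_assoc, ← mul_assoc c, ← X_pow_mul, mul_assoc,
      mul_assoc]
  rw [← h4, ← h5] at h6
  have := dvd_sub h1 (dvd_add (dvd_add h2 h3) h6)
  convert this using 1
  simp only [sub_mul, mul_sub]
  abel

theorem semiconjBy_exp {x y a : PowerSeries R} (hx : constantCoeff x = 0)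
    (hy : constantCoeff y = 0) (h : SemiconjBy a y x) : SemiconjBy a (exp y) (exp x) := by
  rw [exp_eq_subs, exp_eq_subs]
  exact semiconjBy_subs hx hy h _

theorem commute_exp {x a : PowerSeries R} (hx : constantCoeff x = 0) (h : Commute a x) :
    Commute a (exp x) :=
  semiconjBy_exp hx hx h

theorem exp_mul_exp_neg {x : PowerSeries R} (hx : constantCoeff x = 0) :
    exp x * exp (-x) = 1 := by
  rw [← exp_add hx (by simp [hx]) (Commute.refl x).neg_right, add_neg_cancel, exp_zero]

theorem exp_neg_mul_exp {x : PowerSeries R} (hx : constantCoeff x = 0) :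
    exp (-x) * exp x = 1 := by
  simpa using exp_mul_exp_neg (x := -x) (by simp [hx])

theorem isUnit_exp {x : PowerSeries R} (hx : constantCoeff x = 0) : IsUnit (exp x) :=
  ⟨⟨exp x, exp (-x), exp_mul_exp_neg hx, exp_neg_mul_exp hx⟩, rfl⟩

/-- The conjugation formula for `exp x` when the third iterated commutator vanishes. -/
theorem exp_mul_eq {x y z w : PowerSeries R} (hx : constantCoeff x = 0)
    (hz : x * y = y * x + z) (hw : x * z = z * x + w) (hxw : x * w = w * x) :
    SemiconjBy (exp x) y (y + z + (1 / 2 : ℂ) • w) := by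
  have := subs_mul_eq hx hz hw hxw (PowerSeries.exp ℂ)
  rw [derivative_exp, derivative_exp, ← exp_eq_subs] at this
  rw [SemiconjBy, this]
  simp only [add_mul, smul_mul_assoc]

end ExpLog

/-! ### Powers and logarithms of 1 + x, and their commutators. -/

section Binomial

/-- The binomial series `(1 + X) ^ a`. -/
noncomputable def binom (a : ℂ) : PowerSeries ℂ := exp (a • PowerSeries.log ℂ)

theorem binom_add (a b : ℂ) : binom (a + b) = binom a * binom b := by
  rw [binom, add_smul, exp_add (by simp) (by simp) (Commute.all _ _), binom, binom]

theorem binom_zero : binom 0 = 1 := by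
  rw [binom, zero_smul, exp_zero]

/-- Over ℂ itself `subs` is `PowerSeries.subst`, for which the chain rule is known. -/
theorem derivative_subs {g : PowerSeries ℂ} (hg : constantCoeff g = 0) (f : PowerSeries ℂ) :
    derivative ℂ (subs g f) = derivative ℂ g * subs g (derivative ℂ f) := by
  have hs := HasSubst.of_constantCoeff_zero' hg
  have key : ∀ f, subs g f = f.subst g := by
    intro f
    ext n
    rw [coeff_subst' hs, finsum_eq_sum_of_support_subset (s := Finset.range (n + 1))]
    · simp [subs]
    · intro k hk
      simp only [Function.mem_support] at hk
      by_contra hk'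
      simp only [Finset.coe_range, Set.mem_Iio, not_lt] at hk'
      exact hk (by rw [X_pow_dvd_iff.1 (X_pow_dvd_pow hg k) n (by omega), smul_zero])
  rw [key, key, derivative_subst hs, mul_comm]

theorem derivative_exp_eq (g : PowerSeries ℂ) (hg : constantCoeff g = 0) :
    derivative ℂ (exp g) = derivative ℂ g * exp g := by
  rw [exp_eq_subs, derivative_subs hg, derivative_exp]

theorem one_add_X_mul_derivative_log :
    (1 + X) * derivative ℂ (PowerSeries.log ℂ) = 1 := by
  rw [deriv_log]
  ext n
  rcases n with _ | n
  · simp [add_mul]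
  · rw [add_mul, one_mul, map_add, coeff_succ_X_mul, coeff_mk, coeff_mk, coeff_one,
      if_neg n.succ_ne_zero]
    simp [pow_succ]

/-- The product of `binom (-1)` and 1 + X has derivative zero and constant term 1, hence equals 1;
multiplying by `binom 1` gives the claim. -/
theorem binom_one : binom 1 = 1 + X := by
  have h : binom (-1) * (1 + X) = 1 := by
    refine derivative.ext ?_ ?_
    · rw [Derivation.leibniz, map_add, derivative_X, Derivation.map_one_eq_zero, binom,
        neg_one_smul, derivative_exp_eq _ (by simp), map_neg, smul_eq_mul, smul_eq_mul]
      linear_combination (-exp (-PowerSeries.log ℂ)) * one_add_X_mul_derivative_log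
    · simp [binom, constantCoeff_exp]
  have h' : binom 1 * binom (-1) = 1 := by
    rw [← binom_add, add_neg_cancel, binom_zero]
  calc binom 1 = binom 1 * (binom (-1) * (1 + X)) := by rw [h, mul_one]
    _ = 1 + X := by rw [← mul_assoc, h', one_mul]

theorem derivative_log_eq : derivative ℂ (PowerSeries.log ℂ) = binom (-1) := by
  have h' : binom (-1) * binom 1 = 1 := by
    rw [← binom_add, neg_add_cancel, binom_zero]
  calc derivative ℂ (PowerSeries.log ℂ) =
      binom (-1) * binom 1 * derivative ℂ (PowerSeries.log ℂ) := by rw [h', one_mul]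
    _ = _ := by rw [binom_one, mul_assoc, one_add_X_mul_derivative_log, mul_one]

theorem derivative_binom (a : ℂ) : derivative ℂ (binom a) = a • binom (a - 1) := by
  rw [binom, derivative_exp_eq _ (by simp), Derivation.map_smul, derivative_log_eq, ← binom, smul_mul_assoc,
    ← binom_add, neg_add_eq_sub]

variable {R S : Type*} [Ring R] [Algebra ℂ R] [Ring S] [Algebra ℂ S]

/-- `(1 + x) ^ a = exp (a ln (1 + x))`. -/
theorem exp_smul_logOneAdd {x : PowerSeries R} (hx : constantCoeff x = 0) (a : ℂ) :
    exp (a • logOneAdd x) = subs x (binom a) := by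
  rw [logOneAdd_eq_subs, ← subs_smul, exp_eq_subs, ← subs_subs hx (by simp), binom, exp_eq_subs]

theorem exp_logOneAdd {x : PowerSeries R} (hx : constantCoeff x = 0) :
    exp (logOneAdd x) = 1 + x := by
  have := exp_smul_logOneAdd hx 1
  rwa [one_smul, binom_one, subs_add, subs_one hx, subs_X hx] at this

/-- The scalar identity ln(1 + (e^X - 1)) = X holds because both sides have derivative 1 and no
constant term; `y` is then substituted for X. -/
theorem logOneAdd_eq_of_exp_eq {x y : PowerSeries R} (hy : constantCoeff y = 0)
    (h : exp y = 1 + x) : logOneAdd x = y := by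
  have hu : constantCoeff (PowerSeries.exp ℂ - 1) = 0 := by simp
  have key : subs (PowerSeries.exp ℂ - 1) (PowerSeries.log ℂ) = X := by
    refine derivative.ext ?_ ?_
    · have h1 : subs (PowerSeries.exp ℂ - 1) (binom 1) * subs (PowerSeries.exp ℂ - 1)
          (binom (-1)) = 1 := by
        rw [← subs_mul hu, ← binom_add, add_neg_cancel, binom_zero, subs_one hu]
      rw [binom_one, subs_add, subs_one hu, subs_X hu, add_sub_cancel] at h1
      rw [derivative_subs hu, derivative_log_eq, map_sub, Derivation.map_one_eq_zero, sub_zero,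
        derivative_exp, derivative_X, h1]
    · simp [constantCoeff_subs]
  have hx : x = subs y (PowerSeries.exp ℂ - 1) := by
    have : subs y (PowerSeries.exp ℂ - 1 + 1) = subs y (PowerSeries.exp ℂ - 1) + 1 := by
      rw [subs_add, subs_one hy]
    rw [sub_add_cancel, ← exp_eq_subs, h] at this
    exact add_left_cancel (this.trans (add_comm _ _))
  rw [logOneAdd_eq_subs, hx, ← subs_subs hy hu, key, subs_X hy]

/-- The commutation of `(1 + x) ^ a` with an element on which the third iterated commutator with
`x` vanishes. -/
theorem exp_smul_logOneAdd_mul_eq {x y z w : PowerSeries R} (hx : constantCoeff x = 0)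
    (hz : x * y = y * x + z) (hw : x * z = z * x + w) (hxw : x * w = w * x) (a : ℂ) :
    exp (a • logOneAdd x) * y = y * exp (a • logOneAdd x) +
      a • (z * exp ((a - 1) • logOneAdd x)) +
      (a * (a - 1) / 2) • (w * exp ((a - 2) • logOneAdd x)) := by
  simp only [exp_smul_logOneAdd hx]
  rw [subs_mul_eq hx hz hw hxw, derivative_binom, Derivation.map_smul, derivative_binom, subs_smul,
    subs_smul, subs_smul, sub_sub, one_add_one_eq_two]
  simp only [mul_smul_comm, smul_smul]
  congr 2
  ring

/-- The commutator of `ln (1 + x)` with an element on which the third iterated commutator with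
`x` vanishes. -/
theorem logOneAdd_mul_eq {x y z w : PowerSeries R} (hx : constantCoeff x = 0)
    (hz : x * y = y * x + z) (hw : x * z = z * x + w) (hxw : x * w = w * x) :
    logOneAdd x * y = y * logOneAdd x +
      (z * exp (-logOneAdd x) - (1 / 2 : ℂ) • (w * exp ((-2 : ℂ) • logOneAdd x))) := by
  rw [← neg_one_smul ℂ, exp_smul_logOneAdd hx, exp_smul_logOneAdd hx, logOneAdd_eq_subs,
    subs_mul_eq hx hz hw hxw, derivative_log_eq, derivative_binom,
    subs_smul, mul_smul_comm, smul_smul]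
  norm_num
  module

end Binomial

end FormalTwist

/-! ### Embeddings into tensor powers, coproduct and counit on power series. -/

namespace FormalTwist

open PowerSeries
open scoped TensorProduct

section Legs

variable {R S T : Type*} [Ring R] [Algebra ℂ R] [Ring S] [Algebra ℂ S] [Ring T] [Algebra ℂ T]

theorem commute_mapAlgHom {f : R →ₐ[ℂ] T} {g : S →ₐ[ℂ] T} (h : ∀ x y, Commute (f x) (g y))
    (a : PowerSeries R) (b : PowerSeries S) : Commute (mapAlgHom f a) (mapAlgHom g b) := by
  refine PowerSeries.ext fun n => ?_
  simp only [mapAlgHom_apply, coeff_mul, coeff_map]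
  rw [← Finset.Nat.sum_antidiagonal_swap]
  exact Finset.sum_congr rfl fun p _ => h _ _

theorem mapAlgHom_mapAlgHom (f : R →ₐ[ℂ] S) (g : S →ₐ[ℂ] T) (a : PowerSeries R) :
    mapAlgHom g (mapAlgHom f a) = mapAlgHom (g.comp f) a := by
  ext n
  simp [mapAlgHom_apply]

theorem constantCoeff_mapAlgHom (f : R →ₐ[ℂ] S) {a : PowerSeries R} (ha : constantCoeff a = 0) :
    constantCoeff (mapAlgHom f a) = 0 := by
  rw [mapAlgHom_apply, ← coeff_zero_eq_constantCoeff_apply, coeff_map,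
    coeff_zero_eq_constantCoeff_apply, ha, map_zero]

variable {L : Type*} [LieRing L] [LieAlgebra ℂ L]

/-- `a ↦ a ⊗ 1`. -/
noncomputable def leg1 : PowerSeries (U L) →ₐ[ℂ] PowerSeries (U2 L) :=
  mapAlgHom Algebra.TensorProduct.includeLeft

/-- `a ↦ 1 ⊗ a`. -/
noncomputable def leg2 : PowerSeries (U L) →ₐ[ℂ] PowerSeries (U2 L) :=
  mapAlgHom Algebra.TensorProduct.includeRight

/-- The undeformed coproduct of power series. -/
noncomputable def comulPS : PowerSeries (U L) →ₐ[ℂ] PowerSeries (U2 L) := mapAlgHom (comul L)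

/-- `leg12` as an algebra homomorphism. -/
noncomputable def leg12Hom : PowerSeries (U2 L) →ₐ[ℂ] PowerSeries (U3 L) :=
  mapAlgHom Algebra.TensorProduct.includeLeft

/-- `leg23` as an algebra homomorphism. -/
noncomputable def leg23Hom : PowerSeries (U2 L) →ₐ[ℂ] PowerSeries (U3 L) :=
  mapAlgHom (((Algebra.TensorProduct.assoc ℂ ℂ ℂ (U L) (U L) (U L)).symm : _ →ₐ[ℂ] U3 L).comp
      (Algebra.TensorProduct.includeRight : U2 L →ₐ[ℂ] U L ⊗[ℂ] U2 L))

/-- `comulLeft` as an algebra homomorphism. -/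
noncomputable def comulLeftHom : PowerSeries (U2 L) →ₐ[ℂ] PowerSeries (U3 L) :=
  mapAlgHom (Algebra.TensorProduct.map (comul L) (AlgHom.id ℂ (U L)))

/-- `comulRight` as an algebra homomorphism. -/
noncomputable def comulRightHom : PowerSeries (U2 L) →ₐ[ℂ] PowerSeries (U3 L) :=
  mapAlgHom (((Algebra.TensorProduct.assoc ℂ ℂ ℂ (U L) (U L) (U L)).symm : _ →ₐ[ℂ] U3 L).comp
      (Algebra.TensorProduct.map (AlgHom.id ℂ (U L)) (comul L)))

/-- `counitLeft` as an algebra homomorphism. -/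
noncomputable def counitLeftHom : PowerSeries (U2 L) →ₐ[ℂ] PowerSeries (U L) :=
  mapAlgHom (((Algebra.TensorProduct.lid ℂ (U L)) : _ →ₐ[ℂ] U L).comp
      (Algebra.TensorProduct.map (counit L) (AlgHom.id ℂ (U L))))

/-- `counitRight` as an algebra homomorphism. -/
noncomputable def counitRightHom : PowerSeries (U2 L) →ₐ[ℂ] PowerSeries (U L) :=
  mapAlgHom (((Algebra.TensorProduct.rid ℂ ℂ (U L)) : _ →ₐ[ℂ] U L).comp
      (Algebra.TensorProduct.map (AlgHom.id ℂ (U L)) (counit L)))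

theorem tens_eq (a b : PowerSeries (U L)) : tens a b = leg1 a * leg2 b := rfl
-- The ring homomorphisms in the definition of a twist forget ℂ-linearity. As maps of the form
-- `mapAlgHom` they commute with scalars, `exp` and `logOneAdd`.
theorem leg12_eq (y : PowerSeries (U2 L)) : leg12 y = leg12Hom y := rfl
theorem leg23_eq (y : PowerSeries (U2 L)) : leg23 y = leg23Hom y := rfl
theorem comulLeft_eq (y : PowerSeries (U2 L)) : comulLeft y = comulLeftHom y := rfl
theorem comulRight_eq (y : PowerSeries (U2 L)) : comulRight y = comulRightHom y := rfl
theorem counitLeft_eq (y : PowerSeries (U2 L)) : counitLeft y = counitLeftHom y := rfl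
theorem counitRight_eq (y : PowerSeries (U2 L)) : counitRight y = counitRightHom y := rfl

theorem twistedComul_def (F : PowerSeries (U2 L)) (x : PowerSeries (U L)) :
    twistedComul F x = F * comulPS x * Ring.inverse F := rfl

theorem commute_leg1_leg2 (a b : PowerSeries (U L)) : Commute (leg1 a) (leg2 b) :=
  commute_mapAlgHom (fun x y => by simp [Commute, SemiconjBy]) a b

theorem comul_ι (x : L) : comul L (UniversalEnvelopingAlgebra.ι ℂ x) =
    UniversalEnvelopingAlgebra.ι ℂ x ⊗ₜ[ℂ] 1 + 1 ⊗ₜ[ℂ] UniversalEnvelopingAlgebra.ι ℂ x := by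
  simp [comul]

theorem counit_ι (x : L) : counit L (UniversalEnvelopingAlgebra.ι ℂ x) = 0 := by
  simp [counit]

theorem comulPS_C_ι (x : L) : comulPS (C (UniversalEnvelopingAlgebra.ι ℂ x)) =
    leg1 (C (UniversalEnvelopingAlgebra.ι ℂ x)) + leg2 (C (UniversalEnvelopingAlgebra.ι ℂ x)) := by
  simp only [comulPS, leg1, leg2, mapAlgHom_apply, map_C, ← map_add]
  exact congrArg C (comul_ι x)

-- Reduces coassociativity and counitality of Δ to elements of the Lie algebra, where they are
-- immediate.
attribute [local instance 100] LieRing.ofAssociativeRing in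
theorem uea_algHom_ext {f g : U L →ₐ[ℂ] R}
    (h : ∀ x, f (UniversalEnvelopingAlgebra.ι ℂ x) = g (UniversalEnvelopingAlgebra.ι ℂ x)) :
    f = g :=
  UniversalEnvelopingAlgebra.hom_ext ℂ (LieHom.ext h)

/-- The three embeddings of `U(L)[[h]]` into the completed tensor cube. -/
noncomputable def cube1 : PowerSeries (U L) →ₐ[ℂ] PowerSeries (U3 L) := leg12Hom.comp leg1
/-- The second embedding. -/
noncomputable def cube2 : PowerSeries (U L) →ₐ[ℂ] PowerSeries (U3 L) := leg12Hom.comp leg2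
/-- The third embedding. -/
noncomputable def cube3 : PowerSeries (U L) →ₐ[ℂ] PowerSeries (U3 L) :=
  mapAlgHom Algebra.TensorProduct.includeRight

theorem leg12Hom_leg1 (a : PowerSeries (U L)) : leg12Hom (leg1 a) = cube1 a := rfl
theorem leg12Hom_leg2 (a : PowerSeries (U L)) : leg12Hom (leg2 a) = cube2 a := rfl

theorem leg23Hom_leg1 (a : PowerSeries (U L)) : leg23Hom (leg1 a) = cube2 a := by
  simp only [leg23Hom, leg1, cube2, leg12Hom, leg2, AlgHom.comp_apply, mapAlgHom_mapAlgHom]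
  rfl

theorem leg23Hom_leg2 (a : PowerSeries (U L)) : leg23Hom (leg2 a) = cube3 a := by
  simp only [leg23Hom, leg2, cube3, mapAlgHom_mapAlgHom]
  refine congrArg (fun f => mapAlgHom f a) (AlgHom.ext fun x => ?_)
  simp [Algebra.TensorProduct.one_def]

theorem comulLeftHom_leg1 (a : PowerSeries (U L)) :
    comulLeftHom (leg1 a) = leg12Hom (comulPS a) := by
  simp only [comulLeftHom, leg1, comulPS, leg12Hom, mapAlgHom_mapAlgHom]
  refine congrArg (fun f => mapAlgHom f a) (AlgHom.ext fun x => ?_)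
  simp

theorem comulLeftHom_leg2 (a : PowerSeries (U L)) : comulLeftHom (leg2 a) = cube3 a := by
  simp only [comulLeftHom, leg2, cube3, mapAlgHom_mapAlgHom]
  refine congrArg (fun f => mapAlgHom f a) (AlgHom.ext fun x => ?_)
  simp

theorem comulRightHom_leg1 (a : PowerSeries (U L)) : comulRightHom (leg1 a) = cube1 a := by
  simp only [comulRightHom, leg1, cube1, leg12Hom, AlgHom.comp_apply, mapAlgHom_mapAlgHom]
  refine congrArg (fun f => mapAlgHom f a) (AlgHom.ext fun x => ?_)
  simp [Algebra.TensorProduct.one_def]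

theorem comulRightHom_leg2 (a : PowerSeries (U L)) :
    comulRightHom (leg2 a) = leg23Hom (comulPS a) := by
  simp only [comulRightHom, leg2, comulPS, leg23Hom, mapAlgHom_mapAlgHom]
  refine congrArg (fun f => mapAlgHom f a) (AlgHom.ext fun x => ?_)
  simp

theorem commute_leg12Hom_cube3 (y : PowerSeries (U2 L)) (b : PowerSeries (U L)) :
    Commute (leg12Hom y) (cube3 b) :=
  commute_mapAlgHom (fun x y => by simp [Commute, SemiconjBy]) y b

theorem commute_cube1_leg23Hom (a : PowerSeries (U L)) (y : PowerSeries (U2 L)) :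
    Commute (cube1 a) (leg23Hom y) := by
  have h : cube1 a = mapAlgHom (((Algebra.TensorProduct.assoc ℂ ℂ ℂ (U L) (U L) (U L)).symm :
      _ →ₐ[ℂ] U3 L).comp (Algebra.TensorProduct.includeLeft : U L →ₐ[ℂ] U L ⊗[ℂ] U2 L)) a := by
    simp only [cube1, leg1, leg12Hom, AlgHom.comp_apply, mapAlgHom_mapAlgHom]
    refine congrArg (fun f => mapAlgHom f a) (AlgHom.ext fun x => ?_)
    simp [Algebra.TensorProduct.one_def]
  rw [h]
  refine commute_mapAlgHom (fun x y => ?_) a y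
  simp only [Commute, SemiconjBy, AlgHom.comp_apply, ← map_mul]
  simp

theorem counitLeftHom_leg1_C_ι (x : L) :
    counitLeftHom (leg1 (C (UniversalEnvelopingAlgebra.ι ℂ x))) = 0 := by
  simp [counitLeftHom, leg1, mapAlgHom_apply, counit_ι, -UniversalEnvelopingAlgebra.ι_apply]

theorem counitRightHom_leg2_C_ι (x : L) :
    counitRightHom (leg2 (C (UniversalEnvelopingAlgebra.ι ℂ x))) = 0 := by
  simp [counitRightHom, leg2, mapAlgHom_apply, counit_ι, -UniversalEnvelopingAlgebra.ι_apply]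

theorem comul_coassoc (a : PowerSeries (U L)) :
    comulLeftHom (comulPS a) = comulRightHom (comulPS a) := by
  simp only [comulLeftHom, comulRightHom, comulPS, mapAlgHom_mapAlgHom]
  refine congrArg (fun f => mapAlgHom f a) (uea_algHom_ext fun x => ?_)
  simp [-UniversalEnvelopingAlgebra.ι_apply, comul_ι, TensorProduct.add_tmul, TensorProduct.tmul_add, Algebra.TensorProduct.one_def,
    add_assoc]

theorem counitLeftHom_comulPS (a : PowerSeries (U L)) : counitLeftHom (comulPS a) = a := by
  simp only [counitLeftHom, comulPS, mapAlgHom_mapAlgHom]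
  have : (((Algebra.TensorProduct.lid ℂ (U L) : _ →ₐ[ℂ] U L).comp
      (Algebra.TensorProduct.map (counit L) (AlgHom.id ℂ (U L)))).comp
      (comul L)) = AlgHom.id ℂ (U L) := by
    refine uea_algHom_ext fun x => ?_
    simp [comul_ι, counit_ι, -UniversalEnvelopingAlgebra.ι_apply]
  rw [this]
  ext n
  simp [mapAlgHom_apply]

theorem counitRightHom_comulPS (a : PowerSeries (U L)) : counitRightHom (comulPS a) = a := by
  simp only [counitRightHom, comulPS, mapAlgHom_mapAlgHom]
  have : (((Algebra.TensorProduct.rid ℂ ℂ (U L) : _ →ₐ[ℂ] U L).comp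
      (Algebra.TensorProduct.map (AlgHom.id ℂ (U L)) (counit L))).comp
      (comul L)) = AlgHom.id ℂ (U L) := by
    refine uea_algHom_ext fun x => ?_
    simp [comul_ι, counit_ι, -UniversalEnvelopingAlgebra.ι_apply]
  rw [this]
  ext n
  simp [mapAlgHom_apply]

end Legs

/-! ### Criteria for twists. -/

section Twist

variable {L : Type*} [LieRing L] [LieAlgebra ℂ L]

/-- Conjugations are carried as `SemiconjBy` relations, which contain no inverse and compose under
sums and products in every argument. Only here is the inverse restored. -/
theorem _root_.IsUnit.mul_mul_inverse_eq {R : Type*} [Ring R] {F a b : R} (hF : IsUnit F)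
    (h : SemiconjBy F a b) : F * a * Ring.inverse F = b := by
  rw [h.eq, mul_assoc, Ring.mul_inverse_cancel _ hF, mul_one]

theorem twistedComul_eq {F : PowerSeries (U2 L)} (hF : IsUnit F) {x : PowerSeries (U L)}
    {y : PowerSeries (U2 L)} (h : SemiconjBy F (comulPS x) y) : twistedComul F x = y :=
  hF.mul_mul_inverse_eq h

theorem _root_.RingHom.map_ring_inverse {R S : Type*} [Ring R] [Ring S] (φ : R →+* S) {F : R}
    (hF : IsUnit F) : φ (Ring.inverse F) = Ring.inverse (φ F) := by
  have h1 : φ (Ring.inverse F) * φ F = 1 := by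
    rw [← map_mul, Ring.inverse_mul_cancel _ hF, map_one]
  rw [← mul_one (φ (Ring.inverse F)), ← Ring.mul_inverse_cancel _ (hF.map φ), ← mul_assoc, h1,
    one_mul]

theorem _root_.Ring.inverse_mul_of_isUnit {R : Type*} [Ring R] {a b : R} (ha : IsUnit a)
    (hb : IsUnit b) : Ring.inverse (a * b) = Ring.inverse b * Ring.inverse a := by
  obtain ⟨a, rfl⟩ := ha
  obtain ⟨b, rfl⟩ := hb
  rw [← Units.val_mul, Ring.inverse_unit, Ring.inverse_unit, Ring.inverse_unit, mul_inv_rev,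
    Units.val_mul]

/-- A twist of a twist. -/
theorem IsTwist.mul {F G : PowerSeries (U2 L)} (hG : IsTwist 1 G) (hF : IsTwist G F) :
    IsTwist 1 (F * G) where
  isUnit := hF.isUnit.mul hG.isUnit
  cocycle := by
    have h1 := hG.cocycle
    have h2 := hF.cocycle
    have u1 : IsUnit (leg12 G) := hG.isUnit.map leg12
    have u2 : IsUnit (leg23 G) := hG.isUnit.map leg23
    simp only [twistedComulLeft, twistedComulRight, map_one, one_mul, Ring.inverse_one,
      mul_one, map_mul] at *
    -- Inserting the inverse of G₁₂ next to G₁₂ separates the Drinfeld equation of F for Δ_G from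
    -- that of G for Δ.
    calc leg12 F * leg12 G * (comulLeft F * comulLeft G)
        = leg12 F * (leg12 G * comulLeft F * Ring.inverse (leg12 G)) *
          (leg12 G * comulLeft G) := by
          simp only [mul_assoc]
          rw [← mul_assoc (Ring.inverse _), Ring.inverse_mul_cancel _ u1, one_mul]
      _ = leg23 F * leg23 G * (comulRight F * comulRight G) := by
          rw [h1, h2]
          simp only [mul_assoc]
          rw [← mul_assoc (Ring.inverse _), Ring.inverse_mul_cancel _ u2, one_mul]
  counit_left := by rw [map_mul, hF.counit_left, hG.counit_left, one_mul]
  counit_right := by rw [map_mul, hF.counit_right, hG.counit_right, one_mul]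

/-- The element `exp (a ⊗ b)` is a twist for `Δ_G` when `Δ_G a = a ⊗ g + 1 ⊗ a` and, after the
twist, `Δ b = b ⊗ 1 + g ⊗ b`. -/
theorem isTwist_exp_tens {G : PowerSeries (U2 L)} (hG : IsUnit G) {a b g : PowerSeries (U L)}
    (hb : constantCoeff b = 0) (hga : Commute g a) (hgb : Commute g b)
    (ha : SemiconjBy G (comulPS a) (tens a g + leg2 a))
    (hb' : SemiconjBy (exp (tens a b) * G) (comulPS b) (leg1 b + tens g b))
    (hl : counitLeftHom (leg1 a) = 0) (hr : counitRightHom (leg2 b) = 0) :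
    IsTwist G (exp (tens a b)) := by
  have h0 : constantCoeff (tens a b) = 0 := by
    rw [tens_eq, map_mul, leg2, constantCoeff_mapAlgHom _ hb, mul_zero]
  have h3 : ∀ x, constantCoeff (x * cube3 b) = 0 := fun x => by
    rw [map_mul, cube3, constantCoeff_mapAlgHom _ hb, mul_zero]
  have hb2 : constantCoeff (cube2 b) = 0 := by
    rw [← leg12Hom_leg2]
    exact constantCoeff_mapAlgHom _ (constantCoeff_mapAlgHom _ hb)
  have h2 : ∀ x, constantCoeff (x * cube2 b) = 0 := fun x => by rw [map_mul, hb2, mul_zero]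
  have hU : IsUnit (exp (tens a b)) := isUnit_exp h0
  have e12 : leg12Hom (exp (tens a b)) = exp (cube1 a * cube2 b) := by
    rw [leg12Hom, mapAlgHom_exp]
    congr 1
    rw [tens_eq, map_mul]
    rfl
  have e23 : leg23Hom (exp (tens a b)) = exp (cube2 a * cube3 b) := by
    rw [leg23Hom, mapAlgHom_exp, ← leg23Hom, tens_eq, map_mul, leg23Hom_leg1, leg23Hom_leg2]
  have eL : comulLeftHom (exp (tens a b)) = exp (leg12Hom (comulPS a) * cube3 b) := by
    rw [comulLeftHom, mapAlgHom_exp, ← comulLeftHom, tens_eq, map_mul, comulLeftHom_leg1,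
      comulLeftHom_leg2]
  have eR : comulRightHom (exp (tens a b)) = exp (cube1 a * leg23Hom (comulPS b)) := by
    rw [comulRightHom, mapAlgHom_exp, ← comulRightHom, tens_eq, map_mul, comulRightHom_leg1,
      comulRightHom_leg2]
  have c12 : ∀ x y : PowerSeries (U L), Commute (cube1 x) (cube2 y) := fun x y => by
    rw [← leg23Hom_leg1]
    exact commute_cube1_leg23Hom _ _
  have c13 : ∀ x y : PowerSeries (U L), Commute (cube1 x) (cube3 y) := fun x y => by
    rw [← leg23Hom_leg2]
    exact commute_cube1_leg23Hom _ _
  have c23 : ∀ x y : PowerSeries (U L), Commute (cube2 x) (cube3 y) := fun x y => by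
    rw [← leg12Hom_leg2]
    exact commute_leg12Hom_cube3 _ _
  -- Applying Δ_G to the first leg turns the exponent into a⊗g⊗b + 1⊗a⊗b; the two summands commute
  -- because `g` commutes with `a`.
  have hLeft : SemiconjBy (leg12Hom G) (comulLeftHom (exp (tens a b)))
      (exp (cube1 a * cube2 g * cube3 b) * exp (cube2 a * cube3 b)) := by
    rw [eL, ← exp_add (h3 _) (h3 _)]
    · refine semiconjBy_exp ?_ (h3 _) ?_
      · rw [map_add, h3, h3, add_zero]
      · have := (ha.map leg12Hom).mul_right (commute_leg12Hom_cube3 G b)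
        rwa [map_add, tens_eq, map_mul, add_mul, leg12Hom_leg1, leg12Hom_leg2,
          leg12Hom_leg2] at this
    · refine Commute.mul_left ?_ ?_
      · refine Commute.mul_left ?_ ?_
        · exact (c12 _ _).mul_right (c13 _ _)
        · exact (hga.map cube2).mul_right (c23 _ _)
      · exact (c23 _ _).symm.mul_right (Commute.refl _)
  -- On the other side the conjugator is Φ₂₃G₂₃ and the exponent becomes a⊗b⊗1 + a⊗g⊗b, with
  -- commuting summands because `g` commutes with `b`.
  have hRight : SemiconjBy (leg23Hom (exp (tens a b)) * leg23Hom G)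
      (comulRightHom (exp (tens a b)))
      (exp (cube1 a * cube2 b) * exp (cube1 a * cube2 g * cube3 b)) := by
    rw [eR, ← exp_add (h2 _) (h3 _)]
    · refine semiconjBy_exp ?_ ?_ ?_
      · rw [map_add, h2, h3, add_zero]
      · rw [map_mul, leg23Hom, constantCoeff_mapAlgHom, mul_zero]
        exact constantCoeff_mapAlgHom _ hb
      · have := SemiconjBy.mul_right (commute_cube1_leg23Hom a (exp (tens a b) * G)).symm
          (hb'.map leg23Hom)
        rwa [map_add, tens_eq g, map_mul leg23Hom _ G, map_mul leg23Hom (leg1 g), mul_add, leg23Hom_leg1,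
          leg23Hom_leg1, leg23Hom_leg2, ← mul_assoc] at this
    · refine Commute.mul_left ?_ ?_
      · exact ((Commute.refl _).mul_right (c12 _ _)).mul_right (c13 _ _)
      · exact ((c12 _ _).symm.mul_right (hgb.map cube2).symm).mul_right (c23 _ _)
  constructor
  · exact hU
  · have u1 : IsUnit (leg12Hom G) := hG.map leg12Hom
    have u2 : IsUnit (leg23Hom G) := hG.map leg23Hom
    simp only [twistedComulLeft, twistedComulRight, leg12_eq, leg23_eq, comulLeft_eq,
      comulRight_eq]
    rw [u1.mul_mul_inverse_eq hLeft, ← mul_assoc, ← mul_assoc, ← mul_assoc, hRight.eq]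
    simp only [mul_assoc]
    rw [Ring.mul_inverse_cancel _ u2, mul_one, e12, e23]
  · rw [counitLeft_eq, counitLeftHom, mapAlgHom_exp, ← counitLeftHom, tens_eq, map_mul, hl,
      zero_mul, exp_zero]
  · rw [counitRight_eq, counitRightHom, mapAlgHom_exp, ← counitRightHom, tens_eq, map_mul, hr,
      mul_zero, exp_zero]

/-- The two iterated coproducts are conjugates of the same undeformed one, by F₁₂(Δ⊗id)F and by
F₂₃(id⊗Δ)F. The cocycle equation says that these conjugators coincide. -/
theorem IsTwist.isTwistedBialgebra {F : PowerSeries (U2 L)} (hF : IsTwist 1 F) :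
    IsTwistedBialgebra F := by
  have u := hF.isUnit
  have uL := Ring.mul_inverse_cancel _ u
  have uR := Ring.inverse_mul_cancel _ u
  have hc := hF.cocycle
  simp only [twistedComulLeft, twistedComulRight, map_one, one_mul, Ring.inverse_one,
    mul_one] at hc
  constructor
  · simp only [twistedComul_def, map_one, mul_one, uL]
  · intro x y
    simp only [twistedComul_def, map_add, mul_add, add_mul]
  · intro x y
    simp only [twistedComul_def, map_mul, mul_assoc]
    rw [← mul_assoc (Ring.inverse F) F, uR, one_mul]
  · intro x
    have v1 : IsUnit (leg12 F) := u.map leg12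
    have v2 : IsUnit (leg23 F) := u.map leg23
    have w1 : IsUnit (comulLeft F) := u.map comulLeft
    have w2 : IsUnit (comulRight F) := u.map comulRight
    simp only [twistedComulLeft, twistedComulRight, twistedComul_def, map_mul]
    rw [comulLeft.map_ring_inverse u, comulRight.map_ring_inverse u]
    have e : comulLeft (comulPS x) = comulRight (comulPS x) := comul_coassoc x
    have i1 := (Ring.inverse_mul_of_isUnit v1 w1).symm
    have i2 := (Ring.inverse_mul_of_isUnit v2 w2).symm
    calc leg12 F * (comulLeft F * comulLeft (comulPS x) * Ring.inverse (comulLeft F)) *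
          Ring.inverse (leg12 F)
        = (leg12 F * comulLeft F) * comulLeft (comulPS x) *
          (Ring.inverse (comulLeft F) * Ring.inverse (leg12 F)) := by simp only [mul_assoc]
      _ = (leg23 F * comulRight F) * comulRight (comulPS x) *
          (Ring.inverse (comulRight F) * Ring.inverse (leg23 F)) := by rw [i1, i2, hc, e]
      _ = _ := by simp only [mul_assoc]
  · intro x
    rw [twistedComul_def, map_mul, map_mul, counitLeft.map_ring_inverse u, hF.counit_left, Ring.inverse_one, one_mul,
      mul_one]
    exact counitLeftHom_comulPS x
  · intro x
    rw [twistedComul_def, map_mul, map_mul, counitRight.map_ring_inverse u, hF.counit_right, Ring.inverse_one, one_mul,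
      mul_one]
    exact counitRightHom_comulPS x

end Twist

end FormalTwist

/-! A verified rewriting procedure for noncommutative polynomials with dyadic coefficients. -/

namespace Rewriting

/-- The term `num / 2 ^ den • word` of a noncommutative polynomial; the letters are numbered. -/
structure Term where
  num : ℤ
  den : ℕ
  word : List ℕ

/-- Noncommutative polynomials. -/
abbrev Poly := List Term

/-- The rule `(a, b) ↦ p` rewrites the word `a b` into `p`. -/
abbrev Rules := ℕ → ℕ → Option Poly

namespace Poly

/-- Equality of words. -/
def wordBeq : List ℕ → List ℕ → Bool
  | [], [] => true
  | a :: v, b :: w => bif Nat.beq a b then wordBeq v w else false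
  | _, _ => false

/-- Adds a term, collecting like terms. -/
def insert (n : ℤ) (k : ℕ) (w : List ℕ) : Poly → Poly
  | [] => [⟨n, k, w⟩]
  | t :: p => bif wordBeq w t.word then
      -- Fractions are never reduced; a coefficient vanishes exactly when its numerator does.
      ⟨n * (2 ^ t.den : ℕ) + t.num * (2 ^ k : ℕ), k + t.den, w⟩ :: p
    else t :: insert n k w p

/-- Rewrites `c • pre.reverse * rest`, where no rule applies inside `pre.reverse`, and adds the
result to `acc`. -/
def rewrite (T : Rules) : ℕ → ℤ → ℕ → List ℕ → List ℕ → Poly → Poly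
  -- When the fuel runs out the word is kept as it stands, which preserves the value but perhaps not
  -- normality.
  | 0, n, k, pre, rest, acc => insert n k (pre.reverse ++ rest) acc
  | _ + 1, n, k, pre, [], acc => insert n k pre.reverse acc
  | f + 1, n, k, [], a :: rest, acc => rewrite T f n k [a] rest acc
  | f + 1, n, k, b :: pre, a :: rest, acc =>
    match T b a with
    | none => rewrite T f n k (a :: b :: pre) rest acc
    | some p => p.foldr (fun t acc => rewrite T f (n * t.num) (k + t.den) pre (t.word ++ rest) acc)
        acc

/-- Drops the vanishing terms. -/
def clean (p : Poly) : Poly := p.filter fun t => !(t.num == 0)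

/-- The normal form of the product of two polynomials. -/
def mul (T : Rules) (p q : Poly) : Poly :=
  clean (p.foldr (fun t acc => q.foldr (fun u acc =>
    -- The fuel only has to be ample; soundness does not depend on it.
    rewrite T 10000 (t.num * u.num) (t.den + u.den) [] (t.word ++ u.word) acc) acc) [])

/-- The sum of two polynomials. -/
def add (p q : Poly) : Poly := clean (p.foldr (fun t acc => insert t.num t.den t.word acc) q)

/-- The multiple `n / 2 ^ k • p`. -/
def smul (n : ℤ) (k : ℕ) (p : Poly) : Poly := p.map fun t => ⟨n * t.num, k + t.den, t.word⟩

/-- The difference of two polynomials. -/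
def sub (p q : Poly) : Poly := add p (smul (-1) 0 q)

/-- Whether a polynomial has no terms. -/
def isZero : Poly → Bool
  | [] => true
  | _ :: _ => false

/-- The commutator of two polynomials. -/
def comm (T : Rules) (p q : Poly) : Poly := sub (mul T p q) (mul T q p)

/-- The image of a word under a partial substitution of polynomials for letters. -/
def substWord (T : Rules) (m : ℕ → Option Poly) : List ℕ → Option Poly
  | [] => some [⟨1, 0, []⟩]
  | a :: w => match m a, substWord T m w with
    | some p, some q => some (mul T p q)
    | _, _ => none

/-- The image of a polynomial under a partial substitution of polynomials for letters. -/
def subst (T : Rules) (m : ℕ → Option Poly) : Poly → Option Poly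
  | [] => some []
  | t :: p => match substWord T m t.word, subst T m p with
    | some q, some r => some (add (smul t.num t.den q) r)
    | _, _ => none

end Poly

section Eval

variable {R : Type*} [Ring R] [Algebra ℂ R]

/-- The value of a term. -/
noncomputable def Term.eval (ρ : ℕ → R) (t : Term) : R :=
  ((t.num : ℂ) / 2 ^ t.den) • (t.word.map ρ).prod

/-- The value of a polynomial. -/
noncomputable def Poly.eval (ρ : ℕ → R) (p : Poly) : R := (p.map (Term.eval ρ)).sum

/-- The rules hold for the given values of the letters. -/
def Rules.Sound (T : Rules) (ρ : ℕ → R) : Prop :=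
  ∀ a b p, T a b = some p → ρ a * ρ b = Poly.eval ρ p

namespace Poly

variable (ρ : ℕ → R)

@[simp] theorem eval_nil : eval ρ [] = 0 := rfl

@[simp] theorem eval_cons (t : Term) (p : Poly) : eval ρ (t :: p) = t.eval ρ + eval ρ p := by
  simp [eval]

theorem eq_of_wordBeq : ∀ {v w : List ℕ}, wordBeq v w = true → v = w
  | [], [], _ => rfl
  | a :: v, b :: w, h => by
    rw [wordBeq, Bool.cond_false_right, Bool.and_eq_true] at h
    rw [Nat.eq_of_beq_eq_true h.1, eq_of_wordBeq h.2]
  | [], _ :: _, h => by simp [wordBeq] at h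
  | _ :: _, [], h => by simp [wordBeq] at h

theorem eval_insert (n : ℤ) (k : ℕ) (w : List ℕ) (p : Poly) :
    eval ρ (insert n k w p) = Term.eval ρ ⟨n, k, w⟩ + eval ρ p := by
  induction p with
  | nil => rfl
  | cons t p ih =>
    rw [insert]
    cases h : wordBeq w t.word with
    | true =>
      rw [cond_true, eval_cons, eval_cons, ← add_assoc]
      congr 1
      rw [eq_of_wordBeq h, Term.eval, Term.eval, Term.eval, ← add_smul]
      congr 1
      push_cast
      rw [pow_add]
      field_simp
    | false =>
      rw [cond_false, eval_cons, eval_cons, ih]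
      abel

theorem eval_foldr_insert {α : Type*} (f : α → Poly → Poly) (g : α → R)
    (hf : ∀ a acc, eval ρ (f a acc) = g a + eval ρ acc) (l : List α) (acc : Poly) :
    eval ρ (l.foldr f acc) = (l.map g).sum + eval ρ acc := by
  induction l with
  | nil => simp
  | cons a l ih => rw [List.foldr_cons, hf, ih, List.map_cons, List.sum_cons, add_assoc]

/-- Only the truth of the rules is needed. Termination and confluence play no role: an incomplete
normal form could make a check fail, but never make it accept a false identity. -/
theorem eval_rewrite {T : Rules} (hT : T.Sound ρ) (f : ℕ) : ∀ (n : ℤ) (k : ℕ)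
    (pre rest : List ℕ) (acc : Poly), eval ρ (rewrite T f n k pre rest acc) =
      Term.eval ρ ⟨n, k, pre.reverse ++ rest⟩ + eval ρ acc := by
  induction f with
  | zero => exact fun n k pre rest acc => eval_insert ρ n k _ acc
  | succ f ih =>
    rintro n k pre (_ | ⟨a, rest⟩) acc
    · rw [rewrite, eval_insert, List.append_nil]
    rcases pre with _ | ⟨b, pre⟩
    · rw [rewrite, ih]
      rfl
    · rw [rewrite]
      cases h : T b a with
      | none => simp [ih]
      | some p =>
        simp only
        rw [eval_foldr_insert ρ _ _ (fun t acc => ih (n * t.num) (k + t.den) pre _ acc)]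
        congr 1
        simp only [Term.eval, List.map_append, List.prod_append, List.reverse_cons, List.map_cons,
          List.map_nil, List.prod_cons, List.prod_nil, mul_one]
        have := hT b a p h
        rw [mul_assoc, ← mul_assoc (ρ b), this, eval, ← List.sum_map_mul_right,
          ← List.sum_map_mul_left, List.smul_sum, List.map_map]
        congr 1
        refine List.map_congr_left fun t _ => ?_
        simp only [Function.comp_apply, Term.eval, smul_mul_assoc, mul_smul_comm, smul_smul]
        congr 1
        push_cast
        rw [pow_add]
        field_simp

theorem eval_clean (p : Poly) : eval ρ (clean p) = eval ρ p := by
  induction p with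
  | nil => rfl
  | cons t p ih =>
    rw [clean, List.filter_cons]
    split_ifs with h
    · rw [eval_cons, eval_cons, ← clean, ih]
    · have h0 : t.num = 0 := by simpa using h
      rw [← clean, ih, eval_cons, Term.eval, h0]
      simp

theorem eval_mul {T : Rules} (hT : T.Sound ρ) (p q : Poly) :
    eval ρ (mul T p q) = eval ρ p * eval ρ q := by
  rw [mul, eval_clean, eval_foldr_insert ρ _ (fun t => t.eval ρ * eval ρ q), eval_nil, add_zero,
    List.sum_map_mul_right]
  · rfl
  intro t acc
  rw [eval_foldr_insert ρ _ (fun u => t.eval ρ * u.eval ρ), List.sum_map_mul_left]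
  · rfl
  intro u acc
  rw [eval_rewrite ρ hT]
  congr 1
  simp only [Term.eval, List.reverse_nil, List.nil_append, List.map_append, List.prod_append,
    smul_mul_smul_comm]
  congr 1
  push_cast
  rw [pow_add]
  field_simp

theorem eval_add (p q : Poly) : eval ρ (add p q) = eval ρ p + eval ρ q := by
  rw [add, eval_clean, eval_foldr_insert ρ _ (Term.eval ρ)]
  · rfl
  · exact fun t acc => eval_insert ρ _ _ _ _

theorem eval_smul (n : ℤ) (k : ℕ) (p : Poly) :
    eval ρ (smul n k p) = ((n : ℂ) / 2 ^ k) • eval ρ p := by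
  rw [smul, eval, eval, List.smul_sum, List.map_map, List.map_map]
  congr 1
  refine List.map_congr_left fun t _ => ?_
  simp only [Function.comp_apply, Term.eval, smul_smul]
  congr 1
  push_cast
  rw [pow_add]
  field_simp

theorem eval_sub (p q : Poly) : eval ρ (sub p q) = eval ρ p - eval ρ q := by
  rw [sub, eval_add, eval_smul]
  simp [sub_eq_add_neg]

theorem eval_comm {T : Rules} (hT : T.Sound ρ) (p q : Poly) :
    eval ρ (comm T p q) = eval ρ p * eval ρ q - eval ρ q * eval ρ p := by
  rw [comm, eval_sub, eval_mul ρ hT, eval_mul ρ hT]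

/-- The passage from a Boolean computation to an identity in the algebra. -/
theorem eval_eq_of_isZero_sub {p q : Poly} (h : isZero (sub p q) = true) :
    eval ρ p = eval ρ q := by
  rw [← sub_eq_zero, ← eval_sub]
  cases hs : sub p q with
  | nil => rfl
  | cons t r => simp [hs, isZero] at h

/-- Conjugation is multiplicative, so the images of the letters determine those of words. The
substitution is partial because only the letters that occur need a tabulated image. -/
theorem semiconjBy_substWord {T : Rules} (hT : T.Sound ρ) {m : ℕ → Option Poly} {F : R}
    (hm : ∀ a p, m a = some p → SemiconjBy F (ρ a) (eval ρ p)) :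
    ∀ (w : List ℕ) (p : Poly), substWord T m w = some p →
      SemiconjBy F (w.map ρ).prod (eval ρ p)
  | [], p, h => by
    obtain rfl : [⟨1, 0, []⟩] = p := Option.some.inj h
    simp [Term.eval]
  | a :: w, p, h => by
    rw [substWord] at h
    cases h1 : m a with
    | none => simp [h1] at h
    | some p1 =>
      cases h2 : substWord T m w with
      | none => simp [h1, h2] at h
      | some p2 =>
        simp only [h1, h2, Option.some.injEq] at h
        rw [← h, eval_mul ρ hT, List.map_cons, List.prod_cons]
        exact (hm a p1 h1).mul_right (semiconjBy_substWord hT hm w p2 h2)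

/-- Conjugation is a substitution. -/
theorem semiconjBy_subst {T : Rules} (hT : T.Sound ρ) {m : ℕ → Option Poly} {F : R}
    (hm : ∀ a p, m a = some p → SemiconjBy F (ρ a) (eval ρ p)) :
    ∀ (q p : Poly), subst T m q = some p → SemiconjBy F (eval ρ q) (eval ρ p)
  | [], p, h => by
    obtain rfl : [] = p := Option.some.inj h
    simp
  | t :: q, p, h => by
    rw [subst] at h
    cases h1 : substWord T m t.word with
    | none => simp [h1] at h
    | some p1 =>
      cases h2 : subst T m q with
      | none => simp [h1, h2] at h
      | some p2 =>
        simp only [h1, h2, Option.some.injEq] at h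
        rw [← h, eval_add, eval_smul, eval_cons, Term.eval]
        refine SemiconjBy.add_right ?_ (semiconjBy_subst hT hm q p2 h2)
        have := (semiconjBy_substWord ρ hT hm _ p1 h1).eq
        rw [SemiconjBy, mul_smul_comm, smul_mul_assoc, this]

end Poly

end Eval

end Rewriting

/-! ### Brackets of the root basis. -/

namespace So5

open FormalTwist

theorem M_self (j : Fin 5) : M j j = 0 := by
  ext
  simp [M]

theorem M_swap (j k : Fin 5) : M j k = -M k j := by
  ext
  simp [M]

attribute [local instance 100] LieRing.ofAssociativeRing in
theorem lie_M (j k l m : Fin 5) : ⁅M j k, M l m⁆ =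
    (if k = l then M j m else 0) - (if k = m then M j l else 0) -
    (if j = l then M k m else 0) + (if j = m then M k l else 0) := by
  apply Subtype.ext
  rw [LieSubalgebra.coe_bracket, Ring.lie_def]
  have h : ∀ a b c d : Fin 5, Matrix.single a b (1 : ℂ) * Matrix.single c d 1 =
      if b = c then Matrix.single a d 1 else 0 := by
    intro a b c d
    split_ifs with hbc
    · subst hbc
      simp
    · exact Matrix.single_mul_single_of_ne _ _ _ _ hbc _
  have hadd : ∀ x y : so5, (x + y).1 = x.1 + y.1 := fun _ _ => rfl
  have hsub : ∀ x y : so5, (x - y).1 = x.1 - y.1 := fun _ _ => rfl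
  have hite : ∀ (p : Prop) [Decidable p] (x : so5), (if p then x else 0).1 =
      if p then x.1 else 0 := fun p _ x => by split_ifs <;> rfl
  rw [hadd, hsub, hsub, hite, hite, hite, hite]
  simp only [M, sub_mul, mul_sub, h]
  simp only [@eq_comm _ m j, @eq_comm _ m k, @eq_comm _ l j, @eq_comm _ l k]
  split_ifs <;> abel

/-- The only property of √2 that the brackets use. -/
theorem sqrtTwo_inv_sq : (1 / sqrtTwo) ^ 2 = 1 / 2 := by
  have : sqrtTwo ^ 2 = 2 := by
    rw [sqrtTwo, ← Complex.ofReal_pow, Real.sq_sqrt (by norm_num)]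
    norm_num
  rw [div_pow, this, one_pow]

/-- The brackets of the root basis. -/
theorem lie_root :
    ⁅rootF1, rootFp⁆ = 0 ∧
    ⁅rootFm, rootFp⁆ = 0 ∧
    ⁅rootFm, rootF1⁆ = 0 ∧
    ⁅rootF2, rootFp⁆ = 0 ∧
    ⁅rootF2, rootF1⁆ = rootFp ∧
    ⁅rootF2, rootFm⁆ = -rootF1 ∧
    ⁅rootE2, rootFp⁆ = rootF1 ∧
    ⁅rootE2, rootF1⁆ = -rootFm ∧
    ⁅rootE2, rootFm⁆ = 0 ∧
    ⁅rootE2, rootF2⁆ = rootHp - rootHm ∧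
    ⁅rootHp, rootFp⁆ = -rootFp ∧
    ⁅rootHp, rootF1⁆ = (-1/2 : ℂ) • rootF1 ∧
    ⁅rootHp, rootFm⁆ = 0 ∧
    ⁅rootHp, rootF2⁆ = (-1/2 : ℂ) • rootF2 ∧
    ⁅rootHp, rootE2⁆ = (1/2 : ℂ) • rootE2 ∧
    ⁅rootHm, rootFp⁆ = 0 ∧
    ⁅rootHm, rootF1⁆ = (-1/2 : ℂ) • rootF1 ∧
    ⁅rootHm, rootFm⁆ = -rootFm ∧
    ⁅rootHm, rootF2⁆ = (1/2 : ℂ) • rootF2 ∧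
    ⁅rootHm, rootE2⁆ = (-1/2 : ℂ) • rootE2 ∧
    ⁅rootHm, rootHp⁆ = 0 ∧
    ⁅rootEm, rootFp⁆ = 0 ∧
    ⁅rootEm, rootF1⁆ = rootF2 ∧
    ⁅rootEm, rootFm⁆ = (2 : ℂ) • rootHm ∧
    ⁅rootEm, rootF2⁆ = 0 ∧
    ⁅rootEm, rootE2⁆ = -rootE1 ∧
    ⁅rootEm, rootHp⁆ = 0 ∧
    ⁅rootEm, rootHm⁆ = -rootEm ∧
    ⁅rootE1, rootFp⁆ = -rootF2 ∧
    ⁅rootE1, rootF1⁆ = rootHp + rootHm ∧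
    ⁅rootE1, rootFm⁆ = rootE2 ∧
    ⁅rootE1, rootF2⁆ = -rootEm ∧
    ⁅rootE1, rootE2⁆ = rootEp ∧
    ⁅rootE1, rootHp⁆ = (-1/2 : ℂ) • rootE1 ∧
    ⁅rootE1, rootHm⁆ = (-1/2 : ℂ) • rootE1 ∧
    ⁅rootE1, rootEm⁆ = 0 ∧
    ⁅rootEp, rootFp⁆ = (2 : ℂ) • rootHp ∧
    ⁅rootEp, rootF1⁆ = -rootE2 ∧
    ⁅rootEp, rootFm⁆ = 0 ∧
    ⁅rootEp, rootF2⁆ = rootE1 ∧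
    ⁅rootEp, rootE2⁆ = 0 ∧
    ⁅rootEp, rootHp⁆ = -rootEp ∧
    ⁅rootEp, rootHm⁆ = 0 ∧
    ⁅rootEp, rootEm⁆ = 0 ∧
    ⁅rootEp, rootE1⁆ = 0 := by
  have hr := sqrtTwo_inv_sq
  have hI := Complex.I_sq
  simp only [rootHp, rootHm, rootEp, rootEm, rootE1, rootE2, rootF1, rootF2, rootFm, rootFp]
  -- With 1/√2 and i replaced by free scalars subject to r² = 1/2 and I² = -1, each bracket becomes
  -- polynomial algebra over ℂ.
  generalize 1 / sqrtTwo = r at *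
  generalize Complex.I = I at *
  simp only [lie_add, add_lie, lie_sub, sub_lie, lie_smul, smul_lie, lie_neg, neg_lie, lie_M,
    Fin.reduceEq, if_true, if_false, M_self]
  -- Orienting all indices increasingly leaves only basis matrices, so coefficients can be compared
  -- one by one.
  simp only [M_swap 1 0, M_swap 2 0, M_swap 3 0, M_swap 4 0, M_swap 2 1, M_swap 3 1, M_swap 4 1,
    M_swap 3 2, M_swap 4 2, M_swap 4 3]
  and_intros
  all_goals match_scalars <;> grind

end So5

/-! ### The generators as power series, and the exponentials of σ and τ. -/

namespace So5

open FormalTwist PowerSeries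

theorem gen_mul_gen (x y : so5) : gen x * gen y = gen y * gen x + gen ⁅x, y⁆ := by
  simp only [gen, ← map_mul, ← map_add]
  congr 1
  let _ : LieRing (U so5) := LieRing.ofAssociativeRing
  rw [LieHom.map_lie, LieRing.of_associative_ring_bracket, add_sub_cancel]

theorem gen_add (x y : so5) : gen (x + y) = gen x + gen y := by
  simp only [gen, map_add]

theorem gen_sub (x y : so5) : gen (x - y) = gen x - gen y := by
  simp only [gen, map_sub]

theorem gen_neg (x : so5) : gen (-x) = -gen x := by
  simp only [gen, map_neg]

theorem gen_zero : gen 0 = 0 := by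
  simp only [gen, map_zero]

theorem gen_smul (c : ℂ) (x : so5) : gen (c • x) = c • gen x := by
  refine PowerSeries.ext fun n => ?_
  simp only [gen, map_smul, coeff_smul, coeff_C]
  split_ifs <;> simp

theorem mul_h (x : PowerSeries (U so5)) : x * h = h * x := X_mul.symm

theorem mul_h_mul (x y : PowerSeries (U so5)) : x * (h * y) = h * (x * y) := by
  rw [← mul_assoc, mul_h, mul_assoc]

theorem constantCoeff_h_mul (x : PowerSeries (U so5)) : constantCoeff (h * x) = 0 := by
  simp [h]

theorem constantCoeff_Ep : constantCoeff Ep = 0 := constantCoeff_h_mul _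

theorem constantCoeff_EBO : constantCoeff EBO = 0 := by
  have : EBO = h * (gen rootEm + (1 / 2 : ℂ) • (gen rootE1 * (E1 * exp (-sigma)))) := by
    rw [EBO, Em, E1, pow_two, mul_add, mul_smul_comm]
    simp only [mul_assoc]
  rw [this, constantCoeff_h_mul]

theorem constantCoeff_sigma : constantCoeff sigma = 0 := constantCoeff_logOneAdd _
theorem constantCoeff_sigmaBO : constantCoeff sigmaBO = 0 := constantCoeff_logOneAdd _

theorem commute_h_mul_gen {x y : so5} (hxy : ⁅x, y⁆ = 0) :
    Commute (h * gen x) (h * gen y) := by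
  have h1 : Commute (gen x) (gen y) := by
    rw [Commute, SemiconjBy, gen_mul_gen, hxy, gen_zero, add_zero]
  have hc : ∀ z, Commute h z := fun z => (mul_h z).symm
  exact ((hc _).mul_left ((hc _).symm.mul_right h1))

theorem commute_Ep_E1 : Commute Ep E1 := by
  obtain ⟨-, -, -, -, -, -, -, -, -, -, -, -, -, -, -, -, -, -, -, -, -, -, -, -, -, -, -, -, -, -, -,
    -, -, -, -, -, -, -, -, -, -, -, -, -, h1⟩ := lie_root
  exact commute_h_mul_gen h1

theorem commute_Ep_Em : Commute Ep Em := by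
  obtain ⟨-, -, -, -, -, -, -, -, -, -, -, -, -, -, -, -, -, -, -, -, -, -, -, -, -, -, -, -, -, -, -,
    -, -, -, -, -, -, -, -, -, -, -, -, h1, -⟩ := lie_root
  exact commute_h_mul_gen h1

theorem commute_E1_Em : Commute E1 Em := by
  obtain ⟨-, -, -, -, -, -, -, -, -, -, -, -, -, -, -, -, -, -, -, -, -, -, -, -, -, -, -, -, -, -, -,
    -, -, -, -, h1, -⟩ := lie_root
  exact commute_h_mul_gen h1

theorem commute_logOneAdd {x a : PowerSeries (U so5)} (hx : constantCoeff x = 0)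
    (ha : Commute a x) : Commute a (logOneAdd x) := by
  rw [logOneAdd_eq_subs]
  exact commute_subs hx ha _

theorem commute_sigma {a : PowerSeries (U so5)} (ha : Commute a Ep) : Commute a sigma :=
  commute_logOneAdd constantCoeff_Ep ha

theorem commute_exp_neg_sigma {a : PowerSeries (U so5)} (ha : Commute a Ep) :
    Commute a (exp (-sigma)) :=
  commute_exp (by rw [map_neg, constantCoeff_sigma, neg_zero]) (commute_sigma ha).neg_right

theorem commute_EBO {a : PowerSeries (U so5)} (ha : Commute a Ep) (h1 : Commute a E1)
    (hm : Commute a Em) : Commute a EBO :=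
  hm.add_right (((h1.pow_right 2).mul_right (commute_exp_neg_sigma ha)).smul_right _)

theorem commute_sigmaBO {a : PowerSeries (U so5)} (ha : Commute a EBO) : Commute a sigmaBO :=
  commute_logOneAdd constantCoeff_EBO ha

theorem commute_Ep_EBO : Commute Ep EBO :=
  commute_EBO (Commute.refl _) commute_Ep_E1 commute_Ep_Em

/-- `Ep`, `E1` and `Em` commute pairwise and σ, τ are built from them alone. Hence `q` is additive
in its exponents. -/
theorem commute_sigma_sigmaBO : Commute sigma sigmaBO :=
  commute_sigmaBO (commute_sigma commute_Ep_EBO.symm).symm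

theorem constantCoeff_q_arg (a b : ℂ) : constantCoeff (a • sigma + b • sigmaBO) = 0 := by
  simp only [← coeff_zero_eq_constantCoeff_apply, map_add, coeff_smul]
  simp [constantCoeff_sigma, constantCoeff_sigmaBO]

theorem q_mul_q (a b c d : ℂ) : q a b * q c d = q (a + c) (b + d) := by
  rw [q, q, ← exp_add (constantCoeff_q_arg _ _) (constantCoeff_q_arg _ _), q]
  · congr 1
    module
  · have h1 : Commute sigma (c • sigma + d • sigmaBO) :=
      ((Commute.refl _).smul_right c).add_right (commute_sigma_sigmaBO.smul_right d)
    have h2 : Commute sigmaBO (c • sigma + d • sigmaBO) :=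
      (commute_sigma_sigmaBO.symm.smul_right c).add_right ((Commute.refl _).smul_right d)
    exact (h1.smul_left a).add_left (h2.smul_left b)

theorem q_zero : q 0 0 = 1 := by
  rw [q, zero_smul, zero_smul, add_zero, exp_zero]

theorem q_left (a : ℂ) : q a 0 = exp (a • sigma) := by
  rw [q, zero_smul, add_zero]

theorem q_right (b : ℂ) : q 0 b = exp (b • sigmaBO) := by
  rw [q, zero_smul, zero_add]

/-- This is why hE_{1+2} needs no letter of its own in the rewriting: it is a polynomial in e^{σ/2}.
-/
theorem q_one_left : q 1 0 = 1 + Ep := by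
  rw [q_left, one_smul, sigma, exp_logOneAdd constantCoeff_Ep]

theorem q_one_right : q 0 1 = 1 + EBO := by
  rw [q_right, one_smul, sigmaBO, exp_logOneAdd constantCoeff_EBO]

/-- Commutation of a power of `exp σ`. -/
theorem q_left_mul {y z w : PowerSeries (U so5)} (hz : Ep * y = y * Ep + z)
    (hw : Ep * z = z * Ep + w) (hxw : Ep * w = w * Ep) (a : ℂ) :
    q a 0 * y = y * q a 0 + a • (z * q (a - 1) 0) + (a * (a - 1) / 2) • (w * q (a - 2) 0) := by
  simp only [q_left]
  exact exp_smul_logOneAdd_mul_eq constantCoeff_Ep hz hw hxw a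

/-- Commutation of a power of `exp τ`. -/
theorem q_right_mul {y z w : PowerSeries (U so5)} (hz : EBO * y = y * EBO + z)
    (hw : EBO * z = z * EBO + w) (hxw : EBO * w = w * EBO) (a : ℂ) :
    q 0 a * y = y * q 0 a + a • (z * q 0 (a - 1)) + (a * (a - 1) / 2) • (w * q 0 (a - 2)) := by
  simp only [q_right]
  exact exp_smul_logOneAdd_mul_eq constantCoeff_EBO hz hw hxw a

end So5

/-! ### Rewriting tables for the generators and the exponentials. -/

namespace So5

open FormalTwist PowerSeries Rewriting

/-! The letters are numbered `h = 0`, `E_{-1-2} = 1`, `E_{-1} = 2`, `E_{2-1} = 3`,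
`E_{-2} = 4`, `E_2 = 5`, `H_{1+2} = 6`, `H_{1-2} = 7`, `h E_{1-2} = 8`, `h E_1 = 9`,
`exp (σ / 2) = 10`, `exp (-σ / 2) = 11`, `exp (τ / 2) = 12`, `exp (-τ / 2) = 13`, where
`σ = sigma` and `τ = sigmaBO`. The rule for the word `a b` is listed under the key `16 a + b`. -/

/-- The values of the letters. -/
noncomputable def letter : ℕ → PowerSeries (U so5)
  | 0 => h | 1 => Fp | 2 => F1 | 3 => Fm | 4 => F2 | 5 => E2 | 6 => Hp | 7 => Hm | 8 => Em
  | 9 => E1 | 10 => q (1 / 2) 0 | 11 => q (-1 / 2) 0 | 12 => q 0 (1 / 2) | 13 => q 0 (-1 / 2)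
  | _ => 0

/-- Commutation of `E_{-1-2}, …, H_{1-2}, h E_1`. -/
def lieRules : List (ℕ × Poly) :=
  [(33, [⟨1, 0, [1, 2]⟩]), (49, [⟨1, 0, [1, 3]⟩]), (50, [⟨1, 0, [2, 3]⟩]), (65, [⟨1, 0, [1, 4]⟩]),
   (66, [⟨1, 0, [1]⟩, ⟨1, 0, [2, 4]⟩]), (67, [⟨-1, 0, [2]⟩, ⟨1, 0, [3, 4]⟩]),
   (81, [⟨1, 0, [1, 5]⟩, ⟨1, 0, [2]⟩]), (82, [⟨1, 0, [2, 5]⟩, ⟨-1, 0, [3]⟩]),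
   (83, [⟨1, 0, [3, 5]⟩]), (84, [⟨1, 0, [4, 5]⟩, ⟨1, 0, [6]⟩, ⟨-1, 0, [7]⟩]),
   (97, [⟨-1, 0, [1]⟩, ⟨1, 0, [1, 6]⟩]), (98, [⟨-1, 1, [2]⟩, ⟨1, 0, [2, 6]⟩]),
   (99, [⟨1, 0, [3, 6]⟩]), (100, [⟨-1, 1, [4]⟩, ⟨1, 0, [4, 6]⟩]),
   (101, [⟨1, 1, [5]⟩, ⟨1, 0, [5, 6]⟩]), (113, [⟨1, 0, [1, 7]⟩]),
   (114, [⟨-1, 1, [2]⟩, ⟨1, 0, [2, 7]⟩]), (115, [⟨-1, 0, [3]⟩, ⟨1, 0, [3, 7]⟩]),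
   (116, [⟨1, 1, [4]⟩, ⟨1, 0, [4, 7]⟩]), (117, [⟨-1, 1, [5]⟩, ⟨1, 0, [5, 7]⟩]),
   (118, [⟨1, 0, [6, 7]⟩]), (145, [⟨-1, 0, [0, 4]⟩, ⟨1, 0, [1, 9]⟩]),
   (146, [⟨1, 0, [0, 6]⟩, ⟨1, 0, [0, 7]⟩, ⟨1, 0, [2, 9]⟩]),
   (147, [⟨1, 0, [0, 5]⟩, ⟨1, 0, [3, 9]⟩]),
   (149, [⟨-1, 0, []⟩, ⟨1, 0, [5, 9]⟩, ⟨1, 0, [10, 10]⟩]), (150, [⟨1, 0, [6, 9]⟩, ⟨-1, 1, [9]⟩]),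
   (151, [⟨1, 0, [7, 9]⟩, ⟨-1, 1, [9]⟩])]

/-- Commutation of `h E_{1-2}` with `E_{-1-2}, …, h E_1`. -/
def emRules : List (ℕ × Poly) :=
  [(129, [⟨1, 0, [1, 8]⟩]), (130, [⟨1, 0, [0, 4]⟩, ⟨1, 0, [2, 8]⟩]),
   (131, [⟨2, 0, [0, 7]⟩, ⟨1, 0, [3, 8]⟩]), (132, [⟨1, 0, [4, 8]⟩]),
   (133, [⟨1, 0, [5, 8]⟩, ⟨-1, 0, [9]⟩]), (134, [⟨1, 0, [6, 8]⟩]),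
   (135, [⟨1, 0, [7, 8]⟩, ⟨-1, 0, [8]⟩]), (152, [⟨1, 0, [8, 9]⟩]),
   (148, [⟨1, 0, [4, 9]⟩, ⟨-1, 0, [8]⟩])]

/-- Relations among `h E_{1-2}` and the exponentials. -/
def emTauRules : List (ℕ × Poly) :=
  [(168, [⟨1, 0, [8, 10]⟩]), (184, [⟨1, 0, [8, 11]⟩]), (200, [⟨1, 0, [8, 12]⟩]),
   (216, [⟨-1, 1, [9, 9, 11, 11, 13]⟩, ⟨1, 0, [12]⟩, ⟨-1, 0, [13]⟩]),
   (204, [⟨1, 0, []⟩, ⟨1, 0, [8]⟩, ⟨1, 1, [9, 9, 11, 11]⟩])]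

/-- Commutation with `exp (± σ / 2)`. -/
def sigmaRules : List (ℕ × Poly) :=
  [(161, [⟨1, 0, [0, 6, 11]⟩, ⟨1, 2, [0, 11]⟩, ⟨-1, 2, [0, 11, 11, 11]⟩, ⟨1, 0, [1, 10]⟩]),
   (162, [⟨-1, 1, [0, 5, 11]⟩, ⟨1, 0, [2, 10]⟩]), (163, [⟨1, 0, [3, 10]⟩]),
   (164, [⟨1, 0, [4, 10]⟩, ⟨1, 1, [9, 11]⟩]), (165, [⟨1, 0, [5, 10]⟩]),
   (166, [⟨1, 0, [6, 10]⟩, ⟨-1, 1, [10]⟩, ⟨1, 1, [11]⟩]), (167, [⟨1, 0, [7, 10]⟩]),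
   (169, [⟨1, 0, [9, 10]⟩]), (171, [⟨1, 0, []⟩]),
   (177, [⟨-1, 0, [0, 6, 11, 11, 11]⟩, ⟨-3, 2, [0, 11, 11, 11]⟩, ⟨3, 2, [0, 11, 11, 11, 11, 11]⟩,
     ⟨1, 0, [1, 11]⟩]), (178, [⟨1, 1, [0, 5, 11, 11, 11]⟩, ⟨1, 0, [2, 11]⟩]),
   (179, [⟨1, 0, [3, 11]⟩]), (180, [⟨1, 0, [4, 11]⟩, ⟨-1, 1, [9, 11, 11, 11]⟩]),
   (181, [⟨1, 0, [5, 11]⟩]), (182, [⟨1, 0, [6, 11]⟩, ⟨1, 1, [11]⟩, ⟨-1, 1, [11, 11, 11]⟩]),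
   (183, [⟨1, 0, [7, 11]⟩]), (185, [⟨1, 0, [9, 11]⟩]), (186, [⟨1, 0, []⟩])]

/-- Relations among `E_1`, `exp (± σ / 2)` and `exp (± τ / 2)`. -/
def tauRules : List (ℕ × Poly) :=
  [(201, [⟨1, 0, [9, 12]⟩]), (202, [⟨1, 0, [10, 12]⟩]), (203, [⟨1, 0, [11, 12]⟩]),
   (205, [⟨1, 0, []⟩]), (217, [⟨1, 0, [9, 13]⟩]), (218, [⟨1, 0, [10, 13]⟩]),
   (219, [⟨1, 0, [11, 13]⟩]), (220, [⟨1, 0, []⟩])]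

/-- Commutation with `exp (± τ / 2)`, without `h E_{1-2}`. -/
def tauRules2 : List (ℕ × Poly) :=
  -- Key 148 is [hE_1, E_{-2}] = -hE_{1-2} with hE_{1-2} = e^τ - 1 - ½(hE_1)²e^{-σ}. The other rows
  -- expand Taylor's formula for (1 + E_{BO})^{±1/2} with the same elimination.
  [(148, [⟨1, 0, []⟩, ⟨1, 0, [4, 9]⟩, ⟨1, 1, [9, 9, 11, 11]⟩, ⟨-1, 0, [12, 12]⟩]),
   (193, [⟨-1, 1, [0, 4, 9, 11, 11, 13]⟩, ⟨-1, 1, [0, 6, 9, 9, 11, 11, 11, 11, 13]⟩,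
     ⟨-1, 4, [0, 9, 9, 9, 9, 11, 11, 11, 11, 11, 11, 11, 11, 13, 13, 13]⟩,
     ⟨1, 1, [0, 9, 9, 11, 11, 11, 11, 11, 11, 13]⟩, ⟨-1, 2, [0, 9, 9, 11, 11, 11, 11, 13]⟩,
     ⟨1, 3, [0, 9, 9, 11, 11, 11, 11, 13, 13, 13]⟩, ⟨1, 2, [0, 11, 11, 12]⟩,
     ⟨-1, 2, [0, 11, 11, 13]⟩, ⟨1, 0, [1, 12]⟩]),
   (194, [⟨1, 1, [0, 4, 13]⟩, ⟨1, 2, [0, 5, 9, 9, 11, 11, 11, 11, 13]⟩,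
     ⟨1, 1, [0, 6, 9, 11, 11, 13]⟩, ⟨1, 1, [0, 7, 9, 11, 11, 13]⟩,
     ⟨1, 3, [0, 9, 9, 9, 11, 11, 11, 11, 11, 11, 13, 13, 13]⟩,
     ⟨-1, 1, [0, 9, 11, 11, 11, 11, 13]⟩, ⟨1, 1, [0, 9, 11, 11, 13]⟩,
     ⟨-1, 2, [0, 9, 11, 11, 13, 13, 13]⟩, ⟨1, 0, [2, 12]⟩]),
   (195, [⟨1, 1, [0, 5, 9, 11, 11, 13]⟩, ⟨1, 0, [0, 7, 13]⟩,
     ⟨1, 3, [0, 9, 9, 11, 11, 11, 11, 13, 13, 13]⟩, ⟨-1, 2, [0, 11, 11, 13]⟩, ⟨1, 1, [0, 13]⟩,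
     ⟨-1, 2, [0, 13, 13, 13]⟩, ⟨1, 0, [3, 12]⟩]),
   (196, [⟨1, 0, [4, 12]⟩, ⟨-1, 1, [9, 11, 11, 12]⟩, ⟨1, 1, [9, 11, 11, 13]⟩]),
   (197, [⟨1, 0, [5, 12]⟩, ⟨-1, 1, [9, 11, 11, 13]⟩]),
   (198, [⟨1, 0, [6, 12]⟩, ⟨-1, 2, [9, 9, 11, 11, 11, 11, 13]⟩]),
   (199, [⟨1, 0, [7, 12]⟩, ⟨-1, 1, [12]⟩, ⟨1, 1, [13]⟩]),
   (209, [⟨1, 1, [0, 4, 9, 11, 11, 13, 13, 13]⟩,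
     ⟨1, 1, [0, 6, 9, 9, 11, 11, 11, 11, 13, 13, 13]⟩,
     ⟨3, 4, [0, 9, 9, 9, 9, 11, 11, 11, 11, 11, 11, 11, 11, 13, 13, 13, 13, 13]⟩,
     ⟨-1, 1, [0, 9, 9, 11, 11, 11, 11, 11, 11, 13, 13, 13]⟩,
     ⟨1, 1, [0, 9, 9, 11, 11, 11, 11, 13, 13, 13]⟩,
     ⟨-3, 3, [0, 9, 9, 11, 11, 11, 11, 13, 13, 13, 13, 13]⟩, ⟨-1, 2, [0, 11, 11, 13]⟩,
     ⟨1, 2, [0, 11, 11, 13, 13, 13]⟩, ⟨1, 0, [1, 13]⟩]),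
   (210, [⟨-1, 1, [0, 4, 13, 13, 13]⟩, ⟨-1, 2, [0, 5, 9, 9, 11, 11, 11, 11, 13, 13, 13]⟩,
     ⟨-1, 1, [0, 6, 9, 11, 11, 13, 13, 13]⟩, ⟨-1, 1, [0, 7, 9, 11, 11, 13, 13, 13]⟩,
     ⟨-3, 3, [0, 9, 9, 9, 11, 11, 11, 11, 11, 11, 13, 13, 13, 13, 13]⟩,
     ⟨1, 1, [0, 9, 11, 11, 11, 11, 13, 13, 13]⟩, ⟨-1, 0, [0, 9, 11, 11, 13, 13, 13]⟩,
     ⟨3, 2, [0, 9, 11, 11, 13, 13, 13, 13, 13]⟩, ⟨1, 0, [2, 13]⟩]),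
   (211, [⟨-1, 1, [0, 5, 9, 11, 11, 13, 13, 13]⟩, ⟨-1, 0, [0, 7, 13, 13, 13]⟩,
     ⟨-3, 3, [0, 9, 9, 11, 11, 11, 11, 13, 13, 13, 13, 13]⟩, ⟨1, 2, [0, 11, 11, 13, 13, 13]⟩,
     ⟨-1, 0, [0, 13, 13, 13]⟩, ⟨3, 2, [0, 13, 13, 13, 13, 13]⟩, ⟨1, 0, [3, 13]⟩]),
   (212, [⟨1, 0, [4, 13]⟩, ⟨1, 1, [9, 11, 11, 13]⟩, ⟨-1, 1, [9, 11, 11, 13, 13, 13]⟩]),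
   (213, [⟨1, 0, [5, 13]⟩, ⟨1, 1, [9, 11, 11, 13, 13, 13]⟩]),
   (214, [⟨1, 0, [6, 13]⟩, ⟨1, 2, [9, 9, 11, 11, 11, 11, 13, 13, 13]⟩]),
   (215, [⟨1, 0, [7, 13]⟩, ⟨1, 1, [13]⟩, ⟨-1, 1, [13, 13, 13]⟩])]

/-- Looks up a key. -/
def lookup (k : ℕ) : List (ℕ × Poly) → Option Poly
  | [] => none
  | r :: l => bif Nat.beq r.1 k then some r.2 else lookup k l

/-- The rules given by a table, together with the centrality of `h`. -/
def rulesOf (l : List (ℕ × Poly)) : Rules := fun a b =>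
  bif Nat.beq b 0 then bif Nat.beq a 0 then none else some [⟨1, 0, [0, a]⟩]
  -- The bound on `b` makes the key 16a + b decodable by division with remainder.
  else bif Nat.blt b 16 then lookup (16 * a + b) l else none

/-- The rules of a table hold. -/
def TableSound (l : List (ℕ × Poly)) : Prop :=
  ∀ r ∈ l, letter (r.1 / 16) * letter (r.1 % 16) = Poly.eval letter r.2

theorem TableSound.append {l m : List (ℕ × Poly)} (hl : TableSound l) (hm : TableSound m) :
    TableSound (l ++ m) := fun r hr => (List.mem_append.1 hr).elim (hl r) (hm r)

theorem exists_mem_of_lookup {k : ℕ} {p : Poly} : ∀ {l : List (ℕ × Poly)},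
    lookup k l = some p → (k, p) ∈ l
  | [], hk => by simp [lookup] at hk
  | r :: l, hk => by
    rw [lookup] at hk
    cases hr : Nat.beq r.1 k with
    | true =>
      rw [hr, cond_true, Option.some.injEq] at hk
      rw [← Nat.eq_of_beq_eq_true hr, ← hk]
      exact List.mem_cons_self
    | false =>
      rw [hr, cond_false] at hk
      exact List.mem_cons_of_mem _ (exists_mem_of_lookup hk)

theorem TableSound.sound {l : List (ℕ × Poly)} (hl : TableSound l) :
    (rulesOf l).Sound letter := by
  intro a b p hp
  rw [rulesOf] at hp
  cases hb : Nat.beq b 0 with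
  | true =>
    obtain rfl := Nat.eq_of_beq_eq_true hb
    cases ha : Nat.beq a 0 with
    | true => simp [ha] at hp
    | false =>
      simp only [Nat.beq_refl, cond_true, ha, cond_false, Option.some.injEq] at hp
      rw [← hp]
      simp [Term.eval, letter, mul_h]
  | false =>
    cases hb' : Nat.blt b 16 with
    | false => simp [hb, hb'] at hp
    | true =>
      simp only [hb, hb', cond_false, cond_true] at hp
      have hlt : b < 16 := Nat.le_of_ble_eq_true hb'
      have := hl _ (exists_mem_of_lookup hp)
      rwa [show (16 * a + b) / 16 = a by omega, show (16 * a + b) % 16 = b by omega] at this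

theorem q_half_mul_self : q (1 / 2) 0 * q (1 / 2) 0 = 1 + Ep := by
  rw [q_mul_q, ← q_one_left]
  norm_num

theorem tableSound_lieRules : TableSound (lieRules ++ emRules) := by
  simp only [TableSound, lieRules, emRules, List.cons_append, List.nil_append,
    List.forall_mem_cons, List.not_mem_nil, false_implies, implies_true, and_true]
  and_intros
  all_goals
    simp only [Nat.reduceDiv, Nat.reduceMod, letter, Poly.eval_cons, Poly.eval_nil, Term.eval,
      List.map_cons, List.map_nil, List.prod_cons, List.prod_nil, mul_one, q_half_mul_self]
    -- Only the product on the left is out of order; the right-hand side must not be reordered by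
    -- the commutator formula.
    conv_lhs =>
      simp only [E1, Em, Fp, F1, Fm, F2, E2, Hp, Hm, mul_assoc, mul_h_mul]
      rw [gen_mul_gen]
    simp only [lie_root, gen_add, gen_sub, gen_neg, gen_smul, gen_zero, E1, Em, Fp, F1, Fm, F2, E2,
      Hp, Hm, Ep, mul_assoc, mul_h_mul, mul_add, mul_neg, mul_smul_comm]
    norm_num
    try module

end So5

/-! ### Validity of the rules for the exponentials. -/

namespace So5

open FormalTwist PowerSeries Rewriting

theorem Ep_mul :
    Ep * Fp = Fp * Ep + (2 : ℂ) • (h * Hp) ∧ Ep * F1 = F1 * Ep + -(h * E2) ∧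
    Ep * Fm = Fm * Ep ∧ Ep * F2 = F2 * Ep + E1 ∧ Ep * E2 = E2 * Ep ∧ Ep * Hp = Hp * Ep + -Ep ∧
    Ep * Hm = Hm * Ep := by
  and_intros
  all_goals
    conv_lhs =>
      simp only [Ep, Fp, F1, Fm, F2, E2, Hp, Hm, mul_assoc]
      rw [gen_mul_gen]
    simp only [lie_root, gen_neg, gen_smul, gen_zero, E1, Ep, Fp, F1, Fm, F2, E2, Hp, Hm,
      mul_h_mul, mul_add, mul_neg, mul_smul_comm, add_zero]

theorem mul_q_left_of_commute {y : PowerSeries (U so5)} (hy : Ep * y = y * Ep) (a : ℂ) :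
    q a 0 * y = y * q a 0 := by
  rw [q_left]
  exact (commute_exp (by simpa using constantCoeff_q_arg a 0) ((commute_sigma (show Commute y Ep from hy.symm)).smul_right a)).symm

theorem mul_q_left_of_commutator {y z : PowerSeries (U so5)} (hy : Ep * y = y * Ep + z)
    (hz : Ep * z = z * Ep) (a : ℂ) : q a 0 * y = y * q a 0 + a • (z * q (a - 1) 0) := by
  have := q_left_mul (w := 0) hy (by rw [hz, add_zero]) (by simp) a
  simpa using this

theorem Ep_mul_q (a : ℂ) : Ep * q a 0 = q (a + 1) 0 - q a 0 := by
  have : Ep = q 1 0 - 1 := by rw [q_one_left, add_sub_cancel_left]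
  rw [this, sub_mul, q_mul_q, one_mul, add_zero, add_comm]

/-- E_{-1-2} is the one generator in the table whose second commutator with hE_{1+2} does not
vanish: the commutators are 2hH_{1+2} and then -2h·hE_{1+2}, so the second-order Taylor term is
needed. -/
theorem q_left_mul_Fp (a : ℂ) : q a 0 * Fp = Fp * q a 0 + (2 * a) • (h * (Hp * q (a - 1) 0)) +
    (-a * (a - 1)) • (h * (q (a - 1) 0 - q (a - 2) 0)) := by
  obtain ⟨h1, -, -, -, -, h2, -⟩ := Ep_mul
  have h3 : Ep * ((2 : ℂ) • (h * Hp)) = ((2 : ℂ) • (h * Hp)) * Ep + (-2 : ℂ) • (h * Ep) := by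
    rw [mul_smul_comm, mul_h_mul, h2, mul_add, smul_mul_assoc, mul_assoc, mul_neg]
    module
  have h4 : Ep * ((-2 : ℂ) • (h * Ep)) = ((-2 : ℂ) • (h * Ep)) * Ep := by
    rw [mul_smul_comm, smul_mul_assoc, mul_h_mul, mul_assoc]
  rw [q_left_mul h1 h3 h4, smul_mul_assoc, smul_mul_assoc, mul_assoc, mul_assoc, Ep_mul_q,
    smul_smul, smul_smul, show a - 2 + 1 = a - 1 by ring]
  module

theorem tableSound_sigmaRules : TableSound sigmaRules := by
  obtain ⟨-, h2, h3, h4, h5, h6, h7⟩ := Ep_mul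
  have hE1 : Ep * E1 = E1 * Ep := commute_Ep_E1
  have e2 := mul_q_left_of_commutator h2 (by rw [mul_neg, mul_h_mul, h5, neg_mul, mul_assoc])
  have e4 := mul_q_left_of_commutator h4 hE1
  have e6 := mul_q_left_of_commutator h6 (by rw [mul_neg, neg_mul])
  simp only [TableSound, sigmaRules, List.forall_mem_cons, List.not_mem_nil, false_implies,
    implies_true, and_true]
  and_intros
  all_goals
    simp only [Nat.reduceDiv, Nat.reduceMod, letter, Poly.eval_cons, Poly.eval_nil, Term.eval,
      List.map_cons, List.map_nil, List.prod_cons, List.prod_nil, mul_one, q_mul_q, q_left_mul_Fp,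
      e2, e4, e6, mul_q_left_of_commute h3, mul_q_left_of_commute h5, mul_q_left_of_commute h7,
      mul_q_left_of_commute hE1, neg_mul, Ep_mul_q, mul_assoc, mul_sub]
    norm_num [q_zero]
    try module

theorem mul_q_right_of_commute {y : PowerSeries (U so5)} (hy : EBO * y = y * EBO) (a : ℂ) :
    q 0 a * y = y * q 0 a := by
  rw [q_right]
  exact (commute_exp (by simpa using constantCoeff_q_arg 0 a) ((commute_sigmaBO (show Commute y EBO from hy.symm)).smul_right a)).symm

theorem commute_E1_EBO : Commute E1 EBO :=
  commute_EBO commute_Ep_E1.symm (Commute.refl _) commute_E1_Em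

theorem commute_Em_EBO : Commute Em EBO :=
  commute_EBO commute_Ep_Em.symm commute_E1_Em.symm (Commute.refl _)

theorem tableSound_tauRules : TableSound tauRules := by
  have hE1 := fun a => mul_q_right_of_commute commute_E1_EBO.symm.eq a
  simp only [TableSound, tauRules, List.forall_mem_cons, List.not_mem_nil, false_implies,
    implies_true, and_true]
  and_intros
  all_goals
    simp only [Nat.reduceDiv, Nat.reduceMod, letter, Poly.eval_cons, Poly.eval_nil, Term.eval,
      List.map_cons, List.map_nil, List.prod_cons, List.prod_nil, mul_one, q_mul_q, hE1]
    norm_num [q_zero]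

theorem EBO_eq : EBO = Em + (1 / 2 : ℂ) • (E1 * (E1 * q (-1) 0)) := by
  rw [EBO, pow_two, q_left, neg_one_smul, mul_assoc]

theorem EBO_mul_q (a : ℂ) : EBO * q 0 a = q 0 (a + 1) - q 0 a := by
  have : EBO = q 0 1 - 1 := by rw [q_one_right, add_sub_cancel_left]
  rw [this, sub_mul, q_mul_q, one_mul, add_zero, add_comm]

/-- The two nontrivial rows both express e^τ = 1 + hE_{1-2} + ½(hE_1)²e^{-σ}, once directly and once
multiplied by e^{-τ/2}; the others are commutations. -/
theorem tableSound_emTauRules : TableSound emTauRules := by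
  have h1 := fun a => mul_q_left_of_commute commute_Ep_Em.eq a
  have h2 := fun a => mul_q_right_of_commute commute_Em_EBO.symm.eq a
  have h3 : Em * q 0 (-1 / 2) = q 0 (1 / 2) - q 0 (-1 / 2) -
      (1 / 2 : ℂ) • (E1 * (E1 * q (-1) (-1 / 2))) := by
    have : Em = EBO - (1 / 2 : ℂ) • (E1 * (E1 * q (-1) 0)) := by rw [EBO_eq, add_sub_cancel_right]
    rw [this, sub_mul, EBO_mul_q, smul_mul_assoc, mul_assoc, mul_assoc, q_mul_q]
    norm_num
  have h4 : q 0 1 = 1 + Em + (1 / 2 : ℂ) • (E1 * (E1 * q (-1) 0)) := by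
    rw [q_one_right, EBO_eq, add_assoc]
  simp only [TableSound, emTauRules, List.forall_mem_cons, List.not_mem_nil, false_implies,
    implies_true, and_true]
  and_intros
  all_goals
    simp only [Nat.reduceDiv, Nat.reduceMod, letter, Poly.eval_cons, Poly.eval_nil, Term.eval,
      List.map_cons, List.map_nil, List.prod_cons, List.prod_nil, mul_one, q_mul_q, h1, h2, h3]
    norm_num [h4]
    try module

/-- The relations without a rule for `exp (τ / 2)`. -/
def rules1 : Rules := rulesOf (lieRules ++ (emRules ++ (emTauRules ++ (sigmaRules ++ tauRules))))

theorem rules1_sound : rules1.Sound letter := by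
  refine TableSound.sound ?_
  rw [← List.append_assoc]
  exact tableSound_lieRules.append (tableSound_emTauRules.append
    (tableSound_sigmaRules.append tableSound_tauRules))

/-- `E_{BO}` as a polynomial. -/
def polyEBO : Poly := [⟨1, 0, [8]⟩, ⟨1, 1, [9, 9, 11, 11]⟩]

/-- The letter `a` as a polynomial. -/
def var (a : ℕ) : Poly := [⟨1, 0, [a]⟩]

end So5

/-! ### Elimination of hE_{1-2}, and commutation with e^{±τ/2}. -/

namespace So5

open FormalTwist PowerSeries Rewriting

@[simp] theorem eval_var {R : Type*} [Ring R] [Algebra ℂ R] (ρ : ℕ → R) (a : ℕ) :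
    Poly.eval ρ (var a) = ρ a := by
  simp [var, Term.eval]

/-- The relations without a rule for `h E_{1-2}` and without commutation of `exp (± τ / 2)` with
`E_{-1-2}, …, H_{1-2}`. -/
def rulesElim : Rules := rulesOf (lieRules ++ (sigmaRules ++ tauRules))

theorem rulesElim_sound : rulesElim.Sound letter :=
  TableSound.sound (TableSound.append (fun r hr =>
    tableSound_lieRules r (List.mem_append_left _ hr))
      (tableSound_sigmaRules.append tableSound_tauRules))

/-- `h E_{1-2}` as a polynomial in `h E_1` and the exponentials. -/
def polyEm : Poly := [⟨1, 0, [12, 12]⟩, ⟨-1, 0, []⟩, ⟨-1, 1, [9, 9, 11, 11]⟩]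

theorem eval_polyEm : Poly.eval letter polyEm = Em := by
  have h1 : EBO = Em + (1 / 2 : ℂ) • (E1 * (E1 * q (-1) 0)) := EBO_eq
  have h2 : q 0 1 = 1 + EBO := q_one_right
  simp only [polyEm, letter, Poly.eval_cons, Poly.eval_nil, Term.eval, List.map_cons,
    List.map_nil, List.prod_cons, List.prod_nil, mul_one, q_mul_q]
  norm_num [h2, h1]
  module

/-- Eliminates `h E_{1-2}`. -/
def elim (p : Poly) : Option Poly :=
  Poly.subst rulesElim (fun a => bif Nat.beq a 8 then some polyEm else some (var a)) p

/-- Replacing a letter by an equal polynomial is the case F = 1 of conjugation by substitution. -/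
theorem eval_elim {p r : Poly} (hp : elim p = some r) :
    Poly.eval letter p = Poly.eval letter r := by
  have := Poly.semiconjBy_subst letter rulesElim_sound (F := 1) (fun a p h => ?_) p r hp
  · simpa [SemiconjBy] using this
  cases ha : Nat.beq a 8 with
  | true =>
    obtain rfl := Nat.eq_of_beq_eq_true ha
    simp only [ha, cond_true, Option.some.injEq] at h
    rw [← h, eval_polyEm]
    exact SemiconjBy.one_left _
  | false =>
    simp only [ha, cond_false, Option.some.injEq] at h
    rw [← h, eval_var]
    exact SemiconjBy.one_left _

/-- Whether a polynomial vanishes after the elimination of `h E_{1-2}`. -/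
def elimIsZero (p : Poly) : Bool :=
  match elim p with
  | some r => Poly.isZero r
  | none => false

theorem eval_eq_of_elimIsZero_sub {p r : Poly} (h : elimIsZero (Poly.sub p r) = true) :
    Poly.eval letter p = Poly.eval letter r := by
  rw [← sub_eq_zero, ← Poly.eval_sub]
  rw [elimIsZero] at h
  cases hs : elim (Poly.sub p r) with
  | none => simp [hs] at h
  | some r =>
    rw [eval_elim hs]
    cases r with
    | nil => rfl
    | cons t r => simp [hs, Poly.isZero] at h

/-- Checks a rule with `exp (± τ / 2)` against Taylor's formula, and any other rule against
`rules1`. -/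
def checkRule (r : ℕ × Poly) : Bool :=
  let a := r.1 / 16
  let y := var (r.1 % 16)
  let z := Poly.comm rules1 polyEBO y
  let w := Poly.comm rules1 polyEBO z
  -- For the exponent 1/2 the Taylor coefficients are 1/2 and -1/8, with the powers e^{-τ/2} and
  -- e^{-3τ/2}.
  bif Nat.beq a 12 then Poly.isZero (Poly.comm rules1 polyEBO w) &&
    elimIsZero (Poly.sub (Poly.add (Poly.mul rules1 y (var 12))
      (Poly.add (Poly.smul 1 1 (Poly.mul rules1 z (var 13)))
        (Poly.smul (-1) 3 (Poly.mul rules1 w [⟨1, 0, [13, 13, 13]⟩])))) r.2)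
  -- For the exponent -1/2 they are -1/2 and 3/8, with e^{-3τ/2} and e^{-5τ/2}.
  else bif Nat.beq a 13 then Poly.isZero (Poly.comm rules1 polyEBO w) &&
    elimIsZero (Poly.sub (Poly.add (Poly.mul rules1 y (var 13))
      (Poly.add (Poly.smul (-1) 1 (Poly.mul rules1 z [⟨1, 0, [13, 13, 13]⟩]))
        (Poly.smul 3 3 (Poly.mul rules1 w [⟨1, 0, [13, 13, 13, 13, 13]⟩])))) r.2)
  else elimIsZero (Poly.sub (Poly.mul rules1 (var a) y) r.2)

theorem eval_polyEBO : Poly.eval letter polyEBO = EBO := by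
  rw [EBO_eq]
  simp only [polyEBO, letter, Poly.eval_cons, Poly.eval_nil, Term.eval, List.map_cons,
    List.map_nil, List.prod_cons, List.prod_nil, mul_one, q_mul_q]
  norm_num

theorem eq_eval_comm {T : Rules} (hT : T.Sound letter) (p q : Poly) :
    Poly.eval letter p * Poly.eval letter q =
      Poly.eval letter q * Poly.eval letter p + Poly.eval letter (Poly.comm T p q) := by
  rw [Poly.eval_comm _ hT, add_sub_cancel]

theorem mul_comm_of_isZero_comm {T : Rules} (hT : T.Sound letter) {p q : Poly}
    (h : Poly.isZero (Poly.comm T p q) = true) :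
    Poly.eval letter p * Poly.eval letter q = Poly.eval letter q * Poly.eval letter p := by
  rw [← Poly.eval_mul _ hT, ← Poly.eval_mul _ hT]
  exact Poly.eval_eq_of_isZero_sub _ h

/-- E_{BO} is a polynomial in hE_{1-2}, hE_1 and e^{-σ/2}, so its commutators are computable with
`rules1`. Taylor's formula then certifies how e^{±τ/2} moves past a generator without presupposing
any such rule. -/
theorem eq_of_checkRule {r : ℕ × Poly} (hr : checkRule r = true) :
    letter (r.1 / 16) * letter (r.1 % 16) = Poly.eval letter r.2 := by
  have hz := eq_eval_comm rules1_sound polyEBO (var (r.1 % 16))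
  have hw := eq_eval_comm rules1_sound polyEBO (Poly.comm rules1 polyEBO (var (r.1 % 16)))
  have l12 : letter 12 = q 0 (1 / 2) := rfl
  have l13 : letter 13 = q 0 (-1 / 2) := rfl
  rw [checkRule] at hr
  cases h12 : Nat.beq (r.1 / 16) 12 with
  | true =>
    rw [h12, cond_true, Bool.and_eq_true] at hr
    have hxw := mul_comm_of_isZero_comm rules1_sound hr.1
    have h := eval_eq_of_elimIsZero_sub hr.2
    rw [eval_polyEBO, eval_var] at *
    simp only [Poly.eval_add, Poly.eval_mul _ rules1_sound, Poly.eval_smul, eval_var] at h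
    rw [Nat.eq_of_beq_eq_true h12, ← h]
    have := q_right_mul hz hw hxw (1 / 2)
    simp only [l12, l13, Poly.eval_cons, Poly.eval_nil, Term.eval, List.map_cons, List.map_nil,
      List.prod_cons, List.prod_nil, mul_one, q_mul_q]
    rw [this]
    norm_num [add_assoc]
  | false =>
    cases h13 : Nat.beq (r.1 / 16) 13 with
    | true =>
      rw [h12, h13, cond_false, cond_true, Bool.and_eq_true] at hr
      have hxw := mul_comm_of_isZero_comm rules1_sound hr.1
      have h := eval_eq_of_elimIsZero_sub hr.2
      rw [eval_polyEBO, eval_var] at *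
      simp only [Poly.eval_add, Poly.eval_mul _ rules1_sound, Poly.eval_smul, eval_var] at h
      rw [Nat.eq_of_beq_eq_true h13, ← h]
      have := q_right_mul hz hw hxw (-1 / 2)
      simp only [l13, Poly.eval_cons, Poly.eval_nil, Term.eval, List.map_cons, List.map_nil,
        List.prod_cons, List.prod_nil, mul_one, q_mul_q]
      rw [this]
      norm_num [add_assoc]
    | false =>
      rw [h12, h13, cond_false, cond_false] at hr
      have h := eval_eq_of_elimIsZero_sub hr
      rwa [Poly.eval_mul _ rules1_sound, eval_var, eval_var] at h

theorem tableSound_tauRules2 : TableSound tauRules2 := by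
  have h : tauRules2.all checkRule = true := by decide +kernel
  exact fun r hr => eq_of_checkRule (List.all_eq_true.1 h r hr)

/-- The relations without a rule for `h E_{1-2}`. -/
def rules2 : Rules := rulesOf (lieRules ++ (tauRules2 ++ (sigmaRules ++ tauRules)))

theorem rules2_sound : rules2.Sound letter := by
  refine TableSound.sound (TableSound.append ?_ (tableSound_tauRules2.append
    (tableSound_sigmaRules.append tableSound_tauRules)))
  exact fun r hr => tableSound_lieRules r (List.mem_append_left _ hr)

end So5

/-! ### Rewriting in the tensor square. -/

namespace So5

open FormalTwist PowerSeries Rewriting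

/-- The values of the letters of the tensor square: the letter `a` in the first factor has the
number `2 a`, in the second factor `2 a + 1`. -/
noncomputable def letter2 (n : ℕ) : PowerSeries (U2 so5) :=
  bif Nat.beq (n % 2) 0 then leg1 (letter (n / 2)) else leg2 (letter (n / 2))

theorem letter2_mul (a : ℕ) : letter2 (2 * a) = leg1 (letter a) := by
  rw [letter2, Nat.mul_mod_right, Nat.mul_div_cancel_left a two_pos]
  rfl

theorem letter2_mul_add (a : ℕ) : letter2 (2 * a + 1) = leg2 (letter a) := by
  rw [letter2, show (2 * a + 1) % 2 = 1 by omega, show (2 * a + 1) / 2 = a by omega]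
  rfl

theorem leg1_h : leg1 h = h2 := by
  simp [leg1, h, h2, mapAlgHom_apply]

theorem leg2_h : leg2 h = h2 := by
  simp [leg2, h, h2, mapAlgHom_apply]

theorem letter2_of_even {n : ℕ} (hn : Nat.beq (n % 2) 0 = true) :
    letter2 n = leg1 (letter (n / 2)) := by
  rw [letter2, hn, cond_true]

theorem letter2_of_odd {n : ℕ} (hn : Nat.beq (n % 2) 0 = false) :
    letter2 n = leg2 (letter (n / 2)) := by
  rw [letter2, hn, cond_false]

/-- The polynomial `p ⊗ 1`. -/
def shift1 (p : Poly) : Poly := p.map fun t => ⟨t.num, t.den, t.word.map fun a => 2 * a⟩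

/-- The polynomial `1 ⊗ p`. -/
def shift2 (p : Poly) : Poly := p.map fun t =>
  -- The parameter h is the same in both factors and keeps the single number 0.
  ⟨t.num, t.den, t.word.map fun a => bif Nat.beq a 0 then 0 else 2 * a + 1⟩

theorem eval_shift1 (p : Poly) : Poly.eval letter2 (shift1 p) = leg1 (Poly.eval letter p) := by
  rw [Poly.eval, Poly.eval, map_list_sum, shift1, List.map_map, List.map_map]
  congr 1
  refine List.map_congr_left fun t _ => ?_
  simp only [Function.comp_apply, Term.eval, map_smul, map_list_prod, List.map_map]
  congr 3
  exact funext fun a => letter2_mul a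

theorem eval_shift2 (p : Poly) : Poly.eval letter2 (shift2 p) = leg2 (Poly.eval letter p) := by
  rw [Poly.eval, Poly.eval, map_list_sum, shift2, List.map_map, List.map_map]
  congr 1
  refine List.map_congr_left fun t _ => ?_
  simp only [Function.comp_apply, Term.eval, map_smul, map_list_prod, List.map_map]
  congr 3
  refine funext fun a => ?_
  rw [Function.comp_apply, Function.comp_apply]
  cases ha : Nat.beq a 0 with
  | true =>
    obtain rfl := Nat.eq_of_beq_eq_true ha
    exact leg1_h.trans leg2_h.symm
  | false => exact letter2_mul_add a

/-- The rules for the tensor square. -/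
def rulesTensor (T : Rules) : Rules := fun a b =>
  bif Nat.beq b 0 then bif Nat.beq a 0 then none else some [⟨1, 0, [0, a]⟩]
  else bif Nat.beq (b % 2) 0 then
    bif Nat.beq (a % 2) 0 then (T (a / 2) (b / 2)).map shift1 else some [⟨1, 0, [b, a]⟩]
  else bif Nat.beq (a % 2) 0 then none else (T (a / 2) (b / 2)).map shift2

theorem rulesTensor_sound {T : Rules} (hT : T.Sound letter) : (rulesTensor T).Sound letter2 := by
  intro a b p hp
  rw [rulesTensor] at hp
  cases hb : Nat.beq b 0 with
  | true =>
    obtain rfl := Nat.eq_of_beq_eq_true hb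
    cases ha : Nat.beq a 0 with
    | true => simp [ha] at hp
    | false =>
      simp only [Nat.beq_refl, cond_true, ha, cond_false, Option.some.injEq] at hp
      rw [← hp]
      have : letter2 0 = X := leg1_h
      simp [Term.eval, this, X_mul]
  | false =>
    cases hb2 : Nat.beq (b % 2) 0 with
    | true =>
      cases ha2 : Nat.beq (a % 2) 0 with
      | true =>
        simp only [hb, hb2, ha2, cond_true, cond_false, Option.map_eq_some_iff] at hp
        obtain ⟨r, hr, rfl⟩ := hp
        rw [letter2_of_even ha2, letter2_of_even hb2, eval_shift1, ← map_mul, hT _ _ _ hr]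
      | false =>
        simp only [hb, hb2, ha2, cond_true, cond_false, Option.some.injEq] at hp
        rw [← hp]
        simp only [Poly.eval_cons, Poly.eval_nil, Term.eval, List.map_cons, List.map_nil,
          List.prod_cons, List.prod_nil, letter2_of_odd ha2, letter2_of_even hb2]
        simp [(commute_leg1_leg2 (letter (b / 2)) (letter (a / 2))).eq]
    | false =>
      cases ha2 : Nat.beq (a % 2) 0 with
      | true => simp [hb, hb2, ha2] at hp
      | false =>
        simp only [hb, hb2, ha2, cond_false, Option.map_eq_some_iff] at hp
        obtain ⟨r, hr, rfl⟩ := hp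
        rw [letter2_of_odd ha2, letter2_of_odd hb2, eval_shift2, ← map_mul, hT _ _ _ hr]

/-- The polynomial `p ⊗ q`. -/
def polyTens (T : Rules) (p q : Poly) : Poly := Poly.mul (rulesTensor T) (shift1 p) (shift2 q)

theorem eval_polyTens {T : Rules} (hT : T.Sound letter) (p q : Poly) :
    Poly.eval letter2 (polyTens T p q) = tens (Poly.eval letter p) (Poly.eval letter q) := by
  rw [polyTens, Poly.eval_mul _ (rulesTensor_sound hT), eval_shift1, eval_shift2, tens_eq]

/-! ### Conjugation by exp (a ⊗ b) on each tensor factor. -/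

section Conjugation

variable {L : Type*} [LieRing L] [LieAlgebra ℂ L]

theorem constantCoeff_tens (a : PowerSeries (U L)) {b : PowerSeries (U L)}
    (hb : constantCoeff b = 0) : constantCoeff (tens a b) = 0 := by
  rw [tens_eq, map_mul, leg2, constantCoeff_mapAlgHom _ hb, mul_zero]

/-- The iterated commutators of a ⊗ b with 1 ⊗ y are a^k ⊗ (ad b)^k y, and they stop after k = 2. -/
theorem semiconjBy_exp_tens_leg2 {b y z w : PowerSeries (U L)} (a : PowerSeries (U L))
    (hb : constantCoeff b = 0) (hz : b * y = y * b + z) (hw : b * z = z * b + w)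
    (h : b * w = w * b) :
    SemiconjBy (exp (tens a b)) (leg2 y)
      (leg2 y + leg1 a * leg2 z + (1 / 2 : ℂ) • (leg1 (a * a) * leg2 w)) := by
  have c := fun x => (commute_leg1_leg2 a x).symm.eq
  refine exp_mul_eq (constantCoeff_tens a hb) ?_ ?_ ?_
  · rw [tens_eq, mul_assoc, ← map_mul, hz, map_add, mul_add, map_mul, ← mul_assoc, ← mul_assoc, c]
  · rw [tens_eq, ← mul_assoc, mul_assoc _ (leg2 b), c, mul_assoc, mul_assoc (leg1 a) (leg2 b),
      ← map_mul leg2, hw, map_add, map_mul leg2, mul_add, mul_add, ← mul_assoc (leg1 a) (leg1 a) (leg2 w),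
      ← map_mul leg1]
    congr 1
    rw [mul_assoc, ← mul_assoc (leg2 z), c]
    simp only [mul_assoc]
  · rw [tens_eq, map_mul leg1]
    simp only [mul_assoc]
    rw [← mul_assoc (leg2 b), c, ← mul_assoc (leg2 w), c]
    simp only [mul_assoc]
    rw [← mul_assoc (leg2 b) (leg1 a), c, mul_assoc, ← map_mul, h, map_mul]

theorem semiconjBy_exp_tens_leg1 {a b y z w : PowerSeries (U L)}
    (hb : constantCoeff b = 0) (hz : a * y = y * a + z) (hw : a * z = z * a + w)
    (h : a * w = w * a) :
    SemiconjBy (exp (tens a b)) (leg1 y)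
      (leg1 y + leg1 z * leg2 b + (1 / 2 : ℂ) • (leg1 w * leg2 (b * b))) := by
  have c := fun x => (commute_leg1_leg2 x b).symm.eq
  refine exp_mul_eq (constantCoeff_tens a hb) ?_ ?_ ?_
  · rw [tens_eq, mul_assoc, c, ← mul_assoc, ← mul_assoc, ← map_mul, hz, map_add, add_mul, map_mul]
  · rw [tens_eq, mul_assoc, ← mul_assoc (leg2 b), c, map_mul leg2]
    simp only [← mul_assoc]
    rw [← map_mul, hw, map_add, map_mul, add_mul, add_mul, mul_assoc (leg1 z) (leg2 b), c,
      ← mul_assoc]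
  · rw [tens_eq, map_mul leg2]
    simp only [← mul_assoc]
    rw [mul_assoc (leg1 a), c, ← mul_assoc, ← map_mul, h, map_mul]
    rw [mul_assoc (leg1 w * leg2 b), c]
    simp only [← mul_assoc]
    rw [mul_assoc (leg1 w) (leg2 b), c]
    simp only [← mul_assoc]

/-- For a weight vector the adjoint series does not terminate, so the relation (a⊗b)(y⊗1) =
(y⊗1)(a⊗b + k·1⊗b) is exponentiated instead; the two summands on the right commute. -/
theorem semiconjBy_exp_tens_leg1_of_weight {a b y : PowerSeries (U L)} {k : ℂ}
    (hb : constantCoeff b = 0) (hy : a * y = y * a + k • y) :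
    SemiconjBy (exp (tens a b)) (leg1 y) (leg1 y * leg2 (exp (k • b))) := by
  have c := fun x => (commute_leg1_leg2 x b).symm.eq
  have hb2 : constantCoeff (k • leg2 b) = 0 := by
    rw [← map_smul, leg2]
    refine constantCoeff_mapAlgHom _ ?_
    rw [← coeff_zero_eq_constantCoeff_apply, coeff_smul, coeff_zero_eq_constantCoeff_apply, hb,
      smul_zero]
  have hab := constantCoeff_tens a hb
  have h1 : Commute (k • leg2 b) (tens a b) :=
    ((commute_leg1_leg2 a b).symm.mul_right (Commute.refl _)).smul_left k
  have h2 : SemiconjBy (leg1 y) (k • leg2 b + tens a b) (tens a b) := by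
    rw [SemiconjBy, tens_eq, mul_add, mul_smul_comm, mul_assoc, c, ← mul_assoc, ← mul_assoc,
      ← map_mul, ← map_mul, hy, map_add, map_smul, add_mul, smul_mul_assoc, add_comm]
  have h3 := semiconjBy_exp hab (by rw [map_add, hb2, hab, add_zero]) h2
  rw [SemiconjBy, ← h3.eq, exp_add hb2 hab h1, ← map_smul, leg2, mapAlgHom_exp, mul_assoc]

end Conjugation

end So5

/-! ### Boolean certificates for conjugation formulas. -/

namespace So5

open FormalTwist PowerSeries Rewriting

/-- The word of the `n`-th power of `s`, where `S` is the inverse of `s`. -/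
def powerWord (s S : ℕ) : ℤ → List ℕ
  | .ofNat k => List.replicate k s
  | .negSucc k => List.replicate (k + 1) S

/-- `exp (i / 2 σ + j / 2 τ)` as a polynomial. -/
def polyQ (i j : ℤ) : Poly := [⟨1, 0, powerWord 10 11 i ++ powerWord 12 13 j⟩]

theorem q_pow (a b : ℂ) (n : ℕ) : q a b ^ n = q (n * a) (n * b) := by
  induction n with
  | zero => simp [q_zero]
  | succ n ih =>
    rw [pow_succ, ih, q_mul_q]
    push_cast
    ring_nf

theorem eval_polyQ (i j : ℤ) : Poly.eval letter (polyQ i j) = q (i / 2) (j / 2) := by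
  have h1 : ((powerWord 10 11 i).map letter).prod = q (i / 2) 0 := by
    rcases i with k | k
    · simp only [powerWord, List.map_replicate, List.prod_replicate, letter, q_pow, Int.ofNat_eq_natCast,
        Int.cast_natCast]
      congr 1 <;> ring
    · simp only [powerWord, List.map_replicate, List.prod_replicate, letter, q_pow]
      congr 1
      · push_cast
        ring
      · ring
  have h2 : ((powerWord 12 13 j).map letter).prod = q 0 (j / 2) := by
    rcases j with k | k
    · simp only [powerWord, List.map_replicate, List.prod_replicate, letter, q_pow, Int.ofNat_eq_natCast,
        Int.cast_natCast]
      congr 1 <;> ring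
    · simp only [powerWord, List.map_replicate, List.prod_replicate, letter, q_pow]
      congr 1
      · ring
      · push_cast
        ring
  simp [polyQ, Term.eval, h1, h2, q_mul_q]

/-- `h E_{1+2}` as a polynomial. -/
def polyEp : Poly := [⟨1, 0, [10, 10]⟩, ⟨-1, 0, []⟩]

theorem eval_polyEp : Poly.eval letter polyEp = Ep := by
  have := q_half_mul_self
  simp only [polyEp, letter, Poly.eval_cons, Poly.eval_nil, Term.eval, List.map_cons,
    List.map_nil, List.prod_cons, List.prod_nil, mul_one, this]
  norm_num

/-- Conjugation by `F` maps the letters as listed. -/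
def TableConj (F : PowerSeries (U2 so5)) (l : List (ℕ × Poly)) : Prop :=
  ∀ r ∈ l, SemiconjBy F (letter2 r.1) (Poly.eval letter2 r.2)

theorem TableConj.subst {F : PowerSeries (U2 so5)} {l : List (ℕ × Poly)} (hl : TableConj F l)
    {T : Rules} (hT : T.Sound letter2) {p r : Poly}
    (hp : Poly.subst T (fun a => lookup a l) p = some r) :
    SemiconjBy F (Poly.eval letter2 p) (Poly.eval letter2 r) :=
  Poly.semiconjBy_subst letter2 hT (fun _ _ h => hl _ (exists_mem_of_lookup h)) p r hp

/-- Checks the image of `1 ⊗ y` under conjugation by `exp (a ⊗ ln (1 + x))`, where `g` stands for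
`(1 + x)⁻¹`. -/
def checkLog (f : Poly → Option Poly) (T : Rules) (a x g y p : Poly) : Bool :=
  let z := Poly.comm rules1 x y
  let w := Poly.comm rules1 x z
  let w' := Poly.mul rules1 w (Poly.mul rules1 g g)
  Poly.isZero (Poly.comm rules1 x w) &&
    -- With l = ln(1 + x), the commutators are [l,y] = z g - ½ w g² and [l,[l,y]] = w g².
    match f y, f (Poly.sub (Poly.mul rules1 z g) (Poly.smul 1 1 w')), f w' with
    | some y1, some z1, some w1 => Poly.isZero (Poly.sub p (Poly.add (shift2 y1)
        (Poly.add (polyTens T a z1) (Poly.smul 1 1 (polyTens T (Poly.mul rules1 a a) w1)))))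
    | _, _, _ => false

/-- Second commutator of a logarithm l: g, g² and w commute with l, so only z contributes, through
[l,z] = w g. -/
theorem mul_sub_smul_eq {R : Type*} [Ring R] [Algebra ℂ R] {l z w g g2 : R}
    (k1 : l * g = g * l) (k2 : l * g2 = g2 * l) (k3 : l * w = w * l) (k4 : l * z = z * l + w * g)
    (k5 : g * g = g2) (c : ℂ) :
    l * (z * g - c • (w * g2)) = (z * g - c • (w * g2)) * l + w * g2 := by
  have h1 : l * (z * g) = z * g * l + w * g2 := by
    rw [← mul_assoc, k4, add_mul, mul_assoc, k1, mul_assoc, mul_assoc, k5]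
  have h2 : l * (w * g2) = w * g2 * l := by
    rw [← mul_assoc, k3, mul_assoc, k2, mul_assoc]
  rw [mul_sub, mul_smul_comm, h1, h2, sub_mul, smul_mul_assoc]
  abel

/-- The map `f` passes from `rules1` to the rules in which the result is expressed: it is `some` for
σ and `elim` for τ. -/
theorem semiconjBy_of_checkLog {f : Poly → Option Poly} {T : Rules} {a x g y p : Poly}
    (hf : ∀ p r, f p = some r → Poly.eval letter p = Poly.eval letter r) (hT : T.Sound letter)
    {v : PowerSeries (U so5)} (hx : Poly.eval letter x = v) (hv : constantCoeff v = 0)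
    (hg : Poly.eval letter g = exp (-logOneAdd v)) (h : checkLog f T a x g y p = true) :
    SemiconjBy (exp (tens (Poly.eval letter a) (logOneAdd v))) (leg2 (Poly.eval letter y))
      (Poly.eval letter2 p) := by
  rw [checkLog, Bool.and_eq_true] at h
  obtain ⟨h0, h⟩ := h
  have h3 := mul_comm_of_isZero_comm rules1_sound h0
  have h1 := eq_eval_comm rules1_sound x y
  have h2 := eq_eval_comm rules1_sound x (Poly.comm rules1 x y)
  rw [hx] at h1 h2 h3
  generalize Poly.comm rules1 x y = z at *
  generalize Poly.comm rules1 x z = w at *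
  split at h
  case h_2 => simp at h
  rename_i y1 z1 w1 ey ez ew
  rw [Poly.eval_eq_of_isZero_sub letter2 h]
  have c0 : constantCoeff (-logOneAdd v) = 0 := by
    rw [map_neg, constantCoeff_logOneAdd, neg_zero]
  have hg2 : exp (-logOneAdd v) * exp (-logOneAdd v) = exp ((-2 : ℂ) • logOneAdd v) := by
    rw [← exp_add c0 c0 (Commute.refl _)]
    congr 1
    module
  have c2 : constantCoeff ((-2 : ℂ) • logOneAdd v) = 0 := by
    rw [← coeff_zero_eq_constantCoeff_apply, coeff_smul, coeff_zero_eq_constantCoeff_apply,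
      constantCoeff_logOneAdd, smul_zero]
  have k1 : logOneAdd v * exp (-logOneAdd v) = exp (-logOneAdd v) * logOneAdd v :=
    commute_exp c0 (Commute.refl _).neg_right
  have k2 : logOneAdd v * exp ((-2 : ℂ) • logOneAdd v) =
      exp ((-2 : ℂ) • logOneAdd v) * logOneAdd v :=
    commute_exp c2 ((Commute.refl _).smul_right _)
  have k3 : logOneAdd v * Poly.eval letter w = Poly.eval letter w * logOneAdd v :=
    (commute_logOneAdd hv (show Commute (Poly.eval letter w) v from h3.symm)).symm
  -- The commutator formula is applied to z in place of y; its second-order term is absent because x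
  -- commutes with w.
  have k4 := logOneAdd_mul_eq (w := 0) hv h2 (by rw [h3, add_zero]) (by simp)
  rw [zero_mul, smul_zero, sub_zero] at k4
  have := semiconjBy_exp_tens_leg2 (Poly.eval letter a) (constantCoeff_logOneAdd v)
    (logOneAdd_mul_eq hv h1 h2 h3) (w := Poly.eval letter w * exp ((-2 : ℂ) • logOneAdd v)) ?_ ?_
  · rw [tens_eq] at this
    simp only [Poly.eval_add, eval_shift2, eval_polyTens hT, Poly.eval_smul, tens_eq,
      Poly.eval_mul _ rules1_sound, ← hf _ _ ey, ← hf _ _ ez, ← hf _ _ ew, Poly.eval_sub, hg, hg2,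
      Int.cast_one, pow_one]
    rw [← add_assoc]
    exact this
  · exact mul_sub_smul_eq k1 k2 k3 k4 hg2 _
  · rw [← mul_assoc, k3, mul_assoc, k2, mul_assoc]

/-- Checks the image of `y ⊗ 1` under conjugation by `exp (a ⊗ b)`, where `y` has weight `n / 2`
for `a`, and `g` stands for `exp (n / 2 b)`. -/
def checkWeight (f : Poly → Option Poly) (T : Rules) (a : Poly) (n : ℤ) (g y p : Poly) : Bool :=
  Poly.isZero (Poly.sub (Poly.comm rules1 a y) (Poly.smul n 1 y)) &&
    match f y with
    | some y1 => Poly.isZero (Poly.sub p (polyTens T y1 g))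
    | none => false

theorem semiconjBy_of_checkWeight {f : Poly → Option Poly} {T : Rules} {a g y p : Poly} {n : ℤ}
    (hf : ∀ p r, f p = some r → Poly.eval letter p = Poly.eval letter r) (hT : T.Sound letter)
    {b : PowerSeries (U so5)} (hb : constantCoeff b = 0)
    (hg : Poly.eval letter g = exp ((n / 2 : ℂ) • b)) (h : checkWeight f T a n g y p = true) :
    SemiconjBy (exp (tens (Poly.eval letter a) b)) (leg1 (Poly.eval letter y))
      (Poly.eval letter2 p) := by
  rw [checkWeight, Bool.and_eq_true] at h
  obtain ⟨h0, h⟩ := h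
  have h1 := eq_eval_comm rules1_sound a y
  rw [Poly.eval_eq_of_isZero_sub letter h0, Poly.eval_smul] at h1
  split at h
  case h_2 => simp at h
  rename_i y1 ey
  rw [Poly.eval_eq_of_isZero_sub letter2 h, eval_polyTens hT, hg, ← hf _ _ ey]
  exact semiconjBy_exp_tens_leg1_of_weight hb (by simpa using h1)

/-- Checks the image of `1 ⊗ y` under conjugation by `exp (a ⊗ b)`. -/
def checkExp2 (a b y p : Poly) : Bool :=
  let z := Poly.comm rules1 b y
  let w := Poly.comm rules1 b z
  Poly.isZero (Poly.comm rules1 b w) && Poly.isZero (Poly.sub p (Poly.add (shift2 y)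
    (Poly.add (polyTens rules1 a z) (Poly.smul 1 1 (polyTens rules1 (Poly.mul rules1 a a) w)))))

theorem semiconjBy_of_checkExp2 {a b y p : Poly} (hb : constantCoeff (Poly.eval letter b) = 0)
    (h : checkExp2 a b y p = true) :
    SemiconjBy (exp (tens (Poly.eval letter a) (Poly.eval letter b))) (leg2 (Poly.eval letter y))
      (Poly.eval letter2 p) := by
  rw [checkExp2, Bool.and_eq_true] at h
  have := semiconjBy_exp_tens_leg2 (Poly.eval letter a) hb (eq_eval_comm rules1_sound b y)
    (eq_eval_comm rules1_sound b _) (mul_comm_of_isZero_comm rules1_sound h.1)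
  rw [Poly.eval_eq_of_isZero_sub letter2 h.2]
  simp only [Poly.eval_add, eval_shift2, eval_polyTens rules1_sound, Poly.eval_smul, tens_eq,
    Poly.eval_mul _ rules1_sound]
  rw [← add_assoc]
  simpa [tens_eq] using this

/-- Checks the image of `y ⊗ 1` under conjugation by `exp (a ⊗ b)`. -/
def checkExp1 (a b y p : Poly) : Bool :=
  let z := Poly.comm rules1 a y
  let w := Poly.comm rules1 a z
  Poly.isZero (Poly.comm rules1 a w) && Poly.isZero (Poly.sub p (Poly.add (shift1 y)
    (Poly.add (polyTens rules1 z b) (Poly.smul 1 1 (polyTens rules1 w (Poly.mul rules1 b b))))))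

theorem semiconjBy_of_checkExp1 {a b y p : Poly} (hb : constantCoeff (Poly.eval letter b) = 0)
    (h : checkExp1 a b y p = true) :
    SemiconjBy (exp (tens (Poly.eval letter a) (Poly.eval letter b))) (leg1 (Poly.eval letter y))
      (Poly.eval letter2 p) := by
  rw [checkExp1, Bool.and_eq_true] at h
  have := semiconjBy_exp_tens_leg1 hb (eq_eval_comm rules1_sound a y)
    (eq_eval_comm rules1_sound a _) (mul_comm_of_isZero_comm rules1_sound h.1)
  rw [Poly.eval_eq_of_isZero_sub letter2 h.2]
  simp only [Poly.eval_add, eval_shift1, eval_polyTens rules1_sound, Poly.eval_smul, tens_eq,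
    Poly.eval_mul _ rules1_sound]
  rw [← add_assoc]
  simpa [tens_eq] using this

end So5

/-! ### Images of the letters under the three exponential factors. -/

namespace So5

open FormalTwist PowerSeries Rewriting

/-- Conjugation by `exp (H_{1+2} ⊗ σ)`. -/
def tableJ : List (ℕ × Poly) :=
  [(0, [⟨1, 0, [0]⟩]), (2, [⟨1, 0, [2, 23, 23]⟩]), (4, [⟨1, 0, [4, 23]⟩]), (6, [⟨1, 0, [6]⟩]),
   (8, [⟨1, 0, [8, 23]⟩]), (10, [⟨1, 0, [10, 21]⟩]), (12, [⟨1, 0, [12]⟩]), (14, [⟨1, 0, [14]⟩]),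
   (16, [⟨1, 0, [16]⟩]), (18, [⟨1, 0, [18, 21]⟩]), (3, [⟨-1, 0, [0, 12, 12, 23, 23]⟩,
   ⟨1, 0, [0, 12, 12, 23, 23, 23, 23]⟩, ⟨2, 0, [0, 12, 13, 23, 23]⟩, ⟨1, 0, [0, 12, 23, 23]⟩,
   ⟨-1, 0, [0, 12, 23, 23, 23, 23]⟩, ⟨1, 0, [3]⟩]), (5, [⟨-1, 0, [0, 12, 11, 23, 23]⟩,
   ⟨1, 0, [5]⟩]), (7, [⟨1, 0, [7]⟩]), (9, [⟨1, 0, [9]⟩, ⟨1, 0, [12, 19, 23, 23]⟩]),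
   (11, [⟨1, 0, [11]⟩]), (13, [⟨-1, 0, [12]⟩, ⟨1, 0, [12, 23, 23]⟩, ⟨1, 0, [13]⟩]),
   (15, [⟨1, 0, [15]⟩]), (17, [⟨1, 0, [17]⟩]), (19, [⟨1, 0, [19]⟩])]

/-- Conjugation by `exp (-E_2 ⊗ h E_1 exp (-σ / 2))`. -/
def tableE : List (ℕ × Poly) :=
  [(0, [⟨1, 0, [0]⟩]), (2, [⟨1, 0, [2]⟩, ⟨-1, 0, [4, 19, 23]⟩, ⟨-1, 1, [6, 19, 19, 23, 23]⟩]),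
   (4, [⟨1, 0, [4]⟩, ⟨1, 0, [6, 19, 23]⟩]), (6, [⟨1, 0, [6]⟩]), (8, [⟨1, 0, [8]⟩,
   ⟨-1, 1, [10, 19, 19, 23, 23]⟩, ⟨-1, 0, [12, 19, 23]⟩, ⟨1, 0, [14, 19, 23]⟩]),
   (10, [⟨1, 0, [10]⟩]), (12, [⟨1, 1, [10, 19, 23]⟩, ⟨1, 0, [12]⟩]), (14, [⟨-1, 1, [10, 19, 23]⟩,
   ⟨1, 0, [14]⟩]), (16, [⟨1, 0, [16]⟩, ⟨-1, 0, [18, 19, 23]⟩, ⟨1, 1, [19, 19, 23, 23]⟩,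
   ⟨-1, 1, [20, 20, 19, 19, 23, 23]⟩]), (18, [⟨1, 0, [18]⟩, ⟨-1, 0, [19, 23]⟩,
   ⟨1, 0, [20, 20, 19, 23]⟩]), (20, [⟨1, 0, [20]⟩]), (22, [⟨1, 0, [22]⟩]),
   (3, [⟨1, 0, [0, 10, 9, 23]⟩, ⟨1, 1, [0, 10, 10, 17, 23, 23]⟩,
   ⟨1, 2, [0, 10, 10, 19, 19, 23, 23, 23, 23]⟩,
   ⟨1, 2, [0, 10, 10, 19, 19, 23, 23, 23, 23, 23, 23]⟩, ⟨1, 0, [0, 10, 13, 19, 23, 23, 23]⟩,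
   ⟨1, 2, [0, 10, 19, 23, 23, 23]⟩, ⟨-3, 2, [0, 10, 19, 23, 23, 23, 23, 23]⟩, ⟨1, 0, [3]⟩]),
   (5, [⟨-1, 1, [0, 10, 10, 19, 23, 23, 23, 23]⟩, ⟨-1, 1, [0, 10, 11, 19, 23, 23, 23]⟩,
   ⟨-1, 0, [0, 10, 13, 23]⟩, ⟨-1, 0, [0, 10, 15, 23]⟩, ⟨-1, 1, [0, 10, 23]⟩,
   ⟨1, 1, [0, 10, 23, 23, 23]⟩, ⟨1, 0, [5]⟩]), (7, [⟨1, 1, [0, 10, 10]⟩,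
   ⟨-1, 1, [0, 10, 10, 23, 23]⟩, ⟨-1, 0, [0, 10, 11, 23]⟩, ⟨1, 0, [7]⟩]), (9, [⟨1, 0, [9]⟩,
   ⟨1, 0, [10, 17, 23]⟩, ⟨1, 1, [10, 19, 19, 23, 23, 23]⟩]), (11, [⟨-1, 0, [10, 21]⟩,
   ⟨1, 0, [10, 23]⟩, ⟨1, 0, [11]⟩]), (13, [⟨1, 1, [10, 19, 23, 23, 23]⟩, ⟨1, 0, [13]⟩]),
   (15, [⟨1, 1, [10, 19, 23]⟩, ⟨1, 0, [15]⟩]), (17, [⟨1, 0, [17]⟩]), (19, [⟨1, 0, [19]⟩]),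
   (21, [⟨1, 0, [21]⟩]), (23, [⟨1, 0, [23]⟩])]

/-- Conjugation by `exp (H_{1-2} ⊗ τ)`. -/
def tableB : List (ℕ × Poly) :=
  [(0, [⟨1, 0, [0]⟩]), (2, [⟨1, 0, [2]⟩]), (4, [⟨1, 0, [4, 27]⟩]), (6, [⟨1, 0, [6, 27, 27]⟩]),
   (8, [⟨1, 0, [8, 25]⟩]), (10, [⟨1, 0, [10, 27]⟩]), (12, [⟨1, 0, [12]⟩]), (14, [⟨1, 0, [14]⟩]),
   (16, [⟨-1, 1, [18, 18, 22, 22, 25, 25]⟩, ⟨1, 0, [24, 24, 25, 25]⟩, ⟨-1, 0, [25, 25]⟩]),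
   (18, [⟨1, 0, [18, 25]⟩]), (20, [⟨1, 0, [20]⟩]), (22, [⟨1, 0, [22]⟩]),
   (3, [⟨-1, 0, [0, 14, 9, 19, 23, 23, 27, 27]⟩,
   ⟨-1, 0, [0, 14, 13, 19, 19, 23, 23, 23, 23, 27, 27]⟩,
   ⟨1, 2, [0, 14, 14, 19, 19, 19, 19, 23, 23, 23, 23, 23, 23, 23, 23, 27, 27, 27, 27]⟩,
   ⟨1, 1, [0, 14, 14, 19, 19, 23, 23, 23, 23, 27, 27]⟩,
   ⟨-1, 1, [0, 14, 14, 19, 19, 23, 23, 23, 23, 27, 27, 27, 27]⟩,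
   ⟨-1, 2, [0, 14, 19, 19, 19, 19, 23, 23, 23, 23, 23, 23, 23, 23, 27, 27, 27, 27]⟩,
   ⟨1, 0, [0, 14, 19, 19, 23, 23, 23, 23, 23, 23, 27, 27]⟩,
   ⟨-3, 2, [0, 14, 19, 19, 23, 23, 23, 23, 27, 27]⟩,
   ⟨1, 1, [0, 14, 19, 19, 23, 23, 23, 23, 27, 27, 27, 27]⟩, ⟨1, 1, [0, 14, 23, 23]⟩,
   ⟨-1, 1, [0, 14, 23, 23, 27, 27]⟩, ⟨1, 0, [3]⟩]), (5, [⟨1, 0, [0, 14, 9, 27, 27]⟩,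
   ⟨1, 1, [0, 14, 11, 19, 19, 23, 23, 23, 23, 27, 27]⟩, ⟨1, 0, [0, 14, 13, 19, 23, 23, 27, 27]⟩,
   ⟨-1, 1, [0, 14, 14, 19, 19, 19, 23, 23, 23, 23, 23, 23, 27, 27, 27, 27]⟩,
   ⟨-1, 0, [0, 14, 14, 19, 23, 23, 27, 27]⟩, ⟨1, 0, [0, 14, 14, 19, 23, 23, 27, 27, 27, 27]⟩,
   ⟨1, 0, [0, 14, 15, 19, 23, 23, 27, 27]⟩,
   ⟨1, 1, [0, 14, 19, 19, 19, 23, 23, 23, 23, 23, 23, 27, 27, 27, 27]⟩,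
   ⟨-1, 0, [0, 14, 19, 23, 23, 23, 23, 27, 27]⟩, ⟨3, 1, [0, 14, 19, 23, 23, 27, 27]⟩,
   ⟨-1, 0, [0, 14, 19, 23, 23, 27, 27, 27, 27]⟩, ⟨1, 0, [5]⟩]),
   (7, [⟨1, 0, [0, 14, 11, 19, 23, 23, 27, 27]⟩,
   ⟨-1, 1, [0, 14, 14, 19, 19, 23, 23, 23, 23, 27, 27, 27, 27]⟩, ⟨-1, 0, [0, 14, 14, 27, 27]⟩,
   ⟨1, 0, [0, 14, 14, 27, 27, 27, 27]⟩, ⟨2, 0, [0, 14, 15, 27, 27]⟩,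
   ⟨1, 1, [0, 14, 19, 19, 23, 23, 23, 23, 27, 27, 27, 27]⟩, ⟨-1, 1, [0, 14, 23, 23, 27, 27]⟩,
   ⟨3, 1, [0, 14, 27, 27]⟩, ⟨-1, 0, [0, 14, 27, 27, 27, 27]⟩, ⟨1, 0, [7]⟩]), (9, [⟨1, 0, [9]⟩,
   ⟨-1, 0, [14, 19, 23, 23]⟩, ⟨1, 0, [14, 19, 23, 23, 27, 27]⟩]), (11, [⟨1, 0, [11]⟩,
   ⟨-1, 0, [14, 19, 23, 23, 27, 27]⟩]), (13, [⟨1, 0, [13]⟩,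
   ⟨-1, 1, [14, 19, 19, 23, 23, 23, 23, 27, 27]⟩]), (15, [⟨-1, 0, [14]⟩, ⟨1, 0, [14, 27, 27]⟩,
   ⟨1, 0, [15]⟩]), (17, [⟨-1, 0, []⟩, ⟨-1, 1, [19, 19, 23, 23]⟩, ⟨1, 0, [25, 25]⟩]),
   (19, [⟨1, 0, [19]⟩]), (21, [⟨1, 0, [21]⟩]), (23, [⟨1, 0, [23]⟩])]

/-- Twice the weights of the letters for `H_{1+2}`. -/
def weightJ : ℕ → ℤ
  | 1 => -2 | 2 => -1 | 4 => -1 | 5 => 1 | 9 => 1 | _ => 0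

/-- Twice the weights of the letters for `H_{1-2}`. -/
def weightB : ℕ → ℤ
  | 2 => -1 | 3 => -2 | 4 => 1 | 5 => -1 | 8 => 2 | 9 => 1 | _ => 0

/-- Checks an entry of `tableJ`. -/
def checkJ (r : ℕ × Poly) : Bool :=
  bif Nat.beq (r.1 % 2) 0 then checkWeight some rules1 (var 6) (weightJ (r.1 / 2))
    (polyQ (weightJ (r.1 / 2)) 0) (var (r.1 / 2)) r.2
  else checkLog some rules1 (var 6) polyEp (polyQ (-2) 0) (var (r.1 / 2)) r.2

/-- `-E_2` as a polynomial. -/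
def polyNegE2 : Poly := [⟨-1, 0, [5]⟩]

/-- `h E_1 exp (-σ / 2)` as a polynomial. -/
def polyX : Poly := [⟨1, 0, [9, 11]⟩]

/-- Checks an entry of `tableE`. -/
def checkE (r : ℕ × Poly) : Bool :=
  bif Nat.beq (r.1 % 2) 0 then checkExp1 polyNegE2 polyX (var (r.1 / 2)) r.2
  else checkExp2 polyNegE2 polyX (var (r.1 / 2)) r.2

/-- Checks an entry of `tableB`. -/
def checkB (r : ℕ × Poly) : Bool :=
  bif Nat.beq (r.1 % 2) 0 then checkWeight elim rules2 (var 7) (weightB (r.1 / 2))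
    (polyQ 0 (weightB (r.1 / 2))) (var (r.1 / 2)) r.2
  else checkLog elim rules2 (var 7) polyEBO (polyQ 0 (-2)) (var (r.1 / 2)) r.2

/-- H_{1+2} acts by weights on the letters of the first factor, while ad hE_{1+2} is nilpotent on
those of the second; hence one weight check or one logarithm check per row. -/
theorem tableConj_tableJ : TableConj (exp (tens Hp sigma)) tableJ := by
  have h : tableJ.all checkJ = true := by decide +kernel
  have hf : ∀ p r : Poly, some p = some r → Poly.eval letter p = Poly.eval letter r :=
    fun p r h => by rw [Option.some.inj h]
  intro r hr
  have hr' := List.all_eq_true.1 h r hr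
  rw [checkJ] at hr'
  have ha : Poly.eval letter (var 6) = Hp := eval_var letter 6
  cases h2 : Nat.beq (r.1 % 2) 0 with
  | true =>
    rw [h2, cond_true] at hr'
    have := semiconjBy_of_checkWeight hf rules1_sound constantCoeff_sigma
      (by rw [eval_polyQ, Int.cast_zero, zero_div, q_left]) hr'
    rwa [ha, eval_var, ← letter2_of_even h2] at this
  | false =>
    rw [h2, cond_false] at hr'
    have := semiconjBy_of_checkLog hf rules1_sound eval_polyEp constantCoeff_Ep
      (by rw [eval_polyQ, Int.cast_zero, zero_div, q_left, sigma]; norm_num) hr'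
    rwa [ha, eval_var, ← letter2_of_odd h2] at this

theorem tableConj_tableB : TableConj factorBJ tableB := by
  have h : tableB.all checkB = true := by decide +kernel
  intro r hr
  have hr' := List.all_eq_true.1 h r hr
  rw [checkB] at hr'
  have ha : Poly.eval letter (var 7) = Hm := eval_var letter 7
  cases h2 : Nat.beq (r.1 % 2) 0 with
  | true =>
    rw [h2, cond_true] at hr'
    have := semiconjBy_of_checkWeight (fun _ _ => eval_elim) rules2_sound constantCoeff_sigmaBO
      (by rw [eval_polyQ, Int.cast_zero, zero_div, q_right]) hr'
    rwa [ha, eval_var, ← letter2_of_even h2] at this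
  | false =>
    rw [h2, cond_false] at hr'
    have := semiconjBy_of_checkLog (fun _ _ => eval_elim) rules2_sound eval_polyEBO
      constantCoeff_EBO
      (by rw [eval_polyQ, Int.cast_zero, zero_div, q_right, sigmaBO]; norm_num) hr'
    rwa [ha, eval_var, ← letter2_of_odd h2] at this

theorem eval_polyNegE2 : Poly.eval letter polyNegE2 = -E2 := by
  simp [polyNegE2, Term.eval, letter]

theorem eval_polyX : Poly.eval letter polyX = E1 * q (-1 / 2) 0 := by
  simp [polyX, Term.eval, letter]

theorem constantCoeff_E1_mul (x : PowerSeries (U so5)) : constantCoeff (E1 * x) = 0 := by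
  rw [E1, mul_assoc, constantCoeff_h_mul]

/-- Here no weights are involved: on the listed letters both -E_2 and hE_1 e^{-σ/2} have vanishing
third commutators, so both legs use the terminating expansion. -/
theorem tableConj_tableE : TableConj (exp (tens (-E2) (E1 * q (-1 / 2) 0))) tableE := by
  have h : tableE.all checkE = true := by decide +kernel
  have hX : constantCoeff (Poly.eval letter polyX) = 0 := by
    rw [eval_polyX, constantCoeff_E1_mul]
  intro r hr
  have hr' := List.all_eq_true.1 h r hr
  rw [checkE] at hr'
  rw [← eval_polyNegE2, ← eval_polyX]
  cases h2 : Nat.beq (r.1 % 2) 0 with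
  | true =>
    rw [h2, cond_true] at hr'
    have := semiconjBy_of_checkExp1 hX hr'
    rwa [eval_var, ← letter2_of_even h2] at this
  | false =>
    rw [h2, cond_false] at hr'
    have := semiconjBy_of_checkExp2 hX hr'
    rwa [eval_var, ← letter2_of_odd h2] at this

end So5

/-! ### Coproducts of the generators by successive substitution. -/

namespace So5

set_option linter.unusedSimpArgs false

open FormalTwist PowerSeries Rewriting

/-- The product of polynomials in one tensor factor. -/
def mul1 : Poly → Poly → Poly := Poly.mul rules2

/-- The product of polynomials in the tensor square. -/
def mul2 : Poly → Poly → Poly := Poly.mul (rulesTensor rules2)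

/-- The tensor product of polynomials. -/
def ten : Poly → Poly → Poly := polyTens rules2

/-- The unit polynomial. -/
def one : Poly := [⟨1, 0, []⟩]

theorem eval_mul1 (p r : Poly) :
    Poly.eval letter (mul1 p r) = Poly.eval letter p * Poly.eval letter r :=
  Poly.eval_mul _ rules2_sound p r

theorem eval_mul2 (p r : Poly) :
    Poly.eval letter2 (mul2 p r) = Poly.eval letter2 p * Poly.eval letter2 r :=
  Poly.eval_mul _ (rulesTensor_sound rules2_sound) p r

theorem eval_ten (p r : Poly) :
    Poly.eval letter2 (ten p r) = tens (Poly.eval letter p) (Poly.eval letter r) :=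
  eval_polyTens rules2_sound p r

theorem eval_one : Poly.eval letter one = 1 := by
  simp [one, Term.eval]

/-- The constant polynomial `2`. -/
def two : Poly := [⟨2, 0, []⟩]

theorem eval_two : Poly.eval letter two = 2 := by
  simp only [two, Poly.eval_cons, Poly.eval_nil, Term.eval, List.map_nil, List.prod_nil]
  rw [pow_zero, div_one, add_zero, Int.cast_ofNat, two_smul, one_add_one_eq_two]

theorem letter2_zero : letter2 0 = h2 := leg1_h

/-- The sign is moved into the first tensor factor, to match the general form exp (a ⊗ b). -/
theorem twistEJ_eq :
    twistEJ = exp (tens (-E2) (E1 * q (-1 / 2) 0)) * exp (tens Hp sigma) := by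
  rw [twistEJ, q_left, tens_eq (-E2), map_neg, neg_mul, ← tens_eq]

theorem isUnit_exp_tens (a : PowerSeries (U so5)) {b : PowerSeries (U so5)}
    (hb : constantCoeff b = 0) : IsUnit (exp (tens a b)) :=
  isUnit_exp (constantCoeff_tens a hb)

theorem isUnit_twistEJ : IsUnit twistEJ := by
  rw [twistEJ_eq]
  exact (isUnit_exp_tens _ (constantCoeff_E1_mul _)).mul (isUnit_exp_tens _ constantCoeff_sigma)

theorem isUnit_factorBJ : IsUnit factorBJ := isUnit_exp_tens _ constantCoeff_sigmaBO

/-- `Δ_{EJ}` of the letter `a`, computed by substitutions. -/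
def coprodEJ (a : ℕ) : Option Poly :=
  match Poly.subst (rulesTensor rules1) (fun n => lookup n tableJ)
    (Poly.add (shift1 (var a)) (shift2 (var a))) with
  | some p => Poly.subst (rulesTensor rules1) (fun n => lookup n tableE) p
  | none => none

/-- `Δ_{BJEJ}` of the letter `a`, computed by substitutions. -/
def coprodBJEJ (a : ℕ) : Option Poly :=
  match coprodEJ a with
  | some p => Poly.subst (rulesTensor rules2) (fun n => lookup n tableB) p
  | none => none

theorem semiconjBy_of_coprodEJ {a : ℕ} {p : Poly} (hp : coprodEJ a = some p)
    (ha : comulPS (letter a) = leg1 (letter a) + leg2 (letter a)) :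
    SemiconjBy twistEJ (comulPS (letter a)) (Poly.eval letter2 p) := by
  rw [coprodEJ] at hp
  split at hp
  case h_2 => simp at hp
  rename_i r hr
  have h1 := tableConj_tableJ.subst (rulesTensor_sound rules1_sound) hr
  have h2 := tableConj_tableE.subst (rulesTensor_sound rules1_sound) hp
  rw [Poly.eval_add, eval_shift1, eval_shift2, eval_var, ← ha] at h1
  rw [twistEJ_eq]
  exact h2.mul_left h1

theorem semiconjBy_of_coprodBJEJ {a : ℕ} {p : Poly} (hp : coprodBJEJ a = some p)
    (ha : comulPS (letter a) = leg1 (letter a) + leg2 (letter a)) :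
    SemiconjBy twistBJEJ (comulPS (letter a)) (Poly.eval letter2 p) := by
  rw [coprodBJEJ] at hp
  split at hp
  case h_2 => simp at hp
  rename_i r hr
  have h1 := tableConj_tableB.subst (rulesTensor_sound rules2_sound) hp
  exact h1.mul_left (semiconjBy_of_coprodEJ hr ha)

/-- Whether a partial polynomial is defined and equal to another one. -/
def isSomeEq (o : Option Poly) (r : Poly) : Bool :=
  match o with
  | some p => Poly.isZero (Poly.sub p r)
  | none => false

/-- The comparison collects like terms without applying rules, hence holds for every valuation; both
polynomials have to be normalized beforehand. -/
theorem exists_of_isSomeEq {o : Option Poly} {r : Poly} (h : isSomeEq o r = true) :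
    ∃ p, o = some p ∧ ∀ ρ : ℕ → PowerSeries (U2 so5), Poly.eval ρ p = Poly.eval ρ r := by
  cases o with
  | none => simp [isSomeEq] at h
  | some p => exact ⟨p, rfl, fun ρ => Poly.eval_eq_of_isZero_sub ρ h⟩

theorem semiconjBy_twistEJ {a : ℕ} {r : Poly} (h : isSomeEq (coprodEJ a) r = true)
    (ha : comulPS (letter a) = leg1 (letter a) + leg2 (letter a)) :
    SemiconjBy twistEJ (comulPS (letter a)) (Poly.eval letter2 r) := by
  obtain ⟨p, hp, hr⟩ := exists_of_isSomeEq h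
  rw [← hr]
  exact semiconjBy_of_coprodEJ hp ha

theorem deltaEJ_eq {a : ℕ} {r : Poly} (h : isSomeEq (coprodEJ a) r = true)
    (ha : comulPS (letter a) = leg1 (letter a) + leg2 (letter a)) :
    deltaEJ (letter a) = Poly.eval letter2 r :=
  twistedComul_eq isUnit_twistEJ (semiconjBy_twistEJ h ha)

theorem deltaBJEJ_eq {a : ℕ} {r : Poly} (h : isSomeEq (coprodBJEJ a) r = true)
    (ha : comulPS (letter a) = leg1 (letter a) + leg2 (letter a)) :
    deltaBJEJ (letter a) = Poly.eval letter2 r := by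
  obtain ⟨p, hp, hr⟩ := exists_of_isSomeEq h
  rw [← hr]
  exact twistedComul_eq (isUnit_factorBJ.mul isUnit_twistEJ) (semiconjBy_of_coprodBJEJ hp ha)

theorem comulPS_gen (x : so5) : comulPS (gen x) = leg1 (gen x) + leg2 (gen x) :=
  comulPS_C_ι x

theorem comulPS_h : comulPS h = h2 := by
  simp [comulPS, h, h2, mapAlgHom_apply]

theorem comulPS_h_mul_gen (x : so5) :
    comulPS (h * gen x) = leg1 (h * gen x) + leg2 (h * gen x) := by
  rw [map_mul, map_mul, map_mul, comulPS_h, leg1_h, leg2_h, comulPS_gen, mul_add]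

/-- The pattern for the coproducts computed from the tables: the closed formula is transcribed as a
polynomial, compared in the kernel with the result of the substitutions, and evaluated back. -/
theorem deltaEJ_Hp :
    deltaEJ Hp = Hp ⊠ q (-1) 0 + 1 ⊠ Hp + E2 ⊠ E1 * q (-3 / 2) 0 := by
  have h : isSomeEq (coprodEJ 6)
      (((polyTens rules1 (var 6) (polyQ (-2) 0)).add (polyTens rules1 one (var 6))).add (polyTens
        rules1 (var 5) (Poly.mul rules1 (var 9) (polyQ (-3) 0)))) = true := by
    decide +kernel
  refine (deltaEJ_eq h (comulPS_gen _)).trans ?_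
  simp only [Poly.eval_add, Poly.eval_sub, Poly.eval_smul, eval_polyTens rules1_sound,
    Poly.eval_mul _ rules1_sound, eval_polyQ, eval_one, eval_two, eval_polyEm, eval_polyEp,
    eval_var, letter, letter2_zero, H1, pow_two]
  norm_num

theorem deltaEJ_E2 :
    deltaEJ E2 = E2 ⊠ q (-1 / 2) 0 + 1 ⊠ E2 := by
  have h : isSomeEq (coprodEJ 5)
      ((polyTens rules1 (var 5) (polyQ (-1) 0)).add (polyTens rules1 one (var 5))) = true := by
    decide +kernel
  refine (deltaEJ_eq h (comulPS_gen _)).trans ?_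
  simp only [Poly.eval_add, Poly.eval_sub, Poly.eval_smul, eval_polyTens rules1_sound,
    Poly.eval_mul _ rules1_sound, eval_polyQ, eval_one, eval_two, eval_polyEm, eval_polyEp,
    eval_var, letter, letter2_zero, H1, pow_two]
  norm_num

theorem deltaEJ_E1 :
    deltaEJ E1 = E1 ⊠ q (1 / 2) 0 + q 1 0 ⊠ E1 := by
  have h : isSomeEq (coprodEJ 9)
      ((polyTens rules1 (var 9) (polyQ 1 0)).add (polyTens rules1 (polyQ 2 0) (var 9))) = true := by
    decide +kernel
  refine (deltaEJ_eq h (comulPS_h_mul_gen _)).trans ?_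
  simp only [Poly.eval_add, Poly.eval_sub, Poly.eval_smul, eval_polyTens rules1_sound,
    Poly.eval_mul _ rules1_sound, eval_polyQ, eval_one, eval_two, eval_polyEm, eval_polyEp,
    eval_var, letter, letter2_zero, H1, pow_two]
  norm_num

theorem deltaEJ_Em :
    deltaEJ Em = Em ⊠ 1 + 1 ⊠ Em - E1 ⊠ E1 * q (-1 / 2) 0 - (1 / 2 : ℂ) • (Ep ⊠ E1 ^ 2 * q (-1) 0)
      := by
  have h : isSomeEq (coprodEJ 8)
      ((((polyTens rules1 (var 8) one).add (polyTens rules1 one (var 8))).sub (polyTens rules1 (var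
        9) (Poly.mul rules1 (var 9) (polyQ (-1) 0)))).sub (Poly.smul 1 1 (polyTens rules1 polyEp
        (Poly.mul rules1 (Poly.mul rules1 (var 9) (var 9)) (polyQ (-2) 0))))) = true := by
    decide +kernel
  refine (deltaEJ_eq h (comulPS_h_mul_gen _)).trans ?_
  simp only [Poly.eval_add, Poly.eval_sub, Poly.eval_smul, eval_polyTens rules1_sound,
    Poly.eval_mul _ rules1_sound, eval_polyQ, eval_one, eval_two, eval_polyEm, eval_polyEp,
    eval_var, letter, letter2_zero, H1, pow_two]
  norm_num

theorem deltaEJ_Hm :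
    deltaEJ Hm = Hm ⊠ 1 + 1 ⊠ Hm := by
  have h : isSomeEq (coprodEJ 7)
      ((polyTens rules1 (var 7) one).add (polyTens rules1 one (var 7))) = true := by
    decide +kernel
  refine (deltaEJ_eq h (comulPS_gen _)).trans ?_
  simp only [Poly.eval_add, Poly.eval_sub, Poly.eval_smul, eval_polyTens rules1_sound,
    Poly.eval_mul _ rules1_sound, eval_polyQ, eval_one, eval_two, eval_polyEm, eval_polyEp,
    eval_var, letter, letter2_zero, H1, pow_two]

theorem deltaBJEJ_Hp :
    deltaBJEJ Hp = Hp ⊠ q (-1) 0 + 1 ⊠ Hp + E2 ⊠ E1 * q (-3 / 2) (-1 / 2) - (1 / 2 : ℂ) • (Hm ⊠ E1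
      ^ 2 * q (-2) (-1)) := by
  have h : isSomeEq (coprodBJEJ 6)
      ((((ten (var 6) (polyQ (-2) 0)).add (ten one (var 6))).add (ten (var 5) (mul1 (var 9) (polyQ
        (-3) (-1))))).sub (Poly.smul 1 1 (ten (var 7) (mul1 (mul1 (var 9) (var 9)) (polyQ (-4)
        (-2)))))) = true := by
    decide +kernel
  refine (deltaBJEJ_eq h (comulPS_gen _)).trans ?_
  simp only [Poly.eval_add, Poly.eval_sub, Poly.eval_smul, eval_ten, eval_mul1, eval_mul2,
    eval_polyQ, eval_one, eval_two, eval_polyEm, eval_polyEp, eval_var, letter, letter2_zero, H1,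
    pow_two]
  norm_num

theorem deltaBJEJ_Hm :
    deltaBJEJ Hm = Hm ⊠ q 0 (-1) + 1 ⊠ Hm := by
  have h : isSomeEq (coprodBJEJ 7)
      ((ten (var 7) (polyQ 0 (-2))).add (ten one (var 7))) = true := by
    decide +kernel
  refine (deltaBJEJ_eq h (comulPS_gen _)).trans ?_
  simp only [Poly.eval_add, Poly.eval_sub, Poly.eval_smul, eval_ten, eval_mul1, eval_mul2,
    eval_polyQ, eval_one, eval_two, eval_polyEm, eval_polyEp, eval_var, letter, letter2_zero, H1,
    pow_two]
  norm_num

theorem deltaBJEJ_E2 :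
    deltaBJEJ E2 = E2 ⊠ q (-1 / 2) (-1 / 2) + 1 ⊠ E2 - Hm ⊠ E1 * q (-1) (-1) := by
  have h : isSomeEq (coprodBJEJ 5)
      (((ten (var 5) (polyQ (-1) (-1))).add (ten one (var 5))).sub (ten (var 7) (mul1 (var 9)
        (polyQ (-2) (-2))))) = true := by
    decide +kernel
  refine (deltaBJEJ_eq h (comulPS_gen _)).trans ?_
  simp only [Poly.eval_add, Poly.eval_sub, Poly.eval_smul, eval_ten, eval_mul1, eval_mul2,
    eval_polyQ, eval_one, eval_two, eval_polyEm, eval_polyEp, eval_var, letter, letter2_zero, H1,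
    pow_two]
  norm_num

theorem deltaBJEJ_E1 :
    deltaBJEJ E1 = E1 ⊠ q (1 / 2) (1 / 2) + q 1 0 ⊠ E1 := by
  have h : isSomeEq (coprodBJEJ 9)
      ((ten (var 9) (polyQ 1 1)).add (ten (polyQ 2 0) (var 9))) = true := by
    decide +kernel
  refine (deltaBJEJ_eq h (comulPS_h_mul_gen _)).trans ?_
  simp only [Poly.eval_add, Poly.eval_sub, Poly.eval_smul, eval_ten, eval_mul1, eval_mul2,
    eval_polyQ, eval_one, eval_two, eval_polyEm, eval_polyEp, eval_var, letter, letter2_zero, H1,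
    pow_two]
  norm_num

theorem deltaBJEJ_Em :
    deltaBJEJ Em = Em ⊠ q 0 1 + 1 ⊠ Em - E1 ⊠ E1 * q (-1 / 2) (1 / 2) - (1 / 2 : ℂ) • (Ep ⊠ E1 ^ 2
      * q (-1) 0) := by
  -- The letter of hE_{1-2} is absent from the normal forms of `rules2`, so `polyEm` stands for it.
  have h : isSomeEq (coprodBJEJ 8)
      ((((ten polyEm (polyQ 0 2)).add (ten one polyEm)).sub (ten (var 9) (mul1 (var 9) (polyQ (-1)
        1)))).sub (Poly.smul 1 1 (ten polyEp (mul1 (mul1 (var 9) (var 9)) (polyQ (-2) 0))))) = true := by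
    decide +kernel
  refine (deltaBJEJ_eq h (comulPS_h_mul_gen _)).trans ?_
  simp only [Poly.eval_add, Poly.eval_sub, Poly.eval_smul, eval_ten, eval_mul1, eval_mul2,
    eval_polyQ, eval_one, eval_two, eval_polyEm, eval_polyEp, eval_var, letter, letter2_zero, H1,
    pow_two]
  norm_num

theorem deltaBJEJ_F1 :
    deltaBJEJ F1 = F1 ⊠ q (-1 / 2) (-1 / 2) + 1 ⊠ F1 + h2 * (Hm ⊠ (F2 + (2 : ℂ) • (H1 * E1 * q (-1)
      0) + (1 / 2 : ℂ) • (E1 ^ 2 * E2 * q (-2) 0)) * q 0 (-1)) + h2 * ((1 / 2 : ℂ) • (Hm ⊠ E1 *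
      ((E1 ^ 2 * q (-2) 0 - 2) * q 0 (-1) + 1) * q (-1) (-1))) - h2 * ((1 / 2 : ℂ) • (Hm ^ 2 ⊠ E1 *
      ((E1 ^ 2 * q (-2) 0 - 2) * q 0 (-1) + 2) * q (-1) (-1))) + h2 * (Hm * E2 ⊠ (((3 / 2 : ℂ) •
      (E1 ^ 2 * q (-2) 0) - 1) * q 0 (-1) + 1) * q (-1 / 2) (-1 / 2)) - h2 * (Hp ⊠ E2 * q (-1) 0) +
      h2 * (Hp * Hm ⊠ E1 * q (-2) (-1)) + Fm ⊠ E1 * q (-1) (-1) + h2 * (Hp * E2 ⊠ (1 - q (-1) 0) *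
      q (-1 / 2) (-1 / 2)) - h2 * (E2 ⊠ ((2 : ℂ) • H1 + E1 * E2 * q (-1) 0) * q (-1 / 2) (-1 / 2))
      + h2 * (E2 ^ 2 ⊠ E1 * ((1 / 2 : ℂ) • 1 - q (-1) 0) * q (-1) (-1)) := by
  have h : isSomeEq (coprodBJEJ 2)
      ((((((((((((ten (var 2) (polyQ (-1) (-1))).add (ten one (var 2))).add (mul2 (var 0) (ten (var
        7) (mul1 (((var 4).add (Poly.smul 2 0 (mul1 (mul1 (Poly.smul 1 1 ((var 6).add (var 7)))
        (var 9)) (polyQ (-2) 0)))).add (Poly.smul 1 1 (mul1 (mul1 (mul1 (var 9) (var 9)) (var 5))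
        (polyQ (-4) 0)))) (polyQ 0 (-2)))))).add (mul2 (var 0) (Poly.smul 1 1 (ten (var 7) (mul1
        (mul1 (var 9) ((mul1 ((mul1 (mul1 (var 9) (var 9)) (polyQ (-4) 0)).sub two) (polyQ 0
        (-2))).add one)) (polyQ (-2) (-2))))))).sub (mul2 (var 0) (Poly.smul 1 1 (ten (mul1 (var 7)
        (var 7)) (mul1 (mul1 (var 9) ((mul1 ((mul1 (mul1 (var 9) (var 9)) (polyQ (-4) 0)).sub two)
        (polyQ 0 (-2))).add two)) (polyQ (-2) (-2))))))).add (mul2 (var 0) (ten (mul1 (var 7) (var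
        5)) (mul1 ((mul1 ((Poly.smul 3 1 (mul1 (mul1 (var 9) (var 9)) (polyQ (-4) 0))).sub one)
        (polyQ 0 (-2))).add one) (polyQ (-1) (-1)))))).sub (mul2 (var 0) (ten (var 6) (mul1 (var 5)
        (polyQ (-2) 0))))).add (mul2 (var 0) (ten (mul1 (var 6) (var 7)) (mul1 (var 9) (polyQ (-4)
        (-2)))))).add (ten (var 3) (mul1 (var 9) (polyQ (-2) (-2))))).add (mul2 (var 0) (ten (mul1
        (var 6) (var 5)) (mul1 (one.sub (polyQ (-2) 0)) (polyQ (-1) (-1)))))).sub (mul2 (var 0)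
        (ten (var 5) (mul1 ((Poly.smul 2 0 (Poly.smul 1 1 ((var 6).add (var 7)))).add (mul1 (mul1
        (var 9) (var 5)) (polyQ (-2) 0))) (polyQ (-1) (-1)))))).add (mul2 (var 0) (ten (mul1 (var
        5) (var 5)) (mul1 (mul1 (var 9) ((Poly.smul 1 1 one).sub (polyQ (-2) 0))) (polyQ (-2)
        (-2)))))) = true := by
    decide +kernel
  refine (deltaBJEJ_eq h (comulPS_gen _)).trans ?_
  simp only [Poly.eval_add, Poly.eval_sub, Poly.eval_smul, eval_ten, eval_mul1, eval_mul2,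
    eval_polyQ, eval_one, eval_two, eval_polyEm, eval_polyEp, eval_var, letter, letter2_zero, H1,
    pow_two]
  norm_num

theorem deltaBJEJ_F2 :
    deltaBJEJ F2 = F2 ⊠ q (-1 / 2) (1 / 2) + 1 ⊠ F2 + E2 ⊠ (1 - q 0 (-1)) * q (-1 / 2) (1 / 2) + Hm
      ⊠ E1 * q (-1) (-1) := by
  have h : isSomeEq (coprodBJEJ 4)
      ((((ten (var 4) (polyQ (-1) 1)).add (ten one (var 4))).add (ten (var 5) (mul1 (one.sub (polyQ
        0 (-2))) (polyQ (-1) 1)))).add (ten (var 7) (mul1 (var 9) (polyQ (-2) (-2))))) = true := by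
    decide +kernel
  refine (deltaBJEJ_eq h (comulPS_gen _)).trans ?_
  simp only [Poly.eval_add, Poly.eval_sub, Poly.eval_smul, eval_ten, eval_mul1, eval_mul2,
    eval_polyQ, eval_one, eval_two, eval_polyEm, eval_polyEp, eval_var, letter, letter2_zero, H1,
    pow_two]
  norm_num

theorem deltaBJEJ_Fm :
    deltaBJEJ Fm = Fm ⊠ q 0 (-1) + 1 ⊠ Fm + h2 * (Hm ⊠ ((1 / 2 : ℂ) • (1 + q (-1) 0) - q 0 (-1) +
      (2 : ℂ) • Hm + E1 * q (-1) 0 * ((1 / 2 : ℂ) • (E1 * q (-1) (-1)) + E2)) * q 0 (-1)) + h2 *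
      (Hm * E2 ⊠ E1 * q (-3 / 2) (-3 / 2)) + h2 * (Hm ^ 2 ⊠ ((1 - (1 / 2 : ℂ) • (E1 ^ 2 * q (-2)
      0)) * q 0 (-1) - 1) * q 0 (-1)) - h2 * (E2 ⊠ E2 * q (-1 / 2) (-1 / 2)) + h2 * ((1 / 2 : ℂ) •
      (E2 ^ 2 ⊠ (1 - q (-1) 0) * q 0 (-1))) := by
  have h : isSomeEq (coprodBJEJ 3)
      (((((((ten (var 3) (polyQ 0 (-2))).add (ten one (var 3))).add (mul2 (var 0) (ten (var 7)
        (mul1 ((((Poly.smul 1 1 (one.add (polyQ (-2) 0))).sub (polyQ 0 (-2))).add (Poly.smul 2 0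
        (var 7))).add (mul1 (mul1 (var 9) (polyQ (-2) 0)) ((Poly.smul 1 1 (mul1 (var 9) (polyQ (-2)
        (-2)))).add (var 5)))) (polyQ 0 (-2)))))).add (mul2 (var 0) (ten (mul1 (var 7) (var 5))
        (mul1 (var 9) (polyQ (-3) (-3)))))).add (mul2 (var 0) (ten (mul1 (var 7) (var 7)) (mul1
        ((mul1 (one.sub (Poly.smul 1 1 (mul1 (mul1 (var 9) (var 9)) (polyQ (-4) 0)))) (polyQ 0
        (-2))).sub one) (polyQ 0 (-2)))))).sub (mul2 (var 0) (ten (var 5) (mul1 (var 5) (polyQ (-1)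
        (-1)))))).add (mul2 (var 0) (Poly.smul 1 1 (ten (mul1 (var 5) (var 5)) (mul1 (one.sub
        (polyQ (-2) 0)) (polyQ 0 (-2))))))) = true := by
    decide +kernel
  refine (deltaBJEJ_eq h (comulPS_gen _)).trans ?_
  simp only [Poly.eval_add, Poly.eval_sub, Poly.eval_smul, eval_ten, eval_mul1, eval_mul2,
    eval_polyQ, eval_one, eval_two, eval_polyEm, eval_polyEp, eval_var, letter, letter2_zero, H1,
    pow_two]
  norm_num

theorem deltaBJEJ_Fp :
    deltaBJEJ Fp = Fp ⊠ q (-1) 0 + 1 ⊠ Fp + h2 * (Hm ⊠ ((1 / 2 : ℂ) • (q 0 (-1) - 1) - E1 * F2 * q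
      0 (-1)) * q (-1) 0) + h2 * (Hm ⊠ (q (-1) 0 + (1 / 2 : ℂ) • q 0 (-1) - Hp - (1 / 4 : ℂ) • (E1
      ^ 2 * q (-2) (-1) + 1)) * E1 ^ 2 * q (-2) (-1)) + h2 * ((1 / 2 : ℂ) • (Hm ^ 2 ⊠ (1 - q 0 (-1)
      + (1 / 2 : ℂ) • (E1 ^ 2 * q (-2) (-1))) * E1 ^ 2 * q (-2) (-1))) + h2 * ((Hp ^ 2 - Hp) ⊠ (q
      (-1) 0 - 1) * q (-1) 0) + h2 * ((2 : ℂ) • (Hp ⊠ Hp * q (-1) 0)) - h2 * (Hp * Hm ⊠ E1 ^ 2 * q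
      (-3) (-1)) - F1 ⊠ E1 * q (-3 / 2) (-1 / 2) - (1 / 2 : ℂ) • (Fm ⊠ E1 ^ 2 * q (-2) (-1)) + h2 *
      (E2 ⊠ (F2 + ((2 : ℂ) • Hp - (2 : ℂ) • q (-1) 0 + 1) * E1 * q (-1) 0) * q (-1 / 2) (-1 / 2)) +
      h2 * (E2 ^ 2 ⊠ ((1 / 2 : ℂ) • (q (-1) 0 * (1 - q 0 (-1))) + E1 ^ 2 * q (-2) (-1) * (q (-1) 0
      - (1 / 4 : ℂ) • 1))) + h2 * (Hm * E2 ⊠ (q 0 (-1) - 1 - E1 ^ 2 * q (-2) (-1)) * E1 * q (-3 /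
      2) (-1 / 2)) + h2 * (Hp * E2 ⊠ ((2 : ℂ) • q (-1) 0 - 1) * E1 * q (-3 / 2) (-1 / 2)) := by
  have h : isSomeEq (coprodBJEJ 1)
      ((((((((((((((ten (var 1) (polyQ (-2) 0)).add (ten one (var 1))).add (mul2 (var 0) (ten (var
        7) (mul1 ((Poly.smul 1 1 ((polyQ 0 (-2)).sub one)).sub (mul1 (mul1 (var 9) (var 4)) (polyQ
        0 (-2)))) (polyQ (-2) 0))))).add (mul2 (var 0) (ten (var 7) (mul1 (mul1 ((((polyQ (-2)
        0).add (Poly.smul 1 1 (polyQ 0 (-2)))).sub (var 6)).sub (Poly.smul 1 2 ((mul1 (mul1 (var 9)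
        (var 9)) (polyQ (-4) (-2))).add one))) (mul1 (var 9) (var 9))) (polyQ (-4) (-2)))))).add
        (mul2 (var 0) (Poly.smul 1 1 (ten (mul1 (var 7) (var 7)) (mul1 (mul1 ((one.sub (polyQ 0
        (-2))).add (Poly.smul 1 1 (mul1 (mul1 (var 9) (var 9)) (polyQ (-4) (-2))))) (mul1 (var 9)
        (var 9))) (polyQ (-4) (-2))))))).add (mul2 (var 0) (ten ((mul1 (var 6) (var 6)).sub (var
        6)) (mul1 ((polyQ (-2) 0).sub one) (polyQ (-2) 0))))).add (mul2 (var 0) (Poly.smul 2 0 (ten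
        (var 6) (mul1 (var 6) (polyQ (-2) 0)))))).sub (mul2 (var 0) (ten (mul1 (var 6) (var 7))
        (mul1 (mul1 (var 9) (var 9)) (polyQ (-6) (-2)))))).sub (ten (var 2) (mul1 (var 9) (polyQ
        (-3) (-1))))).sub (Poly.smul 1 1 (ten (var 3) (mul1 (mul1 (var 9) (var 9)) (polyQ (-4)
        (-2)))))).add (mul2 (var 0) (ten (var 5) (mul1 ((var 4).add (mul1 (mul1 (((Poly.smul 2 0
        (var 6)).sub (Poly.smul 2 0 (polyQ (-2) 0))).add one) (var 9)) (polyQ (-2) 0))) (polyQ (-1)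
        (-1)))))).add (mul2 (var 0) (ten (mul1 (var 5) (var 5)) ((Poly.smul 1 1 (mul1 (polyQ (-2)
        0) (one.sub (polyQ 0 (-2))))).add (mul1 (mul1 (mul1 (var 9) (var 9)) (polyQ (-4) (-2)))
        ((polyQ (-2) 0).sub (Poly.smul 1 2 one))))))).add (mul2 (var 0) (ten (mul1 (var 7) (var 5))
        (mul1 (mul1 (((polyQ 0 (-2)).sub one).sub (mul1 (mul1 (var 9) (var 9)) (polyQ (-4) (-2))))
        (var 9)) (polyQ (-3) (-1)))))).add (mul2 (var 0) (ten (mul1 (var 6) (var 5)) (mul1 (mul1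
        ((Poly.smul 2 0 (polyQ (-2) 0)).sub one) (var 9)) (polyQ (-3) (-1)))))) = true := by
    decide +kernel
  refine (deltaBJEJ_eq h (comulPS_gen _)).trans ?_
  simp only [Poly.eval_add, Poly.eval_sub, Poly.eval_smul, eval_ten, eval_mul1, eval_mul2,
    eval_polyQ, eval_one, eval_two, eval_polyEm, eval_polyEp, eval_var, letter, letter2_zero, H1,
    pow_two]
  norm_num

end So5

/-! ### Group-like and primitive elements under conjugation. -/

namespace FormalTwist

open PowerSeries

variable {L : Type*} [LieRing L] [LieAlgebra ℂ L]

theorem commute_exp_tens {a b x y : PowerSeries (U L)} (hb : constantCoeff b = 0)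
    (hx : Commute a x) (hy : Commute b y) : Commute (exp (tens a b)) (tens x y) := by
  refine (commute_exp (So5.constantCoeff_tens a hb) ?_).symm
  have h1 : Commute (leg1 x) (leg1 a) := hx.symm.map leg1
  have h2 : Commute (leg2 y) (leg2 b) := hy.symm.map leg2
  exact ((h1.mul_right (commute_leg1_leg2 x b)).mul_left
    ((commute_leg1_leg2 a y).symm.mul_right h2))

theorem logOneAdd_zero {R : Type*} [Ring R] [Algebra ℂ R] :
    logOneAdd (0 : PowerSeries R) = 0 :=
  logOneAdd_eq_of_exp_eq (map_zero _) (by rw [exp_zero, add_zero])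

/-- If `1 + x` is group-like, then `ln (1 + x)` is primitive. -/
theorem semiconjBy_comulPS_logOneAdd {F : PowerSeries (U2 L)} {x : PowerSeries (U L)}
    (hx : constantCoeff x = 0) (h : SemiconjBy F (comulPS x) (tens x (1 + x) + leg2 x)) :
    SemiconjBy F (comulPS (logOneAdd x)) (leg1 (logOneAdd x) + leg2 (logOneAdd x)) := by
  have h1 : constantCoeff (leg1 x) = 0 := constantCoeff_mapAlgHom _ hx
  have h2 : constantCoeff (leg2 x) = 0 := constantCoeff_mapAlgHom _ hx
  have h3 : constantCoeff (comulPS x) = 0 := constantCoeff_mapAlgHom _ hx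
  have h4 : constantCoeff (tens x (1 + x) + leg2 x) = 0 := by
    rw [tens_eq, map_add, map_mul, h1, h2, zero_mul, add_zero]
  have c1 : constantCoeff (leg1 (logOneAdd x)) = 0 :=
    constantCoeff_mapAlgHom _ (constantCoeff_logOneAdd x)
  have c2 : constantCoeff (leg2 (logOneAdd x)) = 0 :=
    constantCoeff_mapAlgHom _ (constantCoeff_logOneAdd x)
  -- The argument is (1+x)⊗(1+x) - 1, and (1+x)⊗(1+x) is the exponential of the right-hand side
  -- because the two legs commute.
  have h5 : logOneAdd (tens x (1 + x) + leg2 x) = leg1 (logOneAdd x) + leg2 (logOneAdd x) := by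
    refine logOneAdd_eq_of_exp_eq (by rw [map_add, c1, c2, add_zero]) ?_
    rw [exp_add c1 c2 (commute_leg1_leg2 _ _)]
    have e1 : exp (leg1 (logOneAdd x)) = 1 + leg1 x := by
      rw [leg1, ← mapAlgHom_exp, exp_logOneAdd hx, map_add, map_one]
    have e2 : exp (leg2 (logOneAdd x)) = 1 + leg2 x := by
      rw [leg2, ← mapAlgHom_exp, exp_logOneAdd hx, map_add, map_one]
    rw [e1, e2, tens_eq, map_add, map_one]
    noncomm_ring
  have h6 : comulPS (logOneAdd x) = logOneAdd (comulPS x) := mapAlgHom_logOneAdd _ _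
  rw [← h5, h6, logOneAdd_eq_subs, logOneAdd_eq_subs]
  exact semiconjBy_subs h4 h3 h _

/-- If `b` is primitive, then `exp (c b)` is group-like. -/
theorem semiconjBy_comulPS_exp_smul {F : PowerSeries (U2 L)} {b : PowerSeries (U L)}
    (hb : constantCoeff b = 0) (h : SemiconjBy F (comulPS b) (leg1 b + leg2 b)) (c : ℂ) :
    SemiconjBy F (comulPS (exp (c • b))) (leg1 (exp (c • b)) * leg2 (exp (c • b))) := by
  have hcb : constantCoeff (c • b) = 0 := by
    rw [← coeff_zero_eq_constantCoeff_apply, coeff_smul, coeff_zero_eq_constantCoeff_apply, hb,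
      smul_zero]
  have h1 : constantCoeff (leg1 (c • b)) = 0 := constantCoeff_mapAlgHom _ hcb
  have h2 : constantCoeff (leg2 (c • b)) = 0 := constantCoeff_mapAlgHom _ hcb
  have h3 : constantCoeff (comulPS (c • b)) = 0 := constantCoeff_mapAlgHom _ hcb
  rw [leg1, leg2, comulPS, mapAlgHom_exp, mapAlgHom_exp, mapAlgHom_exp]
  change SemiconjBy F (exp (comulPS (c • b))) (exp (leg1 (c • b)) * exp (leg2 (c • b)))
  rw [← exp_add h1 h2 (commute_leg1_leg2 _ _)]
  refine semiconjBy_exp (by rw [map_add, h1, h2, add_zero]) h3 ?_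
  rw [map_smul, map_smul, map_smul, ← smul_add]
  exact h.smul_right c

end FormalTwist

/-! ### The twist property of the three factors. -/

namespace So5

open FormalTwist PowerSeries Rewriting

theorem comulPS_Ep : comulPS Ep = leg1 Ep + leg2 Ep := comulPS_h_mul_gen _

/-- hE_{1+2} has weight 1 for H_{1+2}, so hE_{1+2} ⊗ 1 acquires the factor e^σ = 1 + hE_{1+2}, while
1 ⊗ hE_{1+2} commutes with the twist. -/
theorem semiconjBy_factorJ_Ep :
    SemiconjBy (exp (tens Hp sigma)) (comulPS Ep) (tens Ep (1 + Ep) + leg2 Ep) := by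
  obtain ⟨-, -, -, -, -, h6, -⟩ := Ep_mul
  have h1 := semiconjBy_exp_tens_leg1_of_weight (a := Hp) (b := sigma) (y := Ep) (k := 1)
    constantCoeff_sigma (by rw [h6, one_smul, neg_add_cancel_right])
  have h2 := commute_exp_tens (a := Hp) (b := sigma) (x := 1) (y := Ep) constantCoeff_sigma
    (Commute.one_right _) (commute_sigma (Commute.refl Ep)).symm
  rw [tens_eq 1, map_one, one_mul] at h2
  rw [← q_left, q_one_left] at h1
  rw [comulPS_Ep, tens_eq]
  exact h1.add_right h2

theorem commute_E2_Ep : Commute E2 Ep := by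
  obtain ⟨-, -, -, -, h5, -⟩ := Ep_mul
  exact h5.symm

theorem commute_Hm_Ep : Commute Hm Ep := by
  obtain ⟨-, -, -, -, -, -, h7⟩ := Ep_mul
  exact h7.symm

theorem commute_q_Ep (a : ℂ) : Commute (q a 0) Ep :=
  mul_q_left_of_commute rfl a

theorem semiconjBy_twistEJ_Ep :
    SemiconjBy twistEJ (comulPS Ep) (tens Ep (1 + Ep) + leg2 Ep) := by
  rw [twistEJ_eq]
  refine SemiconjBy.mul_left ?_ semiconjBy_factorJ_Ep
  have hX : Commute (E1 * q (-1 / 2) 0) Ep := commute_Ep_E1.symm.mul_left (commute_q_Ep _)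
  have h1 := commute_exp_tens (constantCoeff_E1_mul (q (-1 / 2) 0)) commute_E2_Ep.neg_left
    ((Commute.one_right _).add_right hX)
  have h2 := commute_exp_tens (constantCoeff_E1_mul (q (-1 / 2) 0)) (Commute.one_right (-E2)) hX
  rw [tens_eq 1, map_one, one_mul] at h2
  exact h1.add_right h2

theorem semiconjBy_twistBJEJ_Ep :
    SemiconjBy twistBJEJ (comulPS Ep) (tens Ep (1 + Ep) + leg2 Ep) := by
  refine SemiconjBy.mul_left ?_ semiconjBy_twistEJ_Ep
  have hX : Commute sigmaBO Ep := (commute_sigmaBO commute_Ep_EBO).symm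
  have h1 := commute_exp_tens constantCoeff_sigmaBO commute_Hm_Ep
    ((Commute.one_right _).add_right hX)
  have h2 := commute_exp_tens constantCoeff_sigmaBO (Commute.one_right Hm) hX
  rw [tens_eq 1, map_one, one_mul] at h2
  exact h1.add_right h2

theorem tens_one_left (x : PowerSeries (U so5)) : tens 1 x = leg2 x := by
  rw [tens_eq, map_one, one_mul]

theorem tens_one_right (x : PowerSeries (U so5)) : tens x 1 = leg1 x := by
  rw [tens_eq, map_one, mul_one]

theorem deltaEJ_Ep : deltaEJ Ep = tens Ep (q 1 0) + tens 1 Ep := by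
  rw [q_one_left, tens_one_left]
  exact twistedComul_eq isUnit_twistEJ semiconjBy_twistEJ_Ep

theorem deltaBJEJ_Ep : deltaBJEJ Ep = tens Ep (q 1 0) + tens 1 Ep := by
  rw [q_one_left, tens_one_left]
  exact twistedComul_eq (isUnit_factorBJ.mul isUnit_twistEJ) semiconjBy_twistBJEJ_Ep

/-- 1 + hE_{1+2} is group-like, so σ is primitive and all powers e^{aσ} are group-like. -/
theorem semiconjBy_twistEJ_q (a : ℂ) :
    SemiconjBy twistEJ (comulPS (q a 0)) (tens (q a 0) (q a 0)) := by
  rw [q_left]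
  exact semiconjBy_comulPS_exp_smul constantCoeff_sigma
    (semiconjBy_comulPS_logOneAdd constantCoeff_Ep semiconjBy_twistEJ_Ep) a

/-- `Δ_{EJ}(h E_1)` as a polynomial. -/
def polyDeltaE1 : Poly :=
  Poly.add (polyTens rules1 (var 9) (polyQ 1 0)) (polyTens rules1 (polyQ 2 0) (var 9))

/-- `Δ_{EJ}(h E_{1-2})` as a polynomial. -/
def polyDeltaEm : Poly :=
  Poly.sub (Poly.sub (Poly.add (shift1 (var 8)) (shift2 (var 8)))
    (polyTens rules1 (var 9) [⟨1, 0, [9, 11]⟩]))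
    (Poly.smul 1 1 (polyTens rules1 polyEp [⟨1, 0, [9, 9, 11, 11]⟩]))

theorem semiconjBy_twistEJ_E1 :
    SemiconjBy twistEJ (comulPS E1) (Poly.eval letter2 polyDeltaE1) :=
  semiconjBy_twistEJ (a := 9) (by decide +kernel) (comulPS_h_mul_gen _)

theorem semiconjBy_twistEJ_Em :
    SemiconjBy twistEJ (comulPS Em) (Poly.eval letter2 polyDeltaEm) :=
  semiconjBy_twistEJ (a := 8) (by decide +kernel) (comulPS_h_mul_gen _)

/-- The reason for the form of E_{BO}: the terms that spoil primitivity of hE_{1-2} cancel against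
the cross terms of ½(hE_1)²e^{-σ}, using that e^{-σ} is group-like. -/
theorem semiconjBy_twistEJ_EBO :
    SemiconjBy twistEJ (comulPS EBO) (leg1 EBO + leg2 EBO) := by
  have hs := rulesTensor_sound rules1_sound
  have h : Poly.isZero (Poly.sub (Poly.add polyDeltaEm (Poly.smul 1 1
      (Poly.mul (rulesTensor rules1) polyDeltaE1 (Poly.mul (rulesTensor rules1) polyDeltaE1
        (polyTens rules1 (polyQ (-2) 0) (polyQ (-2) 0))))))
      (Poly.add (shift1 polyEBO) (shift2 polyEBO))) = true := by decide +kernel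
  have h := Poly.eval_eq_of_isZero_sub letter2 h
  have hq : Poly.eval letter (polyQ (-2) 0) = q (-1) 0 := by
    rw [eval_polyQ]
    norm_num
  simp only [Poly.eval_add, eval_shift1, eval_shift2, eval_polyEBO, Poly.eval_smul,
    Poly.eval_mul _ hs, eval_polyTens rules1_sound, hq, Int.cast_one, pow_one] at h
  rw [← h]
  conv => arg 2; rw [EBO_eq, map_add, map_smul, map_mul, map_mul]
  exact semiconjBy_twistEJ_Em.add_right ((semiconjBy_twistEJ_E1.mul_right
    (semiconjBy_twistEJ_E1.mul_right (semiconjBy_twistEJ_q _))).smul_right _)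

theorem Hm_mul_EBO : Hm * EBO = EBO * Hm + EBO := by
  have h : Poly.isZero (Poly.sub (Poly.comm rules1 (var 7) polyEBO) polyEBO) = true := by
    decide +kernel
  have := eq_eval_comm rules1_sound (var 7) polyEBO
  rwa [Poly.eval_eq_of_isZero_sub letter h, eval_polyEBO, eval_var] at this

/-- E_{BO} is primitive for Δ_{EJ} and has weight 1 for H_{1-2}, so the Jordanian argument used for
(H_{1+2}, hE_{1+2}) repeats for (H_{1-2}, E_{BO}). -/
theorem semiconjBy_twistBJEJ_EBO :
    SemiconjBy twistBJEJ (comulPS EBO) (tens EBO (1 + EBO) + leg2 EBO) := by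
  refine SemiconjBy.mul_left ?_ semiconjBy_twistEJ_EBO
  have h1 := semiconjBy_exp_tens_leg1_of_weight (a := Hm) (b := sigmaBO) (y := EBO) (k := 1)
    constantCoeff_sigmaBO (by rw [Hm_mul_EBO, one_smul])
  have h2 := commute_exp_tens (a := Hm) constantCoeff_sigmaBO (Commute.one_right _)
    (commute_sigmaBO (Commute.refl EBO)).symm
  rw [tens_eq 1, map_one, one_mul] at h2
  rw [← q_right, q_one_right] at h1
  rw [tens_eq]
  exact h1.add_right h2

theorem deltaEJ_EBO : deltaEJ EBO = tens EBO 1 + tens 1 EBO := by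
  rw [tens_one_left, tens_one_right]
  exact twistedComul_eq isUnit_twistEJ semiconjBy_twistEJ_EBO

theorem deltaBJEJ_EBO : deltaBJEJ EBO = tens EBO (q 0 1) + tens 1 EBO := by
  rw [q_one_right, tens_one_left]
  exact twistedComul_eq (isUnit_factorBJ.mul isUnit_twistEJ) semiconjBy_twistBJEJ_EBO

theorem counitRightHom_leg2_h_mul_gen (x : so5) : counitRightHom (leg2 (h * gen x)) = 0 := by
  have : counitRightHom (leg2 (gen x)) = 0 := counitRightHom_leg2_C_ι x
  rw [map_mul, map_mul, this, mul_zero]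

theorem counitRightHom_leg2_logOneAdd {x : PowerSeries (U so5)}
    (hx : counitRightHom (leg2 x) = 0) : counitRightHom (leg2 (logOneAdd x)) = 0 := by
  rw [leg2, mapAlgHom_logOneAdd, counitRightHom, mapAlgHom_logOneAdd]
  change logOneAdd (counitRightHom (leg2 x)) = 0
  rw [hx, logOneAdd_zero]

theorem isTwist_factorJ : IsTwist 1 (exp (tens Hp sigma)) := by
  refine isTwist_exp_tens (g := 1) isUnit_one constantCoeff_sigma (Commute.one_left _)
    (Commute.one_left _) ?_ ?_ (counitLeftHom_leg1_C_ι _)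
    (counitRightHom_leg2_logOneAdd (counitRightHom_leg2_h_mul_gen _))
  · rw [tens_one_right, Hp, comulPS_gen]
    exact SemiconjBy.one_left _
  · rw [mul_one, tens_one_left]
    exact semiconjBy_comulPS_logOneAdd constantCoeff_Ep semiconjBy_factorJ_Ep

/-- Here g = e^{σ/2}: the first factor gives -E_2 ⊗ e^{σ/2} - 1 ⊗ E_2, and multiplying Δ_{EJ}(hE_1)
by the group-like e^{-σ/2} gives the required coproduct of hE_1 e^{-σ/2}. -/
theorem isTwist_factorE :
    IsTwist (exp (tens Hp sigma)) (exp (tens (-E2) (E1 * q (-1 / 2) 0))) := by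
  refine isTwist_exp_tens (g := q (1 / 2) 0) (isUnit_exp_tens _ constantCoeff_sigma)
    (constantCoeff_E1_mul _) ?_ ?_ ?_ ?_ ?_ ?_
  · exact Commute.neg_right (mul_q_left_of_commute commute_E2_Ep.symm.eq _)
  · refine Commute.mul_right (mul_q_left_of_commute commute_Ep_E1.eq _) ?_
    rw [Commute, SemiconjBy, q_mul_q, q_mul_q, add_comm]
  · have h1 := tableConj_tableJ (10, [⟨1, 0, [10, 21]⟩]) (exists_mem_of_lookup rfl)
    have h2 := tableConj_tableJ (11, [⟨1, 0, [11]⟩]) (exists_mem_of_lookup rfl)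
    simp only [Poly.eval_cons, Poly.eval_nil, Term.eval, List.map_cons, List.map_nil,
      List.prod_cons, List.prod_nil, mul_one, add_zero, Int.cast_one, pow_zero, div_one,
      one_smul] at h1 h2
    have := (h1.add_right h2).neg_right
    rw [map_neg, E2, comulPS_gen, tens_eq (-_), map_neg, map_neg, neg_mul, ← neg_add]
    exact this
  · have hs := rulesTensor_sound rules1_sound
    have h : Poly.isZero (Poly.sub (Poly.mul (rulesTensor rules1) polyDeltaE1
        (polyTens rules1 (polyQ (-1) 0) (polyQ (-1) 0)))
        (Poly.add (shift1 polyX) (polyTens rules1 (polyQ 1 0) polyX))) = true := by decide +kernel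
    have h := Poly.eval_eq_of_isZero_sub letter2 h
    have hq : Poly.eval letter (polyQ (-1) 0) = q (-1 / 2) 0 := by
      rw [eval_polyQ]
      norm_num
    have hq' : Poly.eval letter (polyQ 1 0) = q (1 / 2) 0 := by
      rw [eval_polyQ]
      norm_num
    simp only [Poly.eval_add, eval_shift1, Poly.eval_mul _ hs, eval_polyTens rules1_sound, hq,
      hq', eval_polyX] at h
    rw [← h, map_mul, ← twistEJ_eq]
    exact semiconjBy_twistEJ_E1.mul_right (semiconjBy_twistEJ_q _)
  · rw [map_neg, map_neg, E2, gen, counitLeftHom_leg1_C_ι, neg_zero]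
  · rw [map_mul, map_mul, E1, counitRightHom_leg2_h_mul_gen, zero_mul]

theorem isTwist_twistEJ : IsTwist 1 twistEJ := by
  rw [twistEJ_eq]
  exact isTwist_factorJ.mul isTwist_factorE

theorem isTwist_factorBJ : IsTwist twistEJ factorBJ := by
  refine isTwist_exp_tens (g := 1) isUnit_twistEJ constantCoeff_sigmaBO (Commute.one_left _)
    (Commute.one_left _) ?_ ?_ (counitLeftHom_leg1_C_ι _)
    (counitRightHom_leg2_logOneAdd ?_)
  · have := semiconjBy_twistEJ (a := 7) (r := Poly.add (shift1 (var 7)) (shift2 (var 7)))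
      (by decide +kernel) (comulPS_gen _)
    rwa [Poly.eval_add, eval_shift1, eval_shift2, eval_var, ← tens_one_right] at this
  · rw [tens_one_left]
    exact semiconjBy_comulPS_logOneAdd constantCoeff_EBO semiconjBy_twistBJEJ_EBO
  · have h1 : counitRightHom (leg2 E1) = 0 := counitRightHom_leg2_h_mul_gen _
    have h2 : counitRightHom (leg2 Em) = 0 := counitRightHom_leg2_h_mul_gen _
    simp only [EBO, pow_two, map_add, map_smul, map_mul, h1, h2, zero_mul, smul_zero, add_zero]

theorem isTwist_twistBJEJ : IsTwist 1 twistBJEJ := isTwist_twistEJ.mul isTwist_factorBJ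

end So5

/-! ### Series with coefficients in a subalgebra, and invariance of U(L⁽⁶⁾). -/

namespace FormalTwist

open PowerSeries

section

variable {R S : Type*} [Ring R] [Algebra ℂ R] [Ring S] [Algebra ℂ S]

/-- The power series with coefficients in a subalgebra. -/
def coeffSubalgebra (A : Subalgebra ℂ R) : Subalgebra ℂ (PowerSeries R) where
  carrier := {f | ∀ n, coeff n f ∈ A}
  mul_mem' {f g} hf hg n := by
    rw [coeff_mul]
    exact A.sum_mem fun p _ => A.mul_mem (hf _) (hg _)
  add_mem' {f g} hf hg n := by
    rw [map_add]
    exact A.add_mem (hf n) (hg n)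
  algebraMap_mem' c n := by
    rw [Algebra.algebraMap_eq_smul_one, coeff_smul, coeff_one]
    split_ifs
    · exact A.smul_mem A.one_mem c
    · rw [smul_zero]
      exact A.zero_mem

theorem mem_coeffSubalgebra {A : Subalgebra ℂ R} {f : PowerSeries R} :
    f ∈ coeffSubalgebra A ↔ ∀ n, coeff n f ∈ A := Iff.rfl

/-- Each coefficient of an exponential is a finite combination, so no closure of the subalgebra is
needed. -/
theorem exp_mem {A : Subalgebra ℂ R} {x : PowerSeries R} (hx : x ∈ coeffSubalgebra A) :
    exp x ∈ coeffSubalgebra A := fun n => by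
  rw [exp, coeff_mk]
  exact A.sum_mem fun k _ => A.smul_mem (pow_mem hx k n) _

theorem logOneAdd_mem {A : Subalgebra ℂ R} {x : PowerSeries R} (hx : x ∈ coeffSubalgebra A) :
    logOneAdd x ∈ coeffSubalgebra A := fun n => by
  rw [logOneAdd, coeff_mk]
  exact A.sum_mem fun k _ => A.smul_mem (pow_mem hx k n) _

theorem C_mem {A : Subalgebra ℂ R} {x : R} (hx : x ∈ A) : C x ∈ coeffSubalgebra A := fun n => by
  rw [coeff_C]
  split_ifs
  · exact hx
  · exact A.zero_mem

theorem X_mem (A : Subalgebra ℂ R) : X ∈ coeffSubalgebra A := fun n => by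
  rw [coeff_X]
  split_ifs
  · exact A.one_mem
  · exact A.zero_mem

theorem inverse_exp_mem {A : Subalgebra ℂ R} {x : PowerSeries R} (h0 : constantCoeff x = 0)
    (hx : x ∈ coeffSubalgebra A) : Ring.inverse (exp x) ∈ coeffSubalgebra A := by
  have h1 : Ring.inverse (exp x) = exp (-x) := by
    rw [← one_mul (exp (-x)), ← Ring.inverse_mul_cancel _ (isUnit_exp h0), mul_assoc,
      exp_mul_exp_neg h0, mul_one]
  rw [h1]
  exact exp_mem (neg_mem hx)

end

variable {L : Type*} [LieRing L] [LieAlgebra ℂ L]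

theorem tens_mem {A : Subalgebra ℂ (U L)} {a b : PowerSeries (U L)} (ha : a ∈ coeffSubalgebra A)
    (hb : b ∈ coeffSubalgebra A) :
    tens a b ∈ coeffSubalgebra (Algebra.TensorProduct.map A.val A.val).range := by
  rw [tens_eq]
  refine mul_mem (fun n => ?_) (fun n => ?_)
  · exact ⟨⟨_, ha n⟩ ⊗ₜ 1, by simp [leg1, mapAlgHom_apply]⟩
  · exact ⟨1 ⊗ₜ ⟨_, hb n⟩, by simp [leg2, mapAlgHom_apply]⟩

/-- The generators are primitive and Δ is multiplicative; the set `s` need not span a Lie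
subalgebra. -/
theorem comul_mem_of_adjoin {s : Set L} {x : U L}
    (hx : x ∈ Algebra.adjoin ℂ (UniversalEnvelopingAlgebra.ι ℂ '' s)) :
    comul L x ∈ (Algebra.TensorProduct.map
      (Algebra.adjoin ℂ (UniversalEnvelopingAlgebra.ι ℂ '' s)).val
      (Algebra.adjoin ℂ (UniversalEnvelopingAlgebra.ι ℂ '' s)).val).range := by
  set A := Algebra.adjoin ℂ (UniversalEnvelopingAlgebra.ι ℂ '' s)
  induction hx using Algebra.adjoin_induction with
  | mem x hx =>
    have hA : x ∈ A := Algebra.subset_adjoin hx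
    obtain ⟨y, -, rfl⟩ := hx
    rw [comul_ι]
    exact ⟨(⟨_, hA⟩ : A) ⊗ₜ 1 + 1 ⊗ₜ ⟨_, hA⟩, by simp⟩
  | algebraMap r =>
    rw [AlgHom.commutes]
    exact Subalgebra.algebraMap_mem _ r
  | add x y _ _ hx hy =>
    rw [map_add]
    exact add_mem hx hy
  | mul x y _ _ hx hy =>
    rw [map_mul]
    exact mul_mem hx hy

end FormalTwist

namespace So5

open FormalTwist PowerSeries

theorem gen_mem_UL6 {x : so5}
    (hx : x ∈ ({rootHp, rootEp, rootHm, rootEm, rootE1, rootE2} : Set so5)) :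
    gen x ∈ coeffSubalgebra UL6 :=
  C_mem (Algebra.subset_adjoin (Set.mem_image_of_mem _ hx))

theorem h_mem_UL6 : h ∈ coeffSubalgebra UL6 := X_mem _

theorem sigma_mem_UL6 : sigma ∈ coeffSubalgebra UL6 :=
  logOneAdd_mem (mul_mem h_mem_UL6 (gen_mem_UL6 (by simp)))

theorem E1_mem_UL6 : E1 ∈ coeffSubalgebra UL6 := mul_mem h_mem_UL6 (gen_mem_UL6 (by simp))

theorem sigmaBO_mem_UL6 : sigmaBO ∈ coeffSubalgebra UL6 :=
  logOneAdd_mem (add_mem (mul_mem h_mem_UL6 (gen_mem_UL6 (by simp)))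
    (Subalgebra.smul_mem _ (mul_mem (pow_mem E1_mem_UL6 2) (exp_mem (neg_mem sigma_mem_UL6))) _))

/-- The exponents of all three factors are built from the generators of U(L⁽⁶⁾), and the inverse of
exp(x) is exp(-x). So the twist, its inverse and the undeformed coproduct all have coefficients in
the image of the tensor square of `UL6`. -/
theorem coeff_deltaBJEJ_mem {x : U so5} (hx : x ∈ UL6) (n : ℕ) :
    coeff n (deltaBJEJ (C x)) ∈ (Algebra.TensorProduct.map UL6.val UL6.val).range := by
  revert n
  rw [← mem_coeffSubalgebra]
  set A := coeffSubalgebra (Algebra.TensorProduct.map UL6.val UL6.val).range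
  have hJ : tens Hp sigma ∈ A := tens_mem (gen_mem_UL6 (by simp)) sigma_mem_UL6
  have hB : tens Hm sigmaBO ∈ A := tens_mem (gen_mem_UL6 (by simp)) sigmaBO_mem_UL6
  have hE : tens (-E2) (E1 * q (-1 / 2) 0) ∈ A := by
    refine tens_mem (neg_mem (gen_mem_UL6 (by simp))) (mul_mem E1_mem_UL6 ?_)
    rw [q_left]
    exact exp_mem (Subalgebra.smul_mem _ sigma_mem_UL6 _)
  have cJ := constantCoeff_tens Hp constantCoeff_sigma
  have cB := constantCoeff_tens Hm constantCoeff_sigmaBO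
  have cE := constantCoeff_tens (-E2) (constantCoeff_E1_mul (q (-1 / 2) 0))
  rw [deltaBJEJ, twistedComul_def, twistBJEJ,
    Ring.inverse_mul_of_isUnit isUnit_factorBJ isUnit_twistEJ, twistEJ_eq,
    Ring.inverse_mul_of_isUnit (isUnit_exp cE) (isUnit_exp cJ), factorBJ]
  refine mul_mem (mul_mem (mul_mem (exp_mem hB) (mul_mem (exp_mem hE) (exp_mem hJ))) ?_)
    (mul_mem (mul_mem (inverse_exp_mem cJ hJ) (inverse_exp_mem cE hE)) (inverse_exp_mem cB hB))
  have : comulPS (C x) = C (comul so5 x) := by simp [comulPS, mapAlgHom_apply]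
  rw [this]
  exact C_mem (comul_mem_of_adjoin hx)

end So5

theorem mainTheorem3 :
    -- `F_{EJ}` is a twist of `U(so(5))`, with coproducts on the generators of the carrier
    IsTwist 1 twistEJ ∧
    deltaEJ Hp = Hp ⊠ q (-1) 0 + 1 ⊠ Hp + E2 ⊠ E1 * q (-3 / 2) 0 ∧
    deltaEJ Ep = Ep ⊠ q 1 0 + 1 ⊠ Ep ∧
    deltaEJ E2 = E2 ⊠ q (-1 / 2) 0 + 1 ⊠ E2 ∧
    deltaEJ E1 = E1 ⊠ q (1 / 2) 0 + q 1 0 ⊠ E1 ∧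
    deltaEJ Em = Em ⊠ 1 + 1 ⊠ Em - E1 ⊠ E1 * q (-1 / 2) 0
      - (1 / 2 : ℂ) • (Ep ⊠ E1 ^ 2 * q (-1) 0) ∧
    -- `H_{1-2}` and `E_{BO}` are primitive for `Δ_{EJ}`
    deltaEJ Hm = Hm ⊠ 1 + 1 ⊠ Hm ∧
    deltaEJ EBO = EBO ⊠ 1 + 1 ⊠ EBO ∧
    -- `Φ_{BJ}` is a twist of the twisted algebra, and `F_{BJEJ}` is a twist of `U(so(5))`
    IsTwist twistEJ factorBJ ∧
    IsTwist 1 twistBJEJ ∧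
    IsTwistedBialgebra twistBJEJ ∧
    (∀ x ∈ UL6, ∀ n : ℕ, PowerSeries.coeff n (deltaBJEJ (PowerSeries.C x)) ∈
      (Algebra.TensorProduct.map UL6.val UL6.val).range) ∧
    -- the coproducts `Δ_{BJEJ}`
    deltaBJEJ Hp = Hp ⊠ q (-1) 0 + 1 ⊠ Hp + E2 ⊠ E1 * q (-3 / 2) (-1 / 2)
      - (1 / 2 : ℂ) • (Hm ⊠ E1 ^ 2 * q (-2) (-1)) ∧
    deltaBJEJ Hm = Hm ⊠ q 0 (-1) + 1 ⊠ Hm ∧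
    deltaBJEJ Ep = Ep ⊠ q 1 0 + 1 ⊠ Ep ∧
    deltaBJEJ E2 = E2 ⊠ q (-1 / 2) (-1 / 2) + 1 ⊠ E2 - Hm ⊠ E1 * q (-1) (-1) ∧
    deltaBJEJ E1 = E1 ⊠ q (1 / 2) (1 / 2) + q 1 0 ⊠ E1 ∧
    deltaBJEJ Em = Em ⊠ q 0 1 + 1 ⊠ Em - E1 ⊠ E1 * q (-1 / 2) (1 / 2)
      - (1 / 2 : ℂ) • (Ep ⊠ E1 ^ 2 * q (-1) 0) ∧
    deltaBJEJ EBO = EBO ⊠ q 0 1 + 1 ⊠ EBO ∧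
    deltaBJEJ F1 = F1 ⊠ q (-1 / 2) (-1 / 2) + 1 ⊠ F1
      + h2 * (Hm ⊠ (F2 + (2 : ℂ) • (H1 * E1 * q (-1) 0)
          + (1 / 2 : ℂ) • (E1 ^ 2 * E2 * q (-2) 0)) * q 0 (-1))
      + h2 * ((1 / 2 : ℂ) • (Hm ⊠ E1 * ((E1 ^ 2 * q (-2) 0 - 2) * q 0 (-1) + 1) * q (-1) (-1)))
      - h2 * ((1 / 2 : ℂ) • (Hm ^ 2 ⊠ E1 * ((E1 ^ 2 * q (-2) 0 - 2) * q 0 (-1) + 2) * q (-1) (-1)))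
      + h2 * (Hm * E2 ⊠ (((3 / 2 : ℂ) • (E1 ^ 2 * q (-2) 0) - 1) * q 0 (-1) + 1)
          * q (-1 / 2) (-1 / 2))
      - h2 * (Hp ⊠ E2 * q (-1) 0)
      + h2 * (Hp * Hm ⊠ E1 * q (-2) (-1))
      + Fm ⊠ E1 * q (-1) (-1)
      + h2 * (Hp * E2 ⊠ (1 - q (-1) 0) * q (-1 / 2) (-1 / 2))
      - h2 * (E2 ⊠ ((2 : ℂ) • H1 + E1 * E2 * q (-1) 0) * q (-1 / 2) (-1 / 2))
      + h2 * (E2 ^ 2 ⊠ E1 * ((1 / 2 : ℂ) • 1 - q (-1) 0) * q (-1) (-1)) ∧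
    deltaBJEJ F2 = F2 ⊠ q (-1 / 2) (1 / 2) + 1 ⊠ F2
      + E2 ⊠ (1 - q 0 (-1)) * q (-1 / 2) (1 / 2)
      + Hm ⊠ E1 * q (-1) (-1) ∧
    deltaBJEJ Fm = Fm ⊠ q 0 (-1) + 1 ⊠ Fm
      + h2 * (Hm ⊠ ((1 / 2 : ℂ) • (1 + q (-1) 0) - q 0 (-1) + (2 : ℂ) • Hm
          + E1 * q (-1) 0 * ((1 / 2 : ℂ) • (E1 * q (-1) (-1)) + E2)) * q 0 (-1))
      + h2 * (Hm * E2 ⊠ E1 * q (-3 / 2) (-3 / 2))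
      + h2 * (Hm ^ 2 ⊠ ((1 - (1 / 2 : ℂ) • (E1 ^ 2 * q (-2) 0)) * q 0 (-1) - 1) * q 0 (-1))
      - h2 * (E2 ⊠ E2 * q (-1 / 2) (-1 / 2))
      + h2 * ((1 / 2 : ℂ) • (E2 ^ 2 ⊠ (1 - q (-1) 0) * q 0 (-1))) ∧
    deltaBJEJ Fp = Fp ⊠ q (-1) 0 + 1 ⊠ Fp
      + h2 * (Hm ⊠ ((1 / 2 : ℂ) • (q 0 (-1) - 1) - E1 * F2 * q 0 (-1)) * q (-1) 0)
      + h2 * (Hm ⊠ (q (-1) 0 + (1 / 2 : ℂ) • q 0 (-1) - Hp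
          - (1 / 4 : ℂ) • (E1 ^ 2 * q (-2) (-1) + 1)) * E1 ^ 2 * q (-2) (-1))
      + h2 * ((1 / 2 : ℂ) • (Hm ^ 2 ⊠ (1 - q 0 (-1) + (1 / 2 : ℂ) • (E1 ^ 2 * q (-2) (-1)))
          * E1 ^ 2 * q (-2) (-1)))
      + h2 * ((Hp ^ 2 - Hp) ⊠ (q (-1) 0 - 1) * q (-1) 0)
      + h2 * ((2 : ℂ) • (Hp ⊠ Hp * q (-1) 0))
      - h2 * (Hp * Hm ⊠ E1 ^ 2 * q (-3) (-1))
      - F1 ⊠ E1 * q (-3 / 2) (-1 / 2)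
      - (1 / 2 : ℂ) • (Fm ⊠ E1 ^ 2 * q (-2) (-1))
      + h2 * (E2 ⊠ (F2 + ((2 : ℂ) • Hp - (2 : ℂ) • q (-1) 0 + 1) * E1 * q (-1) 0)
          * q (-1 / 2) (-1 / 2))
      + h2 * (E2 ^ 2 ⊠ ((1 / 2 : ℂ) • (q (-1) 0 * (1 - q 0 (-1)))
          + E1 ^ 2 * q (-2) (-1) * (q (-1) 0 - (1 / 4 : ℂ) • 1)))
      + h2 * (Hm * E2 ⊠ (q 0 (-1) - 1 - E1 ^ 2 * q (-2) (-1)) * E1 * q (-3 / 2) (-1 / 2))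
      + h2 * (Hp * E2 ⊠ ((2 : ℂ) • q (-1) 0 - 1) * E1 * q (-3 / 2) (-1 / 2)) := by
  exact ⟨isTwist_twistEJ, deltaEJ_Hp, deltaEJ_Ep, deltaEJ_E2, deltaEJ_E1, deltaEJ_Em, deltaEJ_Hm,
    deltaEJ_EBO, isTwist_factorBJ, isTwist_twistBJEJ, isTwist_twistBJEJ.isTwistedBialgebra,
    fun _ hx n => coeff_deltaBJEJ_mem hx n, deltaBJEJ_Hp, deltaBJEJ_Hm, deltaBJEJ_Ep, deltaBJEJ_E2,
    deltaBJEJ_E1, deltaBJEJ_Em, deltaBJEJ_EBO, deltaBJEJ_F1, deltaBJEJ_F2, deltaBJEJ_Fm,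
    deltaBJEJ_Fp⟩
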